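/- Let $\omega>2$ be a real number such that the integer product of two $n\times n$ matrices with entries in $\{0,1\}$ can be computed in $O(n^{\omega})$ time. Then there is an algorithm with running time $O(n^{\omega})$ that does the following. It is given a graph $G$ drawn in the plane with straight edges (possibly with crossings) whose vertices are the vertices of a convex $n$-gon $C$, $n\ge 3$; the vertices are numbered $0,\dots,n-1$ in counterclockwise order along $C$, and $G$ is given by its $n\times n$ adjacency matrix. The algorithm determines whether $G$ contains a triangulation of $C$, and, if it does, returns the adjacency matrix of such a triangulation. Here a triangulation of $C$ is a maximal set of pairwise noncrossing segments between vertices of $C$ (so it contains the $n$ sides of $C$), and $G$ contains it if all its segments are edges of $G$. The model of computation, for both matrix multiplication and the algorithm, is a random access machine with words of $O(\log n)$ bits on which each arithmetic operation ($+,-,\times$, integer division), memory access and test of a register takes one step. -/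

import Mathlib

/-! ### Geometry: convex polygons and their triangulations -/

/-- Twice the signed area of the triangle `x y z`; it is positive iff `x, y, z` make a
strict left turn (counterclockwise). -/
def orientation (x y z : EuclideanSpace ℝ (Fin 2)) : ℝ :=
  (y 0 - x 0) * (z 1 - x 1) - (y 1 - x 1) * (z 0 - x 0)

/-- `p 0, …, p (n-1)` are the vertices of a (strictly) convex `n`-gon, listed in
counterclockwise order along its boundary. -/
def IsConvexPolygon {n : ℕ} (p : Fin n → EuclideanSpace ℝ (Fin 2)) : Prop :=
  3 ≤ n ∧ ∀ i j k : Fin n, i < j → j < k → 0 < orientation (p i) (p j) (p k)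

/-- The graph `T`, drawn with vertex `i` at the point `p i` and with straight edges, has no
crossings: the relative interiors of distinct edges are disjoint. -/
def IsNoncrossing {n : ℕ} (p : Fin n → EuclideanSpace ℝ (Fin 2))
    (T : SimpleGraph (Fin n)) : Prop :=
  ∀ a b c d : Fin n, T.Adj a b → T.Adj c d → s(a, b) ≠ s(c, d) →
    Disjoint (openSegment ℝ (p a) (p b)) (openSegment ℝ (p c) (p d))

/-- `T` is (the set of all edges of) a triangulation of the convex polygon with vertices `p`:
a maximal set of pairwise noncrossing segments between vertices of the polygon. All these
segments lie in the polygon since it is convex, and the sides of the polygon, which no segment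
crosses, always belong to a maximal set. -/
def IsTriangulation {n : ℕ} (p : Fin n → EuclideanSpace ℝ (Fin 2))
    (T : SimpleGraph (Fin n)) : Prop :=
  Maximal (IsNoncrossing p) T

/-! ### The machine: a unit-cost random access machine with words of `O(log n)` bits -/

/-- The arithmetic operations of the machine. -/
inductive ArithOp where
  | add
  | sub
  | mul
  | div

/-- Natural number arithmetic; subtraction truncates at `0` and division rounds down
(with `x / 0 = 0`). -/
def ArithOp.eval : ArithOp → ℕ → ℕ → ℕ
  | .add, x, y => x + y
  | .sub, x, y => x - y
  | .mul, x, y => x * y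
  | .div, x, y => x / y

/-- The elementary instructions. Registers are named by natural numbers. -/
inductive Instr where
  /-- register `d` := the constant `c` -/
  | const (d c : ℕ)
  /-- register `d` := register `a` `o` register `b` -/
  | arith (o : ArithOp) (d a b : ℕ)
  /-- register `d` := the memory cell whose address is in register `a` -/
  | load (d a : ℕ)
  /-- the memory cell whose address is in register `a` := register `b` -/
  | store (a b : ℕ)

/-- Programs: elementary instructions with structured control flow. A program is a finite
object, fixed once for all inputs; it mentions only finitely many registers. -/
inductive Program where
  | skip
  | instr (i : Instr)
  | seq (P Q : Program)
  /-- run `P` if register `r` is nonzero, else `Q` -/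
  | ifNonzero (r : ℕ) (P Q : Program)
  /-- run `P` as long as register `r` is nonzero -/
  | whileNonzero (r : ℕ) (P : Program)

/-- The contents of the registers and of the memory cells. -/
structure MachineState where
  reg : ℕ → ℕ
  mem : ℕ → ℕ

/-- The number that an instruction writes when it is executed in the state `s`. -/
def Instr.written (s : MachineState) : Instr → ℕ
  | .const _ c => c
  | .arith o _ a b => o.eval (s.reg a) (s.reg b)
  | .load _ a => s.mem (s.reg a)
  | .store _ b => s.reg b

/-- The state after the execution of an instruction. -/
def Instr.next (s : MachineState) (i : Instr) : MachineState :=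
  match i with
  | .const d _ => { s with reg := Function.update s.reg d (i.written s) }
  | .arith _ d _ _ => { s with reg := Function.update s.reg d (i.written s) }
  | .load d _ => { s with reg := Function.update s.reg d (i.written s) }
  | .store a _ => { s with mem := Function.update s.mem (s.reg a) (i.written s) }

/-- `Exec W P s t s'`: the program `P`, started in the state `s`, halts in the state `s'` after
exactly `t` steps, and every number it writes to a register or to the memory is less than `W`.
(A program that would write a number `≥ W` gets stuck: overflow.) Each elementary instruction
and each test of a register takes one step. -/
inductive Exec (W : ℕ) : Program → MachineState → ℕ → MachineState → Prop
  | skip (s : MachineState) : Exec W .skip s 1 s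
  | instr (i : Instr) (s : MachineState) (h : i.written s < W) :
      Exec W (.instr i) s 1 (i.next s)
  | seq {P Q : Program} {s s₁ s₂ : MachineState} {t₁ t₂ : ℕ}
      (h₁ : Exec W P s t₁ s₁) (h₂ : Exec W Q s₁ t₂ s₂) :
      Exec W (.seq P Q) s (t₁ + t₂) s₂
  | ifTrue {r : ℕ} {P Q : Program} {s s₁ : MachineState} {t : ℕ}
      (hr : s.reg r ≠ 0) (h : Exec W P s t s₁) :
      Exec W (.ifNonzero r P Q) s (1 + t) s₁
  | ifFalse {r : ℕ} {P Q : Program} {s s₁ : MachineState} {t : ℕ}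
      (hr : s.reg r = 0) (h : Exec W Q s t s₁) :
      Exec W (.ifNonzero r P Q) s (1 + t) s₁
  | whileDone {r : ℕ} {P : Program} {s : MachineState} (hr : s.reg r = 0) :
      Exec W (.whileNonzero r P) s 1 s
  | whileStep {r : ℕ} {P : Program} {s s₁ s₂ : MachineState} {t₁ t₂ : ℕ}
      (hr : s.reg r ≠ 0) (h₁ : Exec W P s t₁ s₁)
      (h₂ : Exec W (.whileNonzero r P) s₁ t₂ s₂) :
      Exec W (.whileNonzero r P) s (1 + t₁ + t₂) s₂

/-- The `n × n` matrix `M` is stored in the memory row by row, from the address `base` on. -/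
def StoredAt {n : ℕ} (mem : ℕ → ℕ) (base : ℕ) (M : Matrix (Fin n) (Fin n) ℕ) : Prop :=
  ∀ i j : Fin n, mem (base + (i : ℕ) * n + (j : ℕ)) = M i j

/-- The initial state common to all inputs of size `n` that occupy the first `len` memory
cells: `n` is in register `0`; all other registers, and all other memory cells, are `0`. -/
def MachineState.IsInitial (s : MachineState) (n len : ℕ) : Prop :=
  s.reg 0 = n ∧ (∀ r, r ≠ 0 → s.reg r = 0) ∧ ∀ a, len ≤ a → s.mem a = 0

/-! ### The two computational problems -/

/-- The product (over the integers) of two `n × n` matrices with entries in `{0, 1}` can be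
computed in time `O(n ^ ω)`, on a machine with words of `O(log n)` bits: one program does it
for all `n ≥ 1`, given the factors in the first `2 * n * n` memory cells, and leaves the product
in the `n * n` cells that follow. -/
def MatrixMultiplicationInTime (ω : ℝ) : Prop :=
  ∃ (P : Program) (k : ℕ) (K : ℝ), ∀ (n : ℕ), 1 ≤ n →
    ∀ A B : Matrix (Fin n) (Fin n) ℕ, (∀ i j, A i j ≤ 1) → (∀ i j, B i j ≤ 1) →
    ∀ s : MachineState, s.IsInitial n (2 * (n * n)) →
      StoredAt s.mem 0 A → StoredAt s.mem (n * n) B →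
      ∃ (t : ℕ) (s' : MachineState), Exec ((n + 2) ^ k) P s t s' ∧
        (t : ℝ) ≤ K * (n : ℝ) ^ ω ∧ StoredAt s'.mem (2 * (n * n)) (A * B)

open Classical in
/-- The `0`-`1` adjacency matrix of a graph. -/
noncomputable def adjacencyMatrix {n : ℕ} (G : SimpleGraph (Fin n)) :
    Matrix (Fin n) (Fin n) ℕ :=
  G.adjMatrix ℕ

/-- The answer of the algorithm in the final state `s'` is correct: register `0` tells whether
`G` contains a triangulation of the polygon and, if so, the adjacency matrix of such a
triangulation is stored in the memory from the address `n * n` on. -/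
def IsCorrectAnswer {n : ℕ} (p : Fin n → EuclideanSpace ℝ (Fin 2)) (G : SimpleGraph (Fin n))
    (s' : MachineState) : Prop :=
  (s'.reg 0 = 1 ∧
    ∃ T : SimpleGraph (Fin n), IsTriangulation p T ∧ T ≤ G ∧
      StoredAt s'.mem (n * n) (adjacencyMatrix T)) ∨
  (s'.reg 0 = 0 ∧ ¬ ∃ T : SimpleGraph (Fin n), IsTriangulation p T ∧ T ≤ G)

/-! ### Expressions and commands compiled to the machine -/

/-! Two segments between vertices of a convex polygon cross exactly when their endpoints interleave
(`IsConvexPolygon.isNoncrossing_iff`), so the problem is combinatorial: G contains a triangulation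
iff the segment from 0 to n - 1 is `Good`, that is, an edge that is a side or splits at some k into
two good segments (`IsTriangulation.good`, `Splits.isTriangulation`). Evaluated cell by cell this
recursion takes cubic time. As in Valiant's parsing algorithm it is to be replaced by Boolean matrix
products, although the matrix to be multiplied by itself is the unknown one.

The order of evaluation resolves this. Let N = 2 ^ L be at least n, give the segment ij the
coordinates N - 1 - i and j, and visit the cells in the order of the interleaved bits of their
coordinates (Morton order), so that each dyadic square of side 2 ^ l is a run of 4 ^ l consecutive
ranks. For i < k < j take the last level l at which the dyadic block of k differs from that of i and
from that of j (`exists_separates`). There the block of k is the sibling just before the block of i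
(counted from the right) or of j. The cells ik and kj then lie in squares of side 2 ^ l that are
completed before the square of ij begins. So when the scan reaches the first rank c = 4 ^ l * q of a
square, with q not divisible by 4, at most two products of 2 ^ l × 2 ^ l matrices with known entries
account for all splittings of level l in that square (`SplitTable.step`). When the scan arrives at
the cell ij itself, every level has been accounted for (`SplitTable.good_iff`).

Level l < L occurs at 3 * 4 ^ (L - l - 1) ranks, so the total cost is a geometric sum of terms 4 ^
(L - l) * 2 ^ (l * ω), dominated by 2 ^ (L * ω) because 2 ^ ω > 4 (`sum_level_rpow_le`). A
triangulation is then found by recursive splitting with linear search, in quadratic time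
(`Triple.processSegment`).

What remains is to run this on the machine. `Triple` is a Hoare logic with time bounds. The given
multiplication program is relocated and called as a subroutine (`Triple.call`). It expects zeros
behind its input, so every call receives a fresh stretch of memory and nothing has to be erased.
There are O(n²) calls, each consuming polynomially many addresses, so words of O(log n) bits
suffice. -/

theorem Exec.mono {W W' : ℕ} (h : W ≤ W') {P : Program} {s s' : MachineState} {t : ℕ}
    (hP : Exec W P s t s') : Exec W' P s t s' := by
  induction hP with
  | skip s => exact .skip s
  | instr i s hi => exact .instr i s (hi.trans_le h)
  | seq _ _ ih₁ ih₂ => exact .seq ih₁ ih₂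
  | ifTrue hr _ ih => exact .ifTrue hr ih
  | ifFalse hr _ ih => exact .ifFalse hr ih
  | whileDone hr => exact .whileDone hr
  | whileStep hr _ _ ih₁ ih₂ => exact .whileStep hr ih₁ ih₂

/-- Arithmetic expressions over the registers. -/
inductive Expr where
  | lit (c : ℕ)
  | var (r : ℕ)
  | bin (o : ArithOp) (a b : Expr)

namespace Expr

instance : Add Expr := ⟨bin .add⟩
instance : Sub Expr := ⟨bin .sub⟩
instance : Mul Expr := ⟨bin .mul⟩
instance : Div Expr := ⟨bin .div⟩

def eval (v : ℕ → ℕ) : Expr → ℕ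
  | lit c => c
  | var r => v r
  | bin o a b => o.eval (a.eval v) (b.eval v)

@[simp] theorem eval_lit (v : ℕ → ℕ) (c : ℕ) : (lit c).eval v = c := rfl
@[simp] theorem eval_var (v : ℕ → ℕ) (r : ℕ) : (var r).eval v = v r := rfl
@[simp] theorem eval_add (v : ℕ → ℕ) (a b : Expr) : (a + b).eval v = a.eval v + b.eval v := rfl
@[simp] theorem eval_sub (v : ℕ → ℕ) (a b : Expr) : (a - b).eval v = a.eval v - b.eval v := rfl
@[simp] theorem eval_mul (v : ℕ → ℕ) (a b : Expr) : (a * b).eval v = a.eval v * b.eval v := rfl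
@[simp] theorem eval_div (v : ℕ → ℕ) (a b : Expr) : (a / b).eval v = a.eval v / b.eval v := rfl

/-- The number of leaves. -/
def size : Expr → ℕ
  | lit _ => 1
  | var _ => 1
  | bin _ a b => a.size + b.size

/-- Only named registers (those below `32`) and constants up to `8` occur. -/
def named : Expr → Bool
  | lit c => decide (c ≤ 8)
  | var r => decide (r < 32)
  | bin _ a b => a.named && b.named

/-- The expressions that the commands below accept. -/
def simple (e : Expr) : Bool := e.named && decide (e.size ≤ 8)

theorem size_pos (e : Expr) : 1 ≤ e.size := by
  induction e with
  | lit => exact le_rfl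
  | var => exact le_rfl
  | bin o a b iha ihb => simp only [size]; omega

theorem eval_congr {v w : ℕ → ℕ} (h : ∀ r < 32, v r = w r) {e : Expr} (he : e.named) :
    e.eval v = e.eval w := by
  induction e with
  | lit => rfl
  | var r => exact h r (by simpa [named] using he)
  | bin o a b iha ihb =>
    simp only [named, Bool.and_eq_true] at he
    simp only [eval, iha he.1, ihb he.2]

/-- If x, y ≥ 2 bound the operands, then x * y bounds the result of every operation, the sum
included. The exponent therefore counts leaves. -/
theorem eval_le {B : ℕ} (hB : 8 ≤ B) {v : ℕ → ℕ} (h : ∀ r < 32, v r ≤ B) {e : Expr}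
    (he : e.named) : e.eval v ≤ B ^ e.size := by
  induction e with
  | lit c =>
    simp only [named, decide_eq_true_eq] at he
    simpa [size] using he.trans hB
  | var r =>
    simp only [named, decide_eq_true_eq] at he
    simpa [size] using h r he
  | bin o a b iha ihb =>
    simp only [named, Bool.and_eq_true] at he
    have ha := iha he.1
    have hb := ihb he.2
    have h1 : 2 ≤ B ^ a.size :=
      (by omega : 2 ≤ B).trans (Nat.le_self_pow (by have := a.size_pos; omega) B)
    have h2 : 2 ≤ B ^ b.size :=
      (by omega : 2 ≤ B).trans (Nat.le_self_pow (by have := b.size_pos; omega) B)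
    simp only [eval, size, pow_add]
    generalize B ^ a.size = x at *
    generalize B ^ b.size = y at *
    cases o with
    | add => simp only [ArithOp.eval]; nlinarith
    | sub =>
      simp only [ArithOp.eval]
      exact (Nat.sub_le _ _).trans (ha.trans (Nat.le_mul_of_pos_right _ (by omega)))
    | mul => exact Nat.mul_le_mul ha hb
    | div =>
      exact (Nat.div_le_self _ _).trans (ha.trans (Nat.le_mul_of_pos_right _ (by omega)))

/-- Evaluate the expression into register `t`, using the registers from `t` on. -/
def compile : ℕ → Expr → Program
  | t, lit c => .instr (.const t c)
  | t, var r => .seq (.instr (.const t 0)) (.instr (.arith .add t r t))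
  | t, bin o a b => .seq (compile t a) (.seq (compile (t + 1) b) (.instr (.arith o t t (t + 1))))

/-- A leaf takes at most 2 steps, and an expression has one operator fewer than leaves, whence 3 *
size - 1. The first operand survives in register t because the second uses only registers from t + 1
on. -/
theorem exec_compile {W B : ℕ} (hB : 8 ≤ B) (hW : B ^ 8 < W) (e : Expr) (he : e.named)
    (h8 : e.size ≤ 8) (s : MachineState) (t : ℕ) (ht : 32 ≤ t) (hs : ∀ r < 32, s.reg r ≤ B) :
    ∃ m s', Exec W (e.compile t) s m s' ∧ m ≤ 3 * e.size - 1 ∧ s'.mem = s.mem ∧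
      (∀ r < t, s'.reg r = s.reg r) ∧ s'.reg t = e.eval s.reg := by
  have hpos : 0 < W := by omega
  have hlt : ∀ e : Expr, e.named → e.size ≤ 8 → ∀ v : ℕ → ℕ, (∀ r < 32, v r ≤ B) →
      e.eval v < W := fun e he h8 v hv =>
    ((eval_le hB hv he).trans (Nat.pow_le_pow_right (by omega) h8)).trans_lt hW
  induction e generalizing s t with
  | lit c =>
    refine ⟨1, _, .instr _ _ ?_, by simp [size], rfl, ?_, ?_⟩
    · exact hlt (lit c) he h8 s.reg hs
    · intro r hr
      exact Function.update_of_ne (by omega) _ _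
    · exact Function.update_self _ _ _
  | var r =>
    have hr : r < 32 := by simpa [named] using he
    have hrt : r ≠ t := by omega
    refine ⟨1 + 1, _, .seq (.instr _ _ ?_) (.instr _ _ ?_), by simp [size], rfl, ?_, ?_⟩
    · exact hpos
    · simpa [Instr.written, Instr.next, ArithOp.eval, Function.update_of_ne hrt] using
        hlt (var r) he h8 s.reg hs
    · intro r' hr'
      have : r' ≠ t := by omega
      simp [Instr.next, Function.update_of_ne this]
    · simp [Instr.written, Instr.next, ArithOp.eval, Function.update_of_ne hrt]
  | bin o a b iha ihb =>
    have hsz := h8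
    simp only [size] at hsz
    have hnm := he
    simp only [named, Bool.and_eq_true] at hnm
    have := a.size_pos
    have := b.size_pos
    obtain ⟨m₁, s₁, h₁, hm₁, hmem₁, hreg₁, hv₁⟩ := iha hnm.1 (by omega) s t ht hs
    obtain ⟨m₂, s₂, h₂, hm₂, hmem₂, hreg₂, hv₂⟩ := ihb hnm.2 (by omega) s₁ (t + 1) (by omega)
      (fun r hr => (hreg₁ r (by omega)).trans_le (hs r hr))
    have ha : s₂.reg t = a.eval s.reg := (hreg₂ t (by omega)).trans hv₁
    have hb : s₂.reg (t + 1) = b.eval s.reg :=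
      hv₂.trans (eval_congr (fun r hr => hreg₁ r (by omega)) hnm.2)
    refine ⟨m₁ + (m₂ + 1), _, .seq h₁ (.seq h₂ (.instr _ _ ?_)), ?_, ?_, ?_, ?_⟩
    · simpa [Instr.written, ha, hb, eval] using hlt _ he h8 s.reg hs
    · simp only [size]; omega
    · simp [Instr.next, hmem₂, hmem₁]
    · intro r hr
      have : r ≠ t := by omega
      simp [Instr.next, Function.update_of_ne this, hreg₂ r (by omega), hreg₁ r hr]
    · simp [Instr.next, Instr.written, ha, hb, eval]

end Expr

/-! ### A Hoare logic for total correctness with time bounds -/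

namespace MachineState

def set (σ : MachineState) (r x : ℕ) : MachineState :=
  { σ with reg := Function.update σ.reg r x }

def put (σ : MachineState) (a x : ℕ) : MachineState :=
  { σ with mem := Function.update σ.mem a x }

@[simp] theorem set_reg (σ : MachineState) (r x r' : ℕ) :
    (σ.set r x).reg r' = if r' = r then x else σ.reg r' := by
  simp [set, Function.update_apply]

@[simp] theorem set_mem (σ : MachineState) (r x : ℕ) : (σ.set r x).mem = σ.mem := rfl

@[simp] theorem put_reg (σ : MachineState) (a x : ℕ) : (σ.put a x).reg = σ.reg := rfl

@[simp] theorem put_mem (σ : MachineState) (a x a' : ℕ) :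
    (σ.put a x).mem a' = if a' = a then x else σ.mem a' := by
  simp [put, Function.update_apply]

/-- The states have the same memory and agree on the named registers. -/
def Agree (s σ : MachineState) : Prop := s.mem = σ.mem ∧ ∀ r < 32, s.reg r = σ.reg r

/-- The contents of the named registers are at most `B`. -/
def Small (B : ℕ) (σ : MachineState) : Prop := ∀ r < 32, σ.reg r ≤ B

end MachineState

open MachineState

/-- Total correctness with a time bound: from every state that agrees with `σ`, the program
halts within `T` steps in a state that agrees with one in `Q`. The named registers are kept
at most `B`, where `B ^ 8` is less than the overflow bound `W`. -/
def Triple (W B : ℕ) (P : Program) (σ : MachineState) (T : ℕ) (Q : MachineState → Prop) : Prop :=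
  8 ≤ B → B ^ 8 < W → Small B σ → ∀ s, Agree s σ →
    ∃ t s' σ', Exec W P s t s' ∧ t ≤ T ∧ Agree s' σ' ∧ Small B σ' ∧ Q σ'

def assign (r : ℕ) (e : Expr) : Program :=
  .seq (e.compile 32) (.seq (.instr (.const 33 0)) (.instr (.arith .add r 32 33)))

def loadC (r : ℕ) (e : Expr) : Program := .seq (e.compile 32) (.instr (.load r 32))

def storeC (a e : Expr) : Program :=
  .seq (a.compile 32) (.seq (e.compile 33) (.instr (.store 32 33)))

def ifC (e : Expr) (P Q : Program) : Program := .seq (e.compile 32) (.ifNonzero 32 P Q)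

def whileC (e : Expr) (P : Program) : Program :=
  .seq (e.compile 32) (.whileNonzero 32 (.seq P (e.compile 32)))

namespace Triple

variable {W B T T' T₁ T₂ : ℕ} {P P₁ P₂ : Program} {σ : MachineState}
  {Q Q' : MachineState → Prop}

theorem mono (h : Triple W B P σ T Q) (hT : T ≤ T') (hQ : ∀ σ', Q σ' → Q' σ') :
    Triple W B P σ T' Q' := by
  intro hB hW hs s hag
  obtain ⟨t, s', σ', hE, ht, hA, hS, hq⟩ := h hB hW hs s hag
  exact ⟨t, s', σ', hE, ht.trans hT, hA, hS, hQ _ hq⟩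

theorem of_small (h : Small B σ → Triple W B P σ T Q) : Triple W B P σ T Q :=
  fun h₁ h₂ hs => h hs h₁ h₂ hs

theorem of_eight (h : 8 ≤ B → Triple W B P σ T Q) : Triple W B P σ T Q :=
  fun h₁ => h h₁ h₁

/-- The postcondition of the first program is the triple of the second, so proofs run forward
through the states without naming intermediate assertions. -/
theorem seq (h₁ : Triple W B P₁ σ T₁ (fun σ' => Triple W B P₂ σ' T₂ Q)) (hT : T₁ + T₂ ≤ T) :
    Triple W B (.seq P₁ P₂) σ T Q := by
  intro hB hW hs s hag
  obtain ⟨t₁, s₁, σ₁, hE₁, ht₁, hA₁, hS₁, h₂⟩ := h₁ hB hW hs s hag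
  obtain ⟨t₂, s₂, σ₂, hE₂, ht₂, hA₂, hS₂, hq⟩ := h₂ hB hW hS₁ s₁ hA₁
  exact ⟨_, s₂, σ₂, .seq hE₁ hE₂, by omega, hA₂, hS₂, hq⟩

theorem skip (hT : 1 ≤ T) (h : Q σ) : Triple W B .skip σ T Q :=
  fun _ _ hs s hag => ⟨1, s, σ, .skip s, hT, hag, hs, h⟩

theorem compile {e : Expr} (he : e.simple) (hB : 8 ≤ B) (hW : B ^ 8 < W) (hs : Small B σ)
    {s : MachineState} (hag : Agree s σ) {t : ℕ} (ht : 32 ≤ t) :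
    ∃ m s', Exec W (e.compile t) s m s' ∧ m ≤ 23 ∧ Agree s' σ ∧
      (∀ r < t, s'.reg r = s.reg r) ∧ s'.reg t = e.eval σ.reg := by
  simp only [Expr.simple, Bool.and_eq_true, decide_eq_true_eq] at he
  obtain ⟨m, s', hE, hm, hmem, hreg, hv⟩ := Expr.exec_compile hB hW e he.1 he.2 s t ht
    (fun r hr => (hag.2 r hr).trans_le (hs r hr))
  exact ⟨m, s', hE, by omega,
    ⟨hmem.trans hag.1, fun r hr => (hreg r (by omega)).trans (hag.2 r hr)⟩, hreg,
    hv.trans (Expr.eval_congr hag.2 he.1)⟩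

theorem small_set (hs : Small B σ) {r x : ℕ} (hx : x ≤ B) : Small B (σ.set r x) := by
  intro r' hr'
  rw [set_reg]
  split_ifs
  · exact hx
  · exact hs r' hr'

/-- The flat charge of 50 steps covers every elementary command: a simple expression takes at most 3
* 8 - 1 = 23 steps, and a store evaluates two of them. -/
theorem assign {r : ℕ} {e : Expr} (he : e.simple) (hv : e.eval σ.reg ≤ B)
    (hT : 50 ≤ T) (h : Q (σ.set r (e.eval σ.reg))) :
    Triple W B (assign r e) σ T Q := by
  intro hB hW hs s hag
  have := Nat.le_self_pow (show 8 ≠ 0 by norm_num) B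
  obtain ⟨m, s₁, hE, hm, hA, -, hx⟩ := compile he hB hW hs hag (t := 32) le_rfl
  refine ⟨_, _, _, .seq hE (.seq (.instr _ _ ?_) (.instr _ _ ?_)), ?_, ?_, small_set hs hv, h⟩
  · simp only [Instr.written]; omega
  · simp only [Instr.written, Instr.next, ArithOp.eval, Function.update_self, add_zero]
    rw [Function.update_of_ne (by norm_num), hx]
    omega
  · omega
  · refine ⟨hA.1, fun r' hr' => ?_⟩
    have : r' ≠ 33 := by omega
    simp [Instr.written, Instr.next, ArithOp.eval, Function.update_apply, hx, this, hA.2 r' hr']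

theorem load {r : ℕ} {e : Expr} (he : e.simple) (hv : σ.mem (e.eval σ.reg) ≤ B)
    (hT : 50 ≤ T) (h : Q (σ.set r (σ.mem (e.eval σ.reg)))) :
    Triple W B (loadC r e) σ T Q := by
  intro hB hW hs s hag
  have := Nat.le_self_pow (show 8 ≠ 0 by norm_num) B
  obtain ⟨m, s₁, hE, hm, hA, -, hx⟩ := compile he hB hW hs hag (t := 32) le_rfl
  refine ⟨_, _, _, .seq hE (.instr _ _ ?_), ?_, ?_, small_set hs hv, h⟩
  · simp only [Instr.written, hx, hA.1]; omega
  · omega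
  · refine ⟨hA.1, fun r' hr' => ?_⟩
    simp [Instr.written, Instr.next, Function.update_apply, hx, hA.1, hA.2 r' hr']

/-- No bound by B is demanded: that bound concerns registers only, and a stored value merely has to
be less than W, which follows from B ^ 8 < W. -/
theorem store {a e : Expr} (ha : a.simple) (he : e.simple) (hT : 50 ≤ T)
    (h : Q (σ.put (a.eval σ.reg) (e.eval σ.reg))) :
    Triple W B (storeC a e) σ T Q := by
  intro hB hW hs s hag
  obtain ⟨m₁, s₁, hE₁, hm₁, hA₁, -, hx₁⟩ := compile ha hB hW hs hag (t := 32) le_rfl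
  obtain ⟨m₂, s₂, hE₂, hm₂, hA₂, hr₂, hx₂⟩ :=
    compile he hB hW hs hA₁ (t := 33) (by norm_num)
  have hx₁' : s₂.reg 32 = a.eval σ.reg := (hr₂ 32 (by norm_num)).trans hx₁
  refine ⟨_, _, σ.put _ _, .seq hE₁ (.seq hE₂ (.instr _ _ ?_)), ?_, ?_, hs, h⟩
  · simp only [Instr.written, hx₂]
    simp only [Expr.simple, Bool.and_eq_true, decide_eq_true_eq] at he
    exact ((Expr.eval_le hB hs he.1).trans (Nat.pow_le_pow_right (by omega) he.2)).trans_lt hW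
  · omega
  · refine ⟨?_, fun r' hr' => hA₂.2 r' hr'⟩
    simp [Instr.written, Instr.next, hx₁', hx₂, hA₂.1, put]

theorem ifC {e : Expr} (he : e.simple) (hT : T₁ + 50 ≤ T)
    (h₁ : e.eval σ.reg ≠ 0 → Triple W B P₁ σ T₁ Q)
    (h₂ : e.eval σ.reg = 0 → Triple W B P₂ σ T₁ Q) :
    Triple W B (ifC e P₁ P₂) σ T Q := by
  intro hB hW hs s hag
  obtain ⟨m, s₁, hE, hm, hA, -, hx⟩ := compile he hB hW hs hag (t := 32) le_rfl
  by_cases h0 : e.eval σ.reg = 0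
  · obtain ⟨t, s', σ', hE', ht, hA', hS, hq⟩ := h₂ h0 hB hW hs s₁ hA
    exact ⟨_, s', σ', .seq hE (.ifFalse (hx.trans h0) hE'), by omega, hA', hS, hq⟩
  · obtain ⟨t, s', σ', hE', ht, hA', hS, hq⟩ := h₁ h0 hB hW hs s₁ hA
    exact ⟨_, s', σ', .seq hE (.ifTrue (by rwa [hx]) hE'), by omega, hA', hS, hq⟩

/-- The loop rule: the invariant carries a potential that pays for the body. -/
theorem whileC {e : Expr} (he : e.simple) (Inv : ℕ → MachineState → Prop) {φ : ℕ}
    (hT : φ + 50 ≤ T)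
    (hbody : ∀ φ σ, Inv φ σ → e.eval σ.reg ≠ 0 → ∃ φ' T', T' + 50 + φ' ≤ φ ∧
      Triple W B P σ T' (Inv φ'))
    (h0 : Inv φ σ) :
    Triple W B (whileC e P) σ T (fun σ' => e.eval σ'.reg = 0 ∧ ∃ φ', Inv φ' σ') := by
  intro hB hW hs s hag
  -- Strong induction on the potential. In each round the surplus of 50 pays for the test and for
  -- evaluating the guard again.
  have key : ∀ φ σ, Inv φ σ → Small B σ → ∀ s, Agree s σ → s.reg 32 = e.eval σ.reg →
      ∃ t s' σ', Exec W (.whileNonzero 32 (.seq P (e.compile 32))) s t s' ∧ t ≤ φ + 1 ∧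
        Agree s' σ' ∧ Small B σ' ∧ e.eval σ'.reg = 0 ∧ ∃ φ', Inv φ' σ' := by
    intro φ
    induction φ using Nat.strong_induction_on with
    | _ φ ih =>
      intro σ hI hs s hag hx
      by_cases h0 : e.eval σ.reg = 0
      · exact ⟨1, s, σ, .whileDone (hx.trans h0), by omega, hag, hs, h0, φ, hI⟩
      · obtain ⟨φ', T', hle, hTr⟩ := hbody φ σ hI h0
        obtain ⟨t₁, s₁, σ₁, hE₁, ht₁, hA₁, hS₁, hI₁⟩ := hTr hB hW hs s hag
        obtain ⟨m, s₂, hE₂, hm, hA₂, -, hx₂⟩ := compile he hB hW hS₁ hA₁ (t := 32) le_rfl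
        obtain ⟨t₃, s₃, σ₃, hE₃, ht₃, hA₃, hS₃, h0₃, hI₃⟩ :=
          ih φ' (by omega) σ₁ hI₁ hS₁ s₂ hA₂ hx₂
        exact ⟨_, s₃, σ₃, .whileStep (by rwa [hx]) (.seq hE₁ hE₂) hE₃, by omega, hA₃, hS₃,
          h0₃, hI₃⟩
  obtain ⟨m, s₁, hE, hm, hA, -, hx⟩ := compile he hB hW hs hag (t := 32) le_rfl
  obtain ⟨t, s', σ', hE', ht, hA', hS', hq⟩ := key φ σ h0 hs s₁ hA hx
  exact ⟨_, s', σ', .seq hE hE', by omega, hA', hS', hq⟩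

theorem seq_assign {r : ℕ} {e : Expr} (he : e.simple) (hv : e.eval σ.reg ≤ B)
    (hT : 50 ≤ T) (h : Triple W B P (σ.set r (e.eval σ.reg)) (T - 50) Q) :
    Triple W B (.seq (_root_.assign r e) P) σ T Q :=
  seq (T₁ := 50) (T₂ := T - 50) (assign he hv le_rfl h) (by omega)

theorem seq_load {r : ℕ} {e : Expr} (he : e.simple) (hv : σ.mem (e.eval σ.reg) ≤ B)
    (hT : 50 ≤ T) (h : Triple W B P (σ.set r (σ.mem (e.eval σ.reg))) (T - 50) Q) :
    Triple W B (.seq (loadC r e) P) σ T Q :=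
  seq (T₁ := 50) (T₂ := T - 50) (load he hv le_rfl h) (by omega)

theorem seq_store {a e : Expr} (ha : a.simple) (he : e.simple) (hT : 50 ≤ T)
    (h : Triple W B P (σ.put (a.eval σ.reg) (e.eval σ.reg)) (T - 50) Q) :
    Triple W B (.seq (storeC a e) P) σ T Q :=
  seq (T₁ := 50) (T₂ := T - 50) (store ha he le_rfl h) (by omega)

end Triple

/-- Run `P` with register `r` equal to `0, 1, …` as long as it is less than register `b`. -/
def forUp (r b : ℕ) (P : Program) : Program :=
  .seq (assign r (.lit 0)) (whileC (.var b - .var r) (.seq P (assign r (.var r + .lit 1))))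

/-- The body leaves the counter at i, and the invariant for i + 1 is required of the state after the
increment. The 100 extra steps per round are 50 for the increment and 50 for the loop. -/
theorem Triple.forUp {W B T T' : ℕ} {P : Program} {σ : MachineState} {r b m : ℕ}
    (hr : r < 32) (hb : b < 32) (hne : b ≠ r) (Inv : ℕ → MachineState → Prop)
    (hm : σ.reg b = m) (hT : (m + 1) * (T' + 100) + 100 ≤ T)
    (h0 : Inv 0 (σ.set r 0))
    (hstep : ∀ i < m, ∀ σ, Inv i σ → σ.reg r = i → σ.reg b = m → Triple W B P σ T'
      (fun σ' => σ'.reg r = i ∧ σ'.reg b = m ∧ Inv (i + 1) (σ'.set r (i + 1)))) :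
    Triple W B (forUp r b P) σ T (fun σ' => Inv m σ' ∧ σ'.reg r = m ∧ σ'.reg b = m) := by
  have hsimple : (Expr.var b - Expr.var r).simple := by
    change ((decide (b < 32) && decide (r < 32)) && decide (1 + 1 ≤ 8)) = true
    simp [hr, hb]
  have hsimple' : (Expr.var r + Expr.lit 1).simple := by
    change ((decide (r < 32) && decide (1 ≤ 8)) && decide (1 + 1 ≤ 8)) = true
    simp [hr]
  refine seq_assign rfl (by simp) (by omega) ?_
  refine (whileC (φ := m * (T' + 100)) hsimple
    (fun φ σ => ∃ i ≤ m, Inv i σ ∧ σ.reg r = i ∧ σ.reg b = m ∧ φ = (m - i) * (T' + 100))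
    (by rw [add_mul, one_mul] at hT; omega) ?_ ?_).mono (le_refl (T - 50)) ?_
  · rintro φ σ ⟨i, hi, hI, hri, hbm, rfl⟩ hlt
    simp only [Expr.eval_sub, Expr.eval_var, hri, hbm] at hlt
    have him : i < m := by omega
    refine ⟨(m - (i + 1)) * (T' + 100), T' + 50, ?_, ?_⟩
    · obtain ⟨d, rfl⟩ : ∃ d, m = i + 1 + d := ⟨m - (i + 1), by omega⟩
      rw [show i + 1 + d - i = d + 1 by omega, show i + 1 + d - (i + 1) = d by omega, add_mul]
      omega
    · refine seq (T₂ := 50) ((hstep i him σ hI hri hbm).mono le_rfl ?_) le_rfl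
      rintro σ' ⟨h1, h2, h3⟩
      -- The new counter is at most m, the content of register b, which is known to be at most B.
      refine of_small fun hs => assign hsimple' ?_ le_rfl ⟨i + 1, him, ?_, ?_, ?_, rfl⟩
      · have := hs b hb
        simp only [Expr.eval_add, Expr.eval_var, Expr.eval_lit]
        omega
      · simpa [h1] using h3
      · simp [h1]
      · simp [hne, h2]
  · refine ⟨0, Nat.zero_le _, h0, by simp, ?_, by simp⟩
    simp [hne, hm]
  · rintro σ' ⟨h0, φ', i, hi, hI, h1, h2, -⟩
    simp only [Expr.eval_sub, Expr.eval_var, h1, h2] at h0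
    have : i = m := by omega
    subst this
    exact ⟨hI, h1, h2⟩

/-! ### Relocating a program -/

namespace Instr

/-- The registers of the instruction are below `N`. -/
def RegsBelow (N : ℕ) : Instr → Prop
  | const d _ => d < N
  | arith _ d a b => d < N ∧ a < N ∧ b < N
  | load d a => d < N ∧ a < N
  | store a b => a < N ∧ b < N

theorem RegsBelow.mono {N N' : ℕ} (h : N ≤ N') {i : Instr} (hi : i.RegsBelow N) :
    i.RegsBelow N' := by
  cases i <;> simp only [RegsBelow] at hi ⊢ <;> omega

theorem exists_regsBelow (i : Instr) : ∃ N, i.RegsBelow N := by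
  cases i with
  | const d c => exact ⟨d + 1, by simp [RegsBelow]⟩
  | arith o d a b => exact ⟨d + a + b + 1, by simp only [RegsBelow]; omega⟩
  | load d a => exact ⟨d + a + 1, by simp only [RegsBelow]; omega⟩
  | store a b => exact ⟨a + b + 1, by simp only [RegsBelow]; omega⟩

/-- Rename register `r` to `64 + r` and offset all addresses by register `f`. -/
def reloc (f : ℕ) : Instr → Program
  | const d c => .instr (.const (64 + d) c)
  | arith o d a b => .instr (.arith o (64 + d) (64 + a) (64 + b))
  | load d a => .seq (.instr (.arith .add 40 f (64 + a))) (.instr (.load (64 + d) 40))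
  | store a b => .seq (.instr (.arith .add 40 f (64 + a))) (.instr (.store 40 (64 + b)))

end Instr

namespace Program

/-- The registers of the program are below `N`. -/
def RegsBelow (N : ℕ) : Program → Prop
  | skip => True
  | instr i => i.RegsBelow N
  | seq P Q => P.RegsBelow N ∧ Q.RegsBelow N
  | ifNonzero r P Q => r < N ∧ P.RegsBelow N ∧ Q.RegsBelow N
  | whileNonzero r P => r < N ∧ P.RegsBelow N

theorem RegsBelow.mono {N N' : ℕ} (h : N ≤ N') {P : Program} (hP : P.RegsBelow N) :
    P.RegsBelow N' := by
  induction P with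
  | skip => trivial
  | instr i => exact Instr.RegsBelow.mono h hP
  | seq P Q ihP ihQ => exact ⟨ihP hP.1, ihQ hP.2⟩
  | ifNonzero r P Q ihP ihQ => exact ⟨hP.1.trans_le h, ihP hP.2.1, ihQ hP.2.2⟩
  | whileNonzero r P ih => exact ⟨hP.1.trans_le h, ih hP.2⟩

theorem exists_regsBelow (P : Program) : ∃ N, P.RegsBelow N := by
  induction P with
  | skip => exact ⟨0, trivial⟩
  | instr i => exact i.exists_regsBelow
  | seq P Q ihP ihQ =>
    obtain ⟨a, ha⟩ := ihP
    obtain ⟨b, hb⟩ := ihQ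
    exact ⟨a + b, ha.mono (by omega), hb.mono (by omega)⟩
  | ifNonzero r P Q ihP ihQ =>
    obtain ⟨a, ha⟩ := ihP
    obtain ⟨b, hb⟩ := ihQ
    exact ⟨r + 1 + a + b, by omega, ha.mono (by omega), hb.mono (by omega)⟩
  | whileNonzero r P ih =>
    obtain ⟨a, ha⟩ := ih
    exact ⟨r + 1 + a, by omega, ha.mono (by omega)⟩

/-- Rename register `r` to `64 + r` and offset all addresses by register `f`. -/
def reloc (f : ℕ) : Program → Program
  | skip => skip
  | instr i => i.reloc f
  | seq P Q => seq (P.reloc f) (Q.reloc f)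
  | ifNonzero r P Q => ifNonzero (64 + r) (P.reloc f) (Q.reloc f)
  | whileNonzero r P => whileNonzero (64 + r) (P.reloc f)

/-- Set the registers `64, …, 63 + N` to zero. -/
def clear : ℕ → Program
  | 0 => skip
  | N + 1 => seq (clear N) (instr (.const (64 + N) 0))

/-- Run `P` on a machine of its own whose memory starts at the address in register `f`, with
register `0` equal to register `m`. -/
def call (f m N : ℕ) (P : Program) : Program :=
  seq (clear (N + 1)) (seq (instr (.arith .add 64 64 m)) (P.reloc f))

end Program

/-- `s` contains the state `σ` of a program with registers below `N`, relocated to `base`. -/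
structure Simulates (W base N : ℕ) (σ s : MachineState) : Prop where
  reg : ∀ r < N, s.reg (64 + r) = σ.reg r
  lt : ∀ r < N, σ.reg r < W
  mem : ∀ a < W, s.mem (base + a) = σ.mem a

/-- `s'` differs from `s` only in the unnamed registers and in the memory from `base` to
`base + W - 1`. -/
structure SameOutside (W base : ℕ) (s s' : MachineState) : Prop where
  reg : ∀ r < 32, s'.reg r = s.reg r
  mem : ∀ a, a < base ∨ base + W ≤ a → s'.mem a = s.mem a

theorem SameOutside.trans {W base : ℕ} {s₁ s₂ s₃ : MachineState}
    (h₁ : SameOutside W base s₁ s₂) (h₂ : SameOutside W base s₂ s₃) :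
    SameOutside W base s₁ s₃ :=
  ⟨fun r hr => (h₂.reg r hr).trans (h₁.reg r hr), fun a ha => (h₂.mem a ha).trans (h₁.mem a ha)⟩

theorem SameOutside.refl (W base : ℕ) (s : MachineState) : SameOutside W base s s :=
  ⟨fun _ _ => rfl, fun _ _ => rfl⟩

theorem Simulates.set {W base N : ℕ} {σ s : MachineState} (h : Simulates W base N σ s)
    {d x : ℕ} (hx : x < W) : Simulates W base N (σ.set d x) (s.set (64 + d) x) := by
  refine ⟨fun r hr => ?_, fun r hr => ?_, h.mem⟩
  · simp [h.reg r hr]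
  · rw [set_reg]
    split_ifs
    · exact hx
    · exact h.lt r hr

theorem SameOutside.set {W base : ℕ} (s : MachineState) {d : ℕ} (hd : 32 ≤ d) (x : ℕ) :
    SameOutside W base s (s.set d x) := by
  refine ⟨fun r hr => ?_, fun _ _ => rfl⟩
  rw [set_reg, if_neg (by omega)]

theorem Simulates.put {W base N : ℕ} {σ s : MachineState} (h : Simulates W base N σ s)
    (a x : ℕ) : Simulates W base N (σ.put a x) (s.put (base + a) x) := by
  refine ⟨h.reg, h.lt, fun r hr => ?_⟩
  simp [h.mem r hr]

theorem SameOutside.put {W base : ℕ} (s : MachineState) {a : ℕ} (ha : a < W) (x : ℕ) :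
    SameOutside W base s (s.put (base + a) x) := by
  refine ⟨fun _ _ => rfl, fun b hb => ?_⟩
  rw [put_mem, if_neg (by omega)]

theorem Simulates.set_scratch {W base N : ℕ} {σ s : MachineState} (h : Simulates W base N σ s)
    (x : ℕ) : Simulates W base N σ (s.set 40 x) := by
  refine ⟨fun r hr => ?_, h.lt, h.mem⟩
  rw [set_reg, if_neg (by omega), h.reg r hr]

/-- A memory access needs one more step, to form the absolute address in register 40, which is
neither named nor relocated; hence the factor 2. Addresses are register contents, thus less than W,
so only the W cells from `base` on can be touched. -/
theorem Simulates.instr {W base N W' f : ℕ} {σ s : MachineState} {i : Instr}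
    (h : Simulates W base N σ s) (hbase : s.reg f = base) (hW : base + W ≤ W')
    (hi : i.RegsBelow N) (hw : i.written σ < W) :
    ∃ t s', Exec W' (i.reloc f) s t s' ∧ t ≤ 2 ∧ Simulates W base N (i.next σ) s' ∧
      SameOutside W base s s' := by
  have key : ∀ a < N, Exec W' (.instr (.arith .add 40 f (64 + a))) s 1
      (s.set 40 (base + σ.reg a)) := by
    intro a ha
    have h1 : (Instr.arith .add 40 f (64 + a)).written s = base + σ.reg a := by
      simp [Instr.written, ArithOp.eval, hbase, h.reg a ha]
    have h2 := Exec.instr (W := W') (.arith .add 40 f (64 + a)) s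
      (by rw [h1]; have := h.lt a ha; omega)
    simp only [Instr.next, h1] at h2
    exact h2
  cases i with
  | const d c =>
    exact ⟨1, _, .instr _ _ (lt_of_lt_of_le hw (by omega)), by norm_num, h.set hw,
      .set s (by omega) _⟩
  | arith o d a b =>
    have h1 : (Instr.arith o (64 + d) (64 + a) (64 + b)).written s
        = (Instr.arith o d a b).written σ := by
      simp [Instr.written, h.reg a hi.2.1, h.reg b hi.2.2]
    have h2 := Exec.instr (W := W') (.arith o (64 + d) (64 + a) (64 + b)) s
      (by rw [h1]; omega)
    simp only [Instr.next, h1] at h2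
    exact ⟨1, _, h2, by norm_num, h.set hw, .set s (by omega) _⟩
  | load d a =>
    set s₁ := s.set 40 (base + σ.reg a) with hs₁
    have h1 : (Instr.load (64 + d) 40).written s₁ = (Instr.load d a).written σ := by
      simp [Instr.written, hs₁, h.mem _ (h.lt a hi.2)]
    have h2 := Exec.instr (W := W') (.load (64 + d) 40) s₁ (by rw [h1]; omega)
    simp only [Instr.next, h1] at h2
    exact ⟨_, _, .seq (key a hi.2) h2, by norm_num, (h.set_scratch _).set hw,
      (SameOutside.set s (by norm_num) _).trans (.set _ (by omega) _)⟩
  | store a b =>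
    set s₁ := s.set 40 (base + σ.reg a) with hs₁
    have h1 : (Instr.store 40 (64 + b)).written s₁ = (Instr.store a b).written σ := by
      have : 64 + b ≠ 40 := by omega
      simp [Instr.written, hs₁, this, h.reg b hi.2]
    have h2 := Exec.instr (W := W') (.store 40 (64 + b)) s₁ (by rw [h1]; omega)
    have h3 : s₁.reg 40 = base + σ.reg a := by simp [hs₁]
    simp only [Instr.next, h1, h3] at h2
    exact ⟨_, _, .seq (key a hi.1) h2, by norm_num, (h.set_scratch _).put _ _,
      (SameOutside.set s (by norm_num) _).trans (.put _ (h.lt a hi.1) _)⟩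

theorem Simulates.exec {W base N W' f : ℕ} (hf : f < 32) (hW : base + W ≤ W') {P : Program}
    {σ σ' : MachineState} {t : ℕ} (hE : Exec W P σ t σ') (hP : P.RegsBelow N) :
    ∀ s, Simulates W base N σ s → s.reg f = base →
      ∃ t' s', Exec W' (P.reloc f) s t' s' ∧ t' ≤ 2 * t ∧ Simulates W base N σ' s' ∧
        SameOutside W base s s' := by
  induction hE with
  | skip σ => exact fun s h _ => ⟨1, s, .skip s, by norm_num, h, .refl _ _ _⟩
  | instr i σ hi => exact fun s h hb => h.instr hb hW hP hi
  | seq _ _ ih₁ ih₂ =>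
    intro s h hb
    obtain ⟨t₁, s₁, hE₁, ht₁, h₁, ho₁⟩ := ih₁ hP.1 s h hb
    obtain ⟨t₂, s₂, hE₂, ht₂, h₂, ho₂⟩ := ih₂ hP.2 s₁ h₁ ((ho₁.reg f hf).trans hb)
    exact ⟨_, s₂, .seq hE₁ hE₂, by omega, h₂, ho₁.trans ho₂⟩
  | ifTrue hr _ ih =>
    intro s h hb
    obtain ⟨t₁, s₁, hE₁, ht₁, h₁, ho₁⟩ := ih hP.2.1 s h hb
    exact ⟨_, s₁, .ifTrue (by rwa [h.reg _ hP.1]) hE₁, by omega, h₁, ho₁⟩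
  | ifFalse hr _ ih =>
    intro s h hb
    obtain ⟨t₁, s₁, hE₁, ht₁, h₁, ho₁⟩ := ih hP.2.2 s h hb
    exact ⟨_, s₁, .ifFalse (by rwa [h.reg _ hP.1]) hE₁, by omega, h₁, ho₁⟩
  | whileDone hr =>
    exact fun s h _ => ⟨1, s, .whileDone (by rwa [h.reg _ hP.1]), by norm_num, h, .refl _ _ _⟩
  | whileStep hr _ _ ih₁ ih₂ =>
    intro s h hb
    obtain ⟨t₁, s₁, hE₁, ht₁, h₁, ho₁⟩ := ih₁ hP.2 s h hb
    obtain ⟨t₂, s₂, hE₂, ht₂, h₂, ho₂⟩ := ih₂ hP s₁ h₁ ((ho₁.reg f hf).trans hb)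
    exact ⟨_, s₂, .whileStep (by rwa [h.reg _ hP.1]) hE₁ hE₂, by omega, h₂, ho₁.trans ho₂⟩

theorem exec_clear {W : ℕ} (hW : 0 < W) (N : ℕ) (s : MachineState) :
    ∃ s', Exec W (Program.clear N) s (N + 1) s' ∧ s'.mem = s.mem ∧
      (∀ r < 32, s'.reg r = s.reg r) ∧ ∀ r < N, s'.reg (64 + r) = 0 := by
  induction N with
  | zero => exact ⟨s, .skip s, rfl, fun _ _ => rfl, by simp⟩
  | succ N ih =>
    obtain ⟨s₁, hE, hm, hr, h0⟩ := ih
    refine ⟨_, .seq hE (.instr (.const (64 + N) 0) s₁ hW), hm, fun r hr' => ?_, fun r hr' => ?_⟩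
    · have : r ≠ 64 + N := by omega
      simp [Instr.next, this, hr r hr']
    · by_cases h : r = N
      · simp [Instr.next, Instr.written, h]
      · simp [Instr.next, h, h0 r (by omega)]

/-- The program `P` multiplies `m × m` matrices with entries in `{0, 1}` in time `μ m`. -/
def Multiplies (P : Program) (k : ℕ) (μ : ℕ → ℕ) : Prop :=
  ∀ m : ℕ, 1 ≤ m → ∀ A B : Matrix (Fin m) (Fin m) ℕ, (∀ i j, A i j ≤ 1) → (∀ i j, B i j ≤ 1) →
    ∀ s : MachineState, s.IsInitial m (2 * (m * m)) →
      StoredAt s.mem 0 A → StoredAt s.mem (m * m) B →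
      ∃ (t : ℕ) (s' : MachineState), Exec ((m + 2) ^ k) P s t s' ∧
        t ≤ μ m ∧ StoredAt s'.mem (2 * (m * m)) (A * B)

/-- Raising the exponent by 3 makes (m + 2) ^ k exceed the 3 * m² cells of the factors and the
product, and |K| replaces K so that the time bound is nonnegative. -/
theorem MatrixMultiplicationInTime.multiplies {ω : ℝ} (h : MatrixMultiplicationInTime ω) :
    ∃ (P : Program) (k : ℕ) (K : ℝ), 3 ≤ k ∧ 0 ≤ K ∧
      Multiplies P k (fun m => ⌊K * (m : ℝ) ^ ω⌋₊) := by
  obtain ⟨P, k, K, h⟩ := h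
  refine ⟨P, k + 3, |K|, by omega, abs_nonneg K, fun m hm A B hA hB s hs hsA hsB => ?_⟩
  obtain ⟨t, s', hE, ht, hS⟩ := h m hm A B hA hB s hs hsA hsB
  refine ⟨t, s', hE.mono (Nat.pow_le_pow_right (by omega) (by omega)), Nat.le_floor ?_, hS⟩
  exact ht.trans (mul_le_mul_of_nonneg_right (le_abs_self K) (by positivity))

/-- The subroutine runs on a virtual machine with word bound (m + 2) ^ k; its registers have been
cleared and its memory behind the input is zero by `hz`, so it starts in a legal initial state. The
bound 2 * B is enough because 2 * B ≤ B ^ 8 < W. -/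
theorem Triple.call {W B k N f r m base : ℕ} {P : Program} {μ : ℕ → ℕ} {σ : MachineState}
    {T : ℕ} (hk : 3 ≤ k) (hP : Multiplies P k μ) (hN : P.RegsBelow N) (hf : f < 32) (hr : r < 32)
    (hm : 1 ≤ m) (hfb : σ.reg f = base) (hrm : σ.reg r = m) (hB : base + (m + 2) ^ k ≤ 2 * B)
    (X Y : Matrix (Fin m) (Fin m) ℕ) (hX : ∀ i j, X i j ≤ 1) (hY : ∀ i j, Y i j ≤ 1)
    (hsX : StoredAt σ.mem base X) (hsY : StoredAt σ.mem (base + m * m) Y)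
    (hz : ∀ a, base + 2 * (m * m) ≤ a → σ.mem a = 0) (hT : 2 * μ m + N + 10 ≤ T) :
    Triple W B (Program.call f r N P) σ T (fun σ' => σ'.reg = σ.reg ∧
      (∀ a, a < base ∨ base + (m + 2) ^ k ≤ a → σ'.mem a = σ.mem a) ∧
      StoredAt σ'.mem (base + 2 * (m * m)) (X * Y)) := by
  intro hB8 hBW hs s hag
  have hBB : 2 * B ≤ B ^ 8 := by
    calc 2 * B ≤ B * B := Nat.mul_le_mul_right _ (by omega)
      _ = B ^ 2 := by ring
      _ ≤ B ^ 8 := Nat.pow_le_pow_right (by omega) (by norm_num)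
  set V := (m + 2) ^ k with hV
  have hVm : 3 * (m * m) + m < V := by
    calc 3 * (m * m) + m < (m + 2) ^ 3 := by nlinarith
      _ ≤ V := Nat.pow_le_pow_right (by omega) hk
  -- One register more than P may use, so that register 64 is cleared even for N = 0.
  obtain ⟨s₁, hE₁, hm₁, hr₁, h0₁⟩ := exec_clear (W := W) (by omega) (N + 1) s
  set s₂ := s₁.set 64 m with hs₂
  have hE₂ : Exec W (.instr (.arith .add 64 64 r)) s₁ 1 s₂ := by
    have h1 : (Instr.arith .add 64 64 r).written s₁ = m := by
      have := h0₁ 0 (by omega)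
      simp only [add_zero] at this
      simp [Instr.written, ArithOp.eval, this, hr₁ r hr, hag.2 r hr, hrm]
    have h2 := Exec.instr (W := W) (.arith .add 64 64 r) s₁
      (by rw [h1]; have := hs r hr; omega)
    simp only [Instr.next, h1] at h2
    exact h2
  let ρ : MachineState := ⟨fun i => if i = 0 then m else 0,
    fun a => if a < V then σ.mem (base + a) else 0⟩
  have hsim : Simulates V base N ρ s₂ := by
    refine ⟨fun i hi => ?_, fun i hi => ?_, fun a ha => ?_⟩
    · by_cases h : i = 0
      · simp [hs₂, ρ, h]
      · simp [hs₂, ρ, h, h0₁ i (by omega)]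
    · simp only [ρ]
      split_ifs <;> omega
    · simp [hs₂, ρ, ha, hm₁, hag.1]
  have hidx : ∀ i j : Fin m, (i : ℕ) * m + j < m * m := by
    intro i j
    have := i.isLt
    have := j.isLt
    nlinarith
  obtain ⟨t, ρ', hE, ht, hst⟩ := hP m hm X Y hX hY ρ ⟨by simp [ρ], fun i hi => by simp [ρ, hi],
      fun a ha => by simp only [ρ]; split_ifs; exacts [hz _ (by omega), rfl]⟩
    (fun i j => by
      have := hidx i j
      simp only [ρ]
      rw [if_pos (by omega), zero_add, ← add_assoc]
      exact hsX i j)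
    (fun i j => by
      have := hidx i j
      simp only [ρ]
      rw [if_pos (by omega), add_assoc, ← hsY i j]
      congr 1
      ring)
  have hbase₂ : s₂.reg f = base := by
    have : f ≠ 64 := by omega
    simp [hs₂, this, hr₁ f hf, hag.2 f hf, hfb]
  obtain ⟨t₃, s₃, hE₃, ht₃, hsim₃, ho₃⟩ :=
    hsim.exec (W' := W) hf (by omega) hE hN s₂ hbase₂
  have hr₃ : ∀ i < 32, s₃.reg i = σ.reg i := fun i hi => by
    have : i ≠ 64 := by omega
    rw [ho₃.reg i hi, hs₂, set_reg, if_neg this, hr₁ i hi, hag.2 i hi]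
  refine ⟨_, s₃, ⟨σ.reg, s₃.mem⟩, .seq hE₁ (.seq hE₂ hE₃), by omega, ⟨rfl, hr₃⟩, hs, rfl,
    fun a ha => ?_, fun i j => ?_⟩
  · simp only
    rw [ho₃.mem a ha, hs₂, set_mem, hm₁, hag.1]
  · have := hidx i j
    rw [← hst i j, ← hsim₃.mem _ (by omega)]
    simp only
    congr 1
    ring

/-! ### The order in which the cells of a matrix are visited -/

/-- The row of the cell of rank `c`: the bits of `c` in even positions. -/
def evenBits (c : ℕ) : ℕ := if h : c = 0 then 0 else 2 * evenBits (c / 4) + c % 2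
decreasing_by omega

/-- The column of the cell of rank `c`: the bits of `c` in odd positions. -/
def oddBits (c : ℕ) : ℕ := if h : c = 0 then 0 else 2 * oddBits (c / 4) + c % 4 / 2
decreasing_by omega

/-- Insert a zero before every bit. -/
def spread (a : ℕ) : ℕ := if h : a = 0 then 0 else 4 * spread (a / 2) + a % 2
decreasing_by omega

/-- The rank of a cell in the order. -/
def cellRank (a b : ℕ) : ℕ := spread a + 2 * spread b

/-- The exponent of `4` in `c`. -/
def level (c : ℕ) : ℕ := if h : c = 0 ∨ c % 4 ≠ 0 then 0 else level (c / 4) + 1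
decreasing_by omega

theorem evenBits_eq (c : ℕ) : evenBits c = 2 * evenBits (c / 4) + c % 2 := by
  by_cases h : c = 0
  · subst h; simp [evenBits]
  · rw [evenBits]; simp [h]

theorem oddBits_eq (c : ℕ) : oddBits c = 2 * oddBits (c / 4) + c % 4 / 2 := by
  by_cases h : c = 0
  · subst h; simp [oddBits]
  · rw [oddBits]; simp [h]

theorem spread_eq (a : ℕ) : spread a = 4 * spread (a / 2) + a % 2 := by
  by_cases h : a = 0
  · subst h; simp [spread]
  · rw [spread]; simp [h]

/-- The last base-4 digit of the rank consists of the last bits of the two coordinates; facts about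
the order follow from this by recursion. -/
theorem cellRank_eq (a b : ℕ) :
    cellRank a b = 4 * cellRank (a / 2) (b / 2) + (a % 2 + 2 * (b % 2)) := by
  simp only [cellRank]
  rw [spread_eq a, spread_eq b]
  omega

theorem cellRank_evenBits_oddBits (c : ℕ) : cellRank (evenBits c) (oddBits c) = c := by
  induction c using Nat.strong_induction_on with
  | _ c ih =>
    by_cases h : c = 0
    · subst h; simp [evenBits, oddBits, cellRank, spread]
    · have h1 := ih (c / 4) (by omega)
      rw [cellRank_eq]
      have h2 := evenBits_eq c
      have h3 := oddBits_eq c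
      rw [show evenBits c / 2 = evenBits (c / 4) by omega,
        show oddBits c / 2 = oddBits (c / 4) by omega, h1]
      omega

theorem bits_cellRank (a b : ℕ) :
    evenBits (cellRank a b) = a ∧ oddBits (cellRank a b) = b := by
  induction h : a + b using Nat.strong_induction_on generalizing a b with
  | _ m ih =>
    by_cases h0 : a + b = 0
    · obtain ⟨rfl, rfl⟩ : a = 0 ∧ b = 0 := by omega
      simp [evenBits, oddBits, cellRank, spread]
    · have h1 := ih (a / 2 + b / 2) (by omega) (a / 2) (b / 2) rfl
      have h2 := cellRank_eq a b
      have h3 : cellRank a b / 4 = cellRank (a / 2) (b / 2) := by omega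
      rw [evenBits_eq, oddBits_eq, h3, h1.1, h1.2]
      omega

/-- Dropping l digits in base 4 drops l bits of each coordinate. This is why a dyadic square of side
2 ^ l is an interval of 4 ^ l ranks. -/
theorem cellRank_div_pow (l a b : ℕ) :
    cellRank a b / 4 ^ l = cellRank (a / 2 ^ l) (b / 2 ^ l) := by
  induction l with
  | zero => simp
  | succ l ih =>
    rw [pow_succ, pow_succ, ← Nat.div_div_eq_div_mul, ih, ← Nat.div_div_eq_div_mul,
      ← Nat.div_div_eq_div_mul, cellRank_eq (a / 2 ^ l)]
    omega

theorem spread_strictMono : StrictMono spread := by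
  intro a b hab
  induction b using Nat.strong_induction_on generalizing a with
  | _ b ih =>
    rw [spread_eq a, spread_eq b]
    by_cases h : a / 2 = b / 2
    · rw [h]; omega
    · have := ih (b / 2) (by omega) (a := a / 2) (by omega)
      omega

theorem cellRank_zero : cellRank 0 0 = 0 := by simp [cellRank, spread]

theorem cellRank_lt {L a b : ℕ} (ha : a < 2 ^ L) (hb : b < 2 ^ L) : cellRank a b < 4 ^ L := by
  have h := cellRank_div_pow L a b
  rw [Nat.div_eq_of_lt ha, Nat.div_eq_of_lt hb, cellRank_zero] at h
  exact (Nat.div_eq_zero_iff_lt (by positivity)).1 h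

theorem bits_div_pow (l c : ℕ) :
    evenBits (c / 4 ^ l) = evenBits c / 2 ^ l ∧ oddBits (c / 4 ^ l) = oddBits c / 2 ^ l := by
  have h := cellRank_div_pow l (evenBits c) (oddBits c)
  rw [cellRank_evenBits_oddBits] at h
  rw [h]
  exact bits_cellRank _ _

theorem bits_lt {L c : ℕ} (hc : c < 4 ^ L) : evenBits c < 2 ^ L ∧ oddBits c < 2 ^ L := by
  have h := bits_div_pow L c
  rw [Nat.div_eq_of_lt hc] at h
  have h0 : evenBits 0 = 0 ∧ oddBits 0 = 0 := by simp [evenBits, oddBits]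
  rw [h0.1, h0.2] at h
  exact ⟨(Nat.div_eq_zero_iff_lt (by positivity)).1 h.1.symm,
    (Nat.div_eq_zero_iff_lt (by positivity)).1 h.2.symm⟩

theorem evenBits_pow_mul (l q : ℕ) : evenBits (4 ^ l * q) = 2 ^ l * evenBits q := by
  induction l with
  | zero => simp
  | succ l ih =>
    rw [evenBits_eq, show 4 ^ (l + 1) * q = 4 * (4 ^ l * q) by ring,
      Nat.mul_div_cancel_left _ (by norm_num), ih, pow_succ]
    have : 4 * (4 ^ l * q) % 2 = 0 := by omega
    rw [this]; ring

theorem oddBits_pow_mul (l q : ℕ) : oddBits (4 ^ l * q) = 2 ^ l * oddBits q := by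
  induction l with
  | zero => simp
  | succ l ih =>
    rw [oddBits_eq, show 4 ^ (l + 1) * q = 4 * (4 ^ l * q) by ring,
      Nat.mul_div_cancel_left _ (by norm_num), ih, pow_succ]
    have : 4 * (4 ^ l * q) % 4 / 2 = 0 := by omega
    rw [this]; ring

/-- The last l base-4 digits of 4 ^ l * q - 1 are all 3: it is the far corner of the square number q
- 1. The scan uses this to pass from rank c - 1 to rank c by arithmetic on the coordinates. -/
theorem evenBits_pow_mul_pred (l q : ℕ) (hq : 0 < q) :
    evenBits (4 ^ l * q - 1) + 1 = 2 ^ l * (evenBits (q - 1) + 1) := by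
  induction l with
  | zero => simp
  | succ l ih =>
    have h4 : 0 < 4 ^ l * q := by positivity
    rw [evenBits_eq, show 4 ^ (l + 1) * q = 4 * (4 ^ l * q) by ring,
      show (4 * (4 ^ l * q) - 1) / 4 = 4 ^ l * q - 1 by omega,
      show (4 * (4 ^ l * q) - 1) % 2 = 1 by omega]
    rw [pow_succ]
    linarith

theorem oddBits_pow_mul_pred (l q : ℕ) (hq : 0 < q) :
    oddBits (4 ^ l * q - 1) + 1 = 2 ^ l * (oddBits (q - 1) + 1) := by
  induction l with
  | zero => simp
  | succ l ih =>
    have h4 : 0 < 4 ^ l * q := by positivity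
    rw [oddBits_eq, show 4 ^ (l + 1) * q = 4 * (4 ^ l * q) by ring,
      show (4 * (4 ^ l * q) - 1) / 4 = 4 ^ l * q - 1 by omega,
      show (4 * (4 ^ l * q) - 1) % 4 / 2 = 1 by omega]
    rw [pow_succ]
    linarith

/-- Without a carry only the last base-4 digit changes. From 1 to 2 the row bit falls and the column
bit rises; from 0 to 1 and from 2 to 3 only the row bit rises. -/
theorem bits_pred {q : ℕ} (hq : q % 4 ≠ 0) :
    (q % 2 = 0 → evenBits (q - 1) = evenBits q + 1 ∧ oddBits (q - 1) + 1 = oddBits q) ∧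
      (q % 2 = 1 → evenBits (q - 1) + 1 = evenBits q ∧ oddBits (q - 1) = oddBits q) := by
  have h1 := evenBits_eq q
  have h2 := oddBits_eq q
  have h3 := evenBits_eq (q - 1)
  have h4 := oddBits_eq (q - 1)
  rw [show (q - 1) / 4 = q / 4 by omega] at h3 h4
  omega

theorem level_of_mod {q : ℕ} (hq : q % 4 ≠ 0) : level q = 0 := by
  rw [level]; simp [hq]

theorem level_mul_four {q : ℕ} (hq : q ≠ 0) : level (4 * q) = level q + 1 := by
  rw [level]; simp [hq]

theorem level_pow_mul {l q : ℕ} (hq : q ≠ 0) : level (4 ^ l * q) = level q + l := by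
  induction l with
  | zero => simp
  | succ l ih =>
    rw [show 4 ^ (l + 1) * q = 4 * (4 ^ l * q) by ring, level_mul_four (by positivity), ih]
    omega

/-- The multiples of 4 in the range are 4 * c with 1 ≤ c < 4 ^ L, one level above c; the other 3 * 4
^ L numbers have level 0. -/
theorem sum_level_succ {M : Type*} [AddCommMonoid M] (f : ℕ → M) (L : ℕ) :
    ∑ c ∈ Finset.Ico 1 (4 ^ (L + 1)), f (level c) =
      ∑ c ∈ Finset.Ico 1 (4 ^ L), f (level c + 1) + (3 * 4 ^ L) • f 0 := by
  have key : ∀ m : ℕ, 1 ≤ m → ∑ c ∈ Finset.Ico 1 (4 * m), f (level c) =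
      ∑ c ∈ Finset.Ico 1 m, f (level c + 1) + (3 * m) • f 0 := by
    intro m hm
    induction m, hm using Nat.le_induction with
    | base =>
      simp [Finset.sum_Ico_succ_top, level_of_mod, succ_nsmul]
    | succ m hm ih =>
      rw [show 4 * (m + 1) = 4 * m + 1 + 1 + 1 + 1 by ring,
        Finset.sum_Ico_succ_top (by omega), Finset.sum_Ico_succ_top (by omega),
        Finset.sum_Ico_succ_top (by omega), Finset.sum_Ico_succ_top (by omega), ih,
        Finset.sum_Ico_succ_top (by omega), level_mul_four (by omega),
        level_of_mod (q := 4 * m + 1) (by omega), level_of_mod (q := 4 * m + 1 + 1) (by omega),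
        level_of_mod (q := 4 * m + 1 + 1 + 1) (by omega),
        show 3 * (m + 1) = 3 * m + 1 + 1 + 1 by ring]
      simp only [succ_nsmul]
      abel
  rw [pow_succ, mul_comm]
  exact key _ (Nat.one_le_pow _ _ (by norm_num))

/-! ### Segments over which the graph contains a triangulation -/

/-- The part of the polygon between `i` and `j` has a triangulation with edges in `E`. -/
inductive Good (E : ℕ → ℕ → Prop) : ℕ → ℕ → Prop
  | side {i : ℕ} (h : E i (i + 1)) : Good E i (i + 1)
  | split {i k j : ℕ} (h : E i j) (h₁ : Good E i k) (h₂ : Good E k j) : Good E i j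

namespace Good

variable {E : ℕ → ℕ → Prop} {i j k : ℕ}

theorem lt (h : Good E i j) : i < j := by
  induction h with
  | side _ => omega
  | split _ _ _ h₁ h₂ => omega

theorem edge (h : Good E i j) : E i j := by
  cases h <;> assumption

theorem eq_or_split (h : Good E i j) : j = i + 1 ∨ ∃ k, Good E i k ∧ Good E k j := by
  cases h with
  | side _ => exact .inl rfl
  | split _ h₁ h₂ => exact .inr ⟨_, h₁, h₂⟩

end Good

/-- At level `l`, the index `k` shares its block with neither `i` nor `j`, but at level `l + 1`
it does with one of them. Blocks for `i` are counted from the right end. -/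
def Separates (N l i j k : ℕ) : Prop :=
  (N - 1 - k) / 2 ^ l ≠ (N - 1 - i) / 2 ^ l ∧ k / 2 ^ l ≠ j / 2 ^ l ∧
    ((N - 1 - k) / 2 ^ l / 2 = (N - 1 - i) / 2 ^ l / 2 ∨ k / 2 ^ l / 2 = j / 2 ^ l / 2)

/-- At level 0 the vertex k shares its block with neither i nor j, and at level L there is only one
block. The level just before the first coincidence is the one wanted. -/
theorem exists_separates {L i j k : ℕ} (hj : j < 2 ^ L) (hik : i < k) (hkj : k < j) :
    ∃ l, Separates (2 ^ L) l i j k := by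
  classical
  have hex : ∃ l, (2 ^ L - 1 - k) / 2 ^ l = (2 ^ L - 1 - i) / 2 ^ l ∨ k / 2 ^ l = j / 2 ^ l :=
    ⟨L, .inr (by rw [Nat.div_eq_of_lt hj, Nat.div_eq_of_lt (hkj.trans hj)])⟩
  have h0 : Nat.find hex ≠ 0 := by
    intro h
    have := Nat.find_spec hex
    rw [h] at this
    simp only [pow_zero, Nat.div_one] at this
    omega
  obtain ⟨l, hl⟩ := Nat.exists_eq_succ_of_ne_zero h0
  have h1 := Nat.find_spec hex
  have h2 := Nat.find_min hex (m := l) (by omega)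
  rw [hl] at h1
  push Not at h2
  refine ⟨l, h2.1, h2.2, ?_⟩
  simpa [pow_succ, Nat.div_div_eq_div_mul] using h1

/-- The table `X` tells which of the cells of rank below `c` are good. -/
def GoodTable (E : ℕ → ℕ → Prop) (N c : ℕ) (X : ℕ → ℕ → ℕ) : Prop :=
  ∀ i < N, ∀ j < N, X i j ≤ 1 ∧ (X i j = 1 ↔ Good E i j ∧ cellRank (N - 1 - i) j < c)

/-- The table `A` only records cells that have a splitting vertex, and it records all those
splittings that have been processed before step `c`. -/
structure SplitTable (E : ℕ → ℕ → Prop) (N c : ℕ) (A : ℕ → ℕ → ℕ) : Prop where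
  le_one : ∀ i < N, ∀ j < N, A i j ≤ 1
  sound : ∀ i < N, ∀ j < N, A i j = 1 → ∃ k, Good E i k ∧ Good E k j
  complete : ∀ i < N, ∀ j < N, ∀ k, Good E i k → Good E k j → ∀ l, Separates N l i j k →
    4 ^ l * (cellRank (N - 1 - i) j / 4 ^ l) < c → A i j = 1

/-- `A'` arises from `A` by adding the product of two blocks of `X`. -/
def BlockUpdate (N i₀ j₀ k₀ s : ℕ) (X A A' : ℕ → ℕ → ℕ) : Prop :=
  ∀ i < N, ∀ j < N, A' i j ≤ 1 ∧ (A' i j = 1 ↔ A i j = 1 ∨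
    (i₀ ≤ i ∧ i < i₀ + s ∧ j₀ ≤ j ∧ j < j₀ + s ∧
      ∃ k, k₀ ≤ k ∧ k < k₀ + s ∧ X i k = 1 ∧ X k j = 1))

/-- Soundness does not depend on which blocks are multiplied or when: X marks good segments only, so
a nonzero entry of a product always exhibits a splitting vertex. -/
theorem SplitTable.blockUpdate_sound {E : ℕ → ℕ → Prop} {N c i₀ j₀ k₀ s : ℕ}
    {X A A' : ℕ → ℕ → ℕ} (hX : GoodTable E N c X) (hA : SplitTable E N c A)
    (hk : k₀ + s ≤ N) (h : BlockUpdate N i₀ j₀ k₀ s X A A') : SplitTable E N c A' := by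
  refine ⟨fun i hi j hj => (h i hi j hj).1, fun i hi j hj h1 => ?_,
    fun i hi j hj k h₁ h₂ l hs hl => ?_⟩
  · rcases (h i hi j hj).2.1 h1 with h1 | ⟨-, -, -, -, k, -, hk', h1, h2⟩
    · exact hA.sound i hi j hj h1
    · exact ⟨k, ((hX i hi k (by omega)).2.1 h1).1, ((hX k (by omega) j hj).2.1 h2).1⟩
  · exact (h i hi j hj).2.2 (.inl (hA.complete i hi j hj k h₁ h₂ l hs hl))

/-- In either coordinate k is smaller than the endpoint it is compared with. Distinct blocks with
the same parent are siblings, so the block of k is the even one and that of the endpoint the odd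
one. In particular the square of ij is not the first quarter of its parent. -/
theorem Separates.mod_ne {L i j k l : ℕ} (h : Separates (2 ^ L) l i j k) (hik : i < k)
    (hkj : k < j) :
    cellRank (2 ^ L - 1 - i) j / 4 ^ l % 4 ≠ 0 ∧
    (((2 ^ L - 1 - i) / 2 ^ l % 2 = 1 ∧ (2 ^ L - 1 - k) / 2 ^ l + 1 = (2 ^ L - 1 - i) / 2 ^ l) ∨
      (j / 2 ^ l % 2 = 1 ∧ k / 2 ^ l + 1 = j / 2 ^ l)) := by
  obtain ⟨h1, h2, h3⟩ := h
  have m1 : (2 ^ L - 1 - k) / 2 ^ l ≤ (2 ^ L - 1 - i) / 2 ^ l := Nat.div_le_div_right (by omega)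
  have m2 : k / 2 ^ l ≤ j / 2 ^ l := Nat.div_le_div_right (by omega)
  rw [cellRank_div_pow, cellRank_eq]
  omega

/-- Before step `c`, the block that starts with the cell of rank `c` is updated with the blocks
of the same size next to it. -/
theorem SplitTable.step {E : ℕ → ℕ → Prop} {L N c l q s : ℕ} {X A A' : ℕ → ℕ → ℕ}
    (hN : N = 2 ^ L) (hX : GoodTable E N c X) (hA : SplitTable E N c A)
    (hA' : SplitTable E N c A') (hc : c = 4 ^ l * q) (hq : q % 4 ≠ 0) (hs : s = 2 ^ l)
    (h : ∀ i < N, ∀ j < N, A i j = 1 → A' i j = 1)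
    (h₁ : q % 2 = 1 → ∀ i, N - evenBits c - s ≤ i → i < N - evenBits c →
      ∀ j, oddBits c ≤ j → j < oddBits c + s → i < N → j < N →
      ∀ k, N - evenBits c ≤ k → k < N - evenBits c + s → X i k = 1 → X k j = 1 →
      A' i j = 1)
    (h₂ : q / 2 % 2 = 1 → ∀ i, N - evenBits c - s ≤ i → i < N - evenBits c →
      ∀ j, oddBits c ≤ j → j < oddBits c + s → i < N → j < N →
      ∀ k, oddBits c - s ≤ k → k < oddBits c → X i k = 1 → X k j = 1 →
      A' i j = 1) : SplitTable E N (c + 1) A' := by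
  subst hN
  refine ⟨hA'.le_one, hA'.sound, fun i hi j hj k hik hkj l' hsep hlt => ?_⟩
  -- The only splittings that become due now are those whose square starts exactly at rank c.
  rcases Nat.lt_succ_iff_lt_or_eq.1 hlt with hlt | heq
  · exact h i hi j hj (hA.complete i hi j hj k hik hkj l' hsep hlt)
  obtain ⟨hmod, hcase⟩ := hsep.mod_ne hik.lt hkj.lt
  have hne := hsep.1
  have hne' := hsep.2.1
  set r := cellRank (2 ^ L - 1 - i) j with hr
  -- Both levels write c as a power of 4 times a number not divisible by 4.
  have hll : l' = l := by
    have e1 := level_pow_mul (l := l) (q := q) (by rintro rfl; simp at hq)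
    have e2 := level_pow_mul (l := l') (q := r / 4 ^ l') (by intro h0; simp [h0] at hmod)
    rw [heq, hc, e1, level_of_mod hq, level_of_mod hmod] at e2
    omega
  subst hll
  have hqr : q = r / 4 ^ l' := by
    rw [hc] at heq
    exact (Nat.eq_of_mul_eq_mul_left (by positivity) heq).symm
  -- The square of ij starts at c, so a cell that precedes ij but lies in another square of this
  -- size has rank below c and is already decided.
  have hrange : c ≤ r ∧ ∀ r' < r, r' / 4 ^ l' ≠ r / 4 ^ l' → r' < c := by
    refine ⟨?_, fun r' hr' hdiv => ?_⟩
    · rw [← heq]; exact Nat.mul_div_le _ _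
    · have : r' / 4 ^ l' < r / 4 ^ l' := lt_of_le_of_ne (Nat.div_le_div_right hr'.le) hdiv
      rw [← heq, mul_comm]
      exact (Nat.div_lt_iff_lt_mul (by positivity)).1 this
  have hkN : k < 2 ^ L := hkj.lt.trans hj
  -- The cell ik is in the same row as ij, in an earlier column and another column of squares.
  -- Below, kj is treated likewise with rows and columns exchanged.
  have hXik : X i k = 1 := by
    refine (hX i hi k hkN).2.2 ⟨hik, hrange.2 _ ?_ ?_⟩
    · rw [hr]
      simp only [cellRank]
      have := spread_strictMono hkj.lt
      omega
    · rw [cellRank_div_pow, hr, cellRank_div_pow]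
      intro hh
      exact hne' ((bits_cellRank _ _).2.symm.trans ((congrArg oddBits hh).trans
        (bits_cellRank _ _).2))
  have hXkj : X k j = 1 := by
    refine (hX k hkN j hj).2.2 ⟨hkj, hrange.2 _ ?_ ?_⟩
    · rw [hr]
      simp only [cellRank]
      have hik' := hik.lt
      have := spread_strictMono (show 2 ^ L - 1 - k < 2 ^ L - 1 - i by omega)
      omega
    · rw [cellRank_div_pow, hr, cellRank_div_pow]
      intro hh
      exact hne ((bits_cellRank _ _).1.symm.trans ((congrArg evenBits hh).trans
        (bits_cellRank _ _).1))
  have he : evenBits c = 2 ^ l' * ((2 ^ L - 1 - i) / 2 ^ l') := by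
    rw [hc, evenBits_pow_mul, hqr, hr, cellRank_div_pow, (bits_cellRank _ _).1]
  have ho : oddBits c = 2 ^ l' * (j / 2 ^ l') := by
    rw [hc, oddBits_pow_mul, hqr, hr, cellRank_div_pow, (bits_cellRank _ _).2]
  have hpos : 0 < 2 ^ l' := by positivity
  have b1 := Nat.div_add_mod (2 ^ L - 1 - i) (2 ^ l')
  have b2 := Nat.mod_lt (2 ^ L - 1 - i) hpos
  have b3 := Nat.div_add_mod j (2 ^ l')
  have b4 := Nat.mod_lt j hpos
  have hq2 : q % 2 = (2 ^ L - 1 - i) / 2 ^ l' % 2 ∧ q / 2 % 2 = j / 2 ^ l' % 2 := by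
    rw [hqr, hr, cellRank_div_pow, cellRank_eq]
    omega
  rcases hcase with ⟨hodd, hadj⟩ | ⟨hodd, hadj⟩
  · have b5 := Nat.div_add_mod (2 ^ L - 1 - k) (2 ^ l')
    have b6 := Nat.mod_lt (2 ^ L - 1 - k) hpos
    have b7 : 2 ^ l' * ((2 ^ L - 1 - i) / 2 ^ l') =
        2 ^ l' * ((2 ^ L - 1 - k) / 2 ^ l') + 2 ^ l' := by rw [← hadj]; ring
    exact h₁ (by omega) i (by omega) (by omega) j (by omega) (by omega) hi hj k (by omega)
      (by omega) hXik hXkj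
  · have b5 := Nat.div_add_mod k (2 ^ l')
    have b6 := Nat.mod_lt k hpos
    have b7 : 2 ^ l' * (j / 2 ^ l') = 2 ^ l' * (k / 2 ^ l') + 2 ^ l' := by rw [← hadj]; ring
    exact h₂ (by omega) i (by omega) (by omega) j (by omega) (by omega) hi hj k (by omega)
      (by omega) hXik hXkj

/-- In step `0` there is nothing to update. -/
theorem SplitTable.step_zero {E : ℕ → ℕ → Prop} {L N : ℕ} {A : ℕ → ℕ → ℕ}
    (hN : N = 2 ^ L) (hA : SplitTable E N 0 A) : SplitTable E N 1 A := by
  subst hN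
  refine ⟨hA.le_one, hA.sound, fun i hi j hj k hik hkj l hsep hlt => ?_⟩
  have := (hsep.mod_ne hik.lt hkj.lt).1
  have hpos : 0 < 4 ^ l := by positivity
  have h0 : cellRank (2 ^ L - 1 - i) j / 4 ^ l = 0 := by
    rcases Nat.eq_zero_or_pos (cellRank (2 ^ L - 1 - i) j / 4 ^ l) with h | h
    · exact h
    · have := Nat.mul_pos hpos h
      omega
  simp [h0] at this

/-- Step `c` decides the cell of rank `c`. -/
theorem SplitTable.good_iff {E : ℕ → ℕ → Prop} {L N c i j : ℕ} {A : ℕ → ℕ → ℕ}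
    (hN : N = 2 ^ L) (hA : SplitTable E N (c + 1) A) (hi : i < N) (hj : j < N)
    (hc : cellRank (N - 1 - i) j = c) :
    Good E i j ↔ E i j ∧ (j = i + 1 ∨ A i j = 1) := by
  subst hN
  constructor
  · intro h
    refine ⟨h.edge, h.eq_or_split.imp_right ?_⟩
    rintro ⟨k, hik, hkj⟩
    obtain ⟨l, hl⟩ := exists_separates hj hik.lt hkj.lt
    -- The square containing a cell starts no later than the cell, so every splitting has been
    -- processed by now.
    refine hA.complete i hi j hj k hik hkj l hl ?_
    rw [hc]
    exact Nat.lt_succ_of_le (Nat.mul_div_le _ _)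
  · rintro ⟨hE, rfl | h⟩
    · exact .side hE
    · obtain ⟨k, h₁, h₂⟩ := hA.sound i hi j hj h
      exact .split hE h₁ h₂

theorem GoodTable.step {E : ℕ → ℕ → Prop} {L N c i j : ℕ} {X X' : ℕ → ℕ → ℕ}
    (hN : N = 2 ^ L) (hX : GoodTable E N c X) (hi : i < N) (hj : j < N)
    (hc : cellRank (N - 1 - i) j = c) (h1 : X' i j ≤ 1) (h : X' i j = 1 ↔ Good E i j)
    (hX' : ∀ i' < N, ∀ j' < N, (i', j') ≠ (i, j) → X' i' j' = X i' j') :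
    GoodTable E N (c + 1) X' := by
  subst hN
  intro i' hi' j' hj'
  by_cases heq : (i', j') = (i, j)
  · simp only [Prod.mk.injEq] at heq
    rw [heq.1, heq.2]
    refine ⟨h1, h.trans ?_⟩
    simp [hc]
  · rw [hX' i' hi' j' hj' heq]
    refine ⟨(hX i' hi' j' hj').1, (hX i' hi' j' hj').2.trans (and_congr_right fun _ => ?_)⟩
    have hne : cellRank (2 ^ L - 1 - i') j' ≠ c := by
      intro hh
      have e1 := bits_cellRank (2 ^ L - 1 - i') j'
      rw [hh, ← hc, (bits_cellRank _ _).1, (bits_cellRank _ _).2] at e1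
      apply heq
      rw [e1.2, show i' = i by omega]
    omega

/-! ### Crossings in a convex polygon -/

theorem orientation_rotate (x y z : EuclideanSpace ℝ (Fin 2)) :
    orientation y z x = orientation x y z := by
  simp only [orientation]; ring

theorem orientation_swap (x y z : EuclideanSpace ℝ (Fin 2)) :
    orientation x z y = -orientation x y z := by
  simp only [orientation]; ring

theorem orientation_combination (x y u v : EuclideanSpace ℝ (Fin 2)) {a b : ℝ} (h : a + b = 1) :
    orientation x y (a • u + b • v) = a * orientation x y u + b * orientation x y v := by
  obtain rfl : b = 1 - a := by linarith
  simp only [orientation, PiLp.add_apply, PiLp.smul_apply, smul_eq_mul]; ring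

theorem orientation_combination_endpoints (x y : EuclideanSpace ℝ (Fin 2)) {a b : ℝ}
    (h : a + b = 1) : orientation x y (a • x + b • y) = 0 := by
  rw [orientation_combination x y x y h]
  simp only [orientation]; ring

/-- The function `orientation x y` is affine, vanishes on the segment xy, and under these hypotheses
has a strict sign at interior points of uv. -/
theorem disjoint_openSegment_of_orientation {x y u v : EuclideanSpace ℝ (Fin 2)}
    (h : (0 ≤ orientation x y u ∧ 0 ≤ orientation x y v ∨
      orientation x y u ≤ 0 ∧ orientation x y v ≤ 0))
    (hne : orientation x y u ≠ 0 ∨ orientation x y v ≠ 0) :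
    Disjoint (openSegment ℝ x y) (openSegment ℝ u v) := by
  rw [Set.disjoint_left]
  rintro _ ⟨a, b, -, -, hab, rfl⟩ ⟨c, d, hc, hd, hcd, heq⟩
  have h1 := orientation_combination x y u v hcd
  rw [heq, orientation_combination_endpoints x y hab] at h1
  rcases h with ⟨hu, hv⟩ | ⟨hu, hv⟩
  · rcases hne with hne | hne
    · have := mul_pos hc (lt_of_le_of_ne hu hne.symm)
      have := mul_nonneg hd.le hv
      linarith
    · have := mul_pos hd (lt_of_le_of_ne hv hne.symm)
      have := mul_nonneg hc.le hu
      linarith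
  · rcases hne with hne | hne
    · have := mul_neg_of_pos_of_neg hc (lt_of_le_of_ne hu hne)
      have := mul_nonpos_of_nonneg_of_nonpos hd.le hv
      linarith
    · have := mul_neg_of_pos_of_neg hd (lt_of_le_of_ne hv hne)
      have := mul_nonpos_of_nonneg_of_nonpos hc.le hu
      linarith

/-! ### Interleaving edges and maximal noncrossing graphs -/

section Polygon

variable {n : ℕ} {p : Fin n → EuclideanSpace ℝ (Fin 2)}

theorem IsConvexPolygon.orientation_neg (hp : IsConvexPolygon p) {a b c : Fin n} (hac : a < c)
    (hcb : c < b) : orientation (p a) (p b) (p c) < 0 := by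
  rw [orientation_swap]
  linarith [hp.2 a c b hac hcb]

theorem IsConvexPolygon.orientation_pos (hp : IsConvexPolygon p) {a b c : Fin n} (hab : a < b)
    (hc : c < a ∨ b < c) : 0 < orientation (p a) (p b) (p c) := by
  rcases hc with hc | hc
  · rw [orientation_rotate]
    exact hp.2 c a b hc hab
  · exact hp.2 a b c hab hc

theorem orientation_self_left (x y : EuclideanSpace ℝ (Fin 2)) : orientation x y x = 0 := by
  simp only [orientation]; ring

theorem orientation_self_right (x y : EuclideanSpace ℝ (Fin 2)) : orientation x y y = 0 := by
  simp only [orientation]; ring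

/-- The line ab has the vertices strictly between a and b strictly on one side and all remaining
ones strictly on the other. Without interleaving, c and d are weakly on the same side, and they are
not both on the line since the segments differ. -/
theorem IsConvexPolygon.disjoint (hp : IsConvexPolygon p) {a b c d : Fin n} (hab : a < b)
    (hcd : c < d) (hne : (a, b) ≠ (c, d)) (h₁ : ¬ (a < c ∧ c < b ∧ b < d))
    (h₂ : ¬ (c < a ∧ a < d ∧ d < b)) :
    Disjoint (openSegment ℝ (p a) (p b)) (openSegment ℝ (p c) (p d)) := by
  have hin : ∀ x, a ≤ x → x ≤ b → orientation (p a) (p b) (p x) ≤ 0 := by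
    intro x hx hx'
    rcases hx.eq_or_lt with rfl | hx
    · exact (orientation_self_left _ _).le
    rcases hx'.eq_or_lt with rfl | hx'
    · exact (orientation_self_right _ _).le
    · exact (hp.orientation_neg hx hx').le
  have hout : ∀ x, x ≤ a ∨ b ≤ x → 0 ≤ orientation (p a) (p b) (p x) := by
    intro x hx
    by_cases hxa : x = a
    · rw [hxa]; exact (orientation_self_left _ _).ge
    by_cases hxb : x = b
    · rw [hxb]; exact (orientation_self_right _ _).ge
    · exact (hp.orientation_pos hab (by omega)).le
  have hnz : ∀ x, x ≠ a → x ≠ b → orientation (p a) (p b) (p x) ≠ 0 := by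
    intro x hxa hxb
    by_cases h : a < x ∧ x < b
    · exact (hp.orientation_neg h.1 h.2).ne
    · exact (hp.orientation_pos hab (by omega)).ne'
  simp only [ne_eq, Prod.mk.injEq] at hne
  apply disjoint_openSegment_of_orientation
  · by_cases h : (a ≤ c ∧ c ≤ b) ∧ (a ≤ d ∧ d ≤ b)
    · exact .inr ⟨hin c h.1.1 h.1.2, hin d h.2.1 h.2.2⟩
    · exact .inl ⟨hout c (by omega), hout d (by omega)⟩
  · by_cases h : c ≠ a ∧ c ≠ b
    · exact .inl (hnz c h.1 h.2)
    · exact .inr (hnz d (by omega) (by omega))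

/-- The intersection point is explicit: each endpoint is weighted by the area of the triangle that
the other endpoint of its segment spans with the other segment. Both pairs of areas add up to the
quadrilateral, which is `hsum`. -/
theorem IsConvexPolygon.not_disjoint (hp : IsConvexPolygon p) {a b c d : Fin n} (hac : a < c)
    (hcb : c < b) (hbd : b < d) :
    ¬ Disjoint (openSegment ℝ (p a) (p b)) (openSegment ℝ (p c) (p d)) := by
  rw [Set.not_disjoint_iff]
  have h1 := hp.2 a c b hac hcb
  have h2 := hp.2 a b d (hac.trans hcb) hbd
  have h3 := hp.2 a c d hac (hcb.trans hbd)
  have h4 := hp.2 c b d hcb hbd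
  set O₁ := orientation (p a) (p c) (p b) with e1
  set O₂ := orientation (p a) (p b) (p d) with e2
  set O₃ := orientation (p a) (p c) (p d) with e3
  set O₄ := orientation (p c) (p b) (p d) with e4
  have hs : 0 < O₁ + O₂ := by linarith
  have hsum : O₁ + O₂ = O₃ + O₄ := by
    simp only [e1, e2, e3, e4, orientation]; ring
  refine ⟨(O₄ / (O₁ + O₂)) • p a + (O₃ / (O₁ + O₂)) • p b,
    ⟨_, _, by positivity, by positivity, ?_, rfl⟩,
    ⟨O₂ / (O₁ + O₂), O₁ / (O₁ + O₂), by positivity, by positivity, ?_, ?_⟩⟩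
  · field_simp; linarith
  · field_simp; linarith
  · ext i
    simp only [PiLp.add_apply, PiLp.smul_apply, smul_eq_mul]
    field_simp
    simp only [e1, e2, e3, e4, orientation]
    fin_cases i <;> simp only [Fin.zero_eta, Fin.mk_one] <;> ring

/-- A graph on the vertices of a convex polygon is noncrossing iff no two edges interleave. -/
theorem IsConvexPolygon.isNoncrossing_iff (hp : IsConvexPolygon p) (T : SimpleGraph (Fin n)) :
    IsNoncrossing p T ↔
      ∀ a b c d : Fin n, T.Adj a b → T.Adj c d → a < c → c < b → b < d → False := by
  constructor
  · intro h a b c d hab hcd h1 h2 h3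
    refine hp.not_disjoint h1 h2 h3 (h a b c d hab hcd ?_)
    simp only [ne_eq, Sym2.eq_iff]
    omega
  · intro h
    have key : ∀ a b c d : Fin n, a < b → c < d → T.Adj a b → T.Adj c d → s(a, b) ≠ s(c, d) →
        Disjoint (openSegment ℝ (p a) (p b)) (openSegment ℝ (p c) (p d)) := by
      intro a b c d h1 h2 hab hcd hne
      refine hp.disjoint h1 h2 ?_ (fun hx => h a b c d hab hcd hx.1 hx.2.1 hx.2.2)
        (fun hx => h c d a b hcd hab hx.1 hx.2.1 hx.2.2)
      simp only [ne_eq, Prod.mk.injEq]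
      rintro ⟨rfl, rfl⟩
      exact hne rfl
    intro a b c d hab hcd hne
    have h1 : T.Adj b a := hab.symm
    have h2 : T.Adj d c := hcd.symm
    rcases lt_or_gt_of_ne hab.ne with hlt | hlt <;> rcases lt_or_gt_of_ne hcd.ne with hlt' | hlt'
    · exact key a b c d hlt hlt' hab hcd hne
    · rw [openSegment_symm ℝ (p c)]
      exact key a b d c hlt hlt' hab h2 (by rwa [Sym2.eq_swap (a := d)])
    · rw [openSegment_symm ℝ (p a)]
      exact key b a c d hlt hlt' h1 hcd (by rwa [Sym2.eq_swap (a := b)])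
    · rw [openSegment_symm ℝ (p a), openSegment_symm ℝ (p c)]
      exact key b a d c hlt hlt' h1 h2
        (by rwa [Sym2.eq_swap (a := d), Sym2.eq_swap (a := b)])

/-- Two vertices are adjacent in a triangulation iff the segment crosses no edge. -/
theorem IsTriangulation.adj_of_forall (hp : IsConvexPolygon p) {T : SimpleGraph (Fin n)}
    (hT : IsTriangulation p T) {i j : Fin n} (hij : i < j)
    (h : ∀ c d, T.Adj c d → ¬ (c < i ∧ i < d ∧ d < j) ∧ ¬ (i < c ∧ c < j ∧ j < d)) :
    T.Adj i j := by
  have hnc := (hp.isNoncrossing_iff T).1 hT.1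
  have h1 : IsNoncrossing p (T ⊔ SimpleGraph.edge i j) := by
    rw [hp.isNoncrossing_iff]
    intro a b c d hab hcd h1 h2 h3
    simp only [SimpleGraph.sup_adj, SimpleGraph.edge_adj] at hab hcd
    rcases hab with hab | ⟨hab, -⟩ <;> rcases hcd with hcd | ⟨hcd, -⟩
    · exact hnc a b c d hab hcd h1 h2 h3
    · have := h a b hab
      omega
    · have := h c d hcd
      omega
    · omega
  refine hT.2 h1 le_sup_left ?_
  rw [SimpleGraph.sup_adj, SimpleGraph.edge_adj]
  exact .inr ⟨.inl ⟨rfl, rfl⟩, hij.ne⟩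

/-- The edges of the graph as a relation on the numbers of the vertices. -/
def edgeRel (G : SimpleGraph (Fin n)) (i j : ℕ) : Prop :=
  ∃ (hi : i < n) (hj : j < n), G.Adj ⟨i, hi⟩ ⟨j, hj⟩

/-- Split the edge ij at the largest neighbour k of i strictly between them; i + 1 is such a
neighbour since nothing crosses a side. An edge crossing kj would cross ij or ik, or join i to a
vertex beyond k, so kj is an edge by maximality. -/
theorem IsTriangulation.good (hp : IsConvexPolygon p) {T G : SimpleGraph (Fin n)}
    (hT : IsTriangulation p T) (hTG : T ≤ G) :
    Good (edgeRel G) 0 (n - 1) := by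
  classical
  have hnc := (hp.isNoncrossing_iff T).1 hT.1
  have key : ∀ m : ℕ, ∀ i j : Fin n, i < j → (j : ℕ) - i = m → T.Adj i j →
      Good (edgeRel G) i j := by
    intro m
    induction m using Nat.strong_induction_on with
    | _ m ih =>
      intro i j hij hm hadj
      have hE : edgeRel G i j := ⟨i.isLt, j.isLt, hTG hadj⟩
      by_cases h1 : (j : ℕ) = i + 1
      · rw [h1] at hE ⊢
        exact .side hE
      · let S : Finset (Fin n) := Finset.univ.filter fun k => i < k ∧ k < j ∧ T.Adj i k
        have hS : S.Nonempty := by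
          refine ⟨⟨i + 1, by omega⟩, ?_⟩
          simp only [S, Finset.mem_filter, Finset.mem_univ, true_and]
          refine ⟨by simp [Fin.lt_def], by simp only [Fin.lt_def]; omega,
            hT.adj_of_forall hp (by simp [Fin.lt_def]) fun c d _ => ?_⟩
          simp only [Fin.lt_def]
          omega
        have hk := S.max'_mem hS
        have hmax := S.le_max'
        set k := S.max' hS
        simp only [S, Finset.mem_filter, Finset.mem_univ, true_and] at hk hmax
        obtain ⟨hik, hkj, hadj'⟩ := hk
        have hkj' : T.Adj k j := by
          refine hT.adj_of_forall hp hkj fun c d hcd => ⟨?_, ?_⟩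
          · rintro ⟨hck, hkd, hdj⟩
            rcases lt_trichotomy c i with hci | rfl | hci
            · exact hnc c d i j hcd hadj hci (hik.trans hkd) hdj
            · exact absurd (hmax d ⟨hik.trans hkd, hdj, hcd⟩) (not_le.2 hkd)
            · exact hnc i k c d hadj' hcd hci hck hkd
          · rintro ⟨hkc, hcj, hjd⟩
            exact hnc i j c d hadj hcd (hik.trans hkc) hcj hjd
        exact .split hE (ih (k - i) (by omega) i k hik rfl hadj')
          (ih (j - k) (by omega) k j hkj rfl hkj')
  have hn := hp.1
  have := key (n - 1) ⟨0, by omega⟩ ⟨n - 1, by omega⟩ (by simp only [Fin.lt_def]; omega)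
    (by simp) (hT.adj_of_forall hp (by simp only [Fin.lt_def]; omega) fun c d _ => by
      simp only [Fin.lt_def]; omega)
  exact this

/-! ### Building a triangulation from the splitting vertices -/

/-- The segments that arise from the segment `i j` by repeated splitting at `w i j`. -/
inductive Reach (w : ℕ → ℕ → ℕ) : ℕ → ℕ → ℕ → ℕ → Prop
  | refl (i j : ℕ) : Reach w i j i j
  | left {i j a b : ℕ} (hij : i + 1 < j) (h : Reach w i (w i j) a b) : Reach w i j a b
  | right {i j a b : ℕ} (hij : i + 1 < j) (h : Reach w (w i j) j a b) : Reach w i j a b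

theorem reach_iff {w : ℕ → ℕ → ℕ} {i j a b : ℕ} :
    Reach w i j a b ↔ (a = i ∧ b = j) ∨
      (i + 1 < j ∧ (Reach w i (w i j) a b ∨ Reach w (w i j) j a b)) := by
  constructor
  · intro h
    cases h with
    | refl => exact .inl ⟨rfl, rfl⟩
    | left hij h => exact .inr ⟨hij, .inl h⟩
    | right hij h => exact .inr ⟨hij, .inr h⟩
  · rintro (⟨rfl, rfl⟩ | ⟨hij, h | h⟩)
    · exact .refl _ _
    · exact .left hij h
    · exact .right hij h

/-- `w` finds a splitting vertex of every good segment that is not a side. -/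
def Splits (E : ℕ → ℕ → Prop) (w : ℕ → ℕ → ℕ) : Prop :=
  ∀ i j, Good E i j → i + 1 < j → Good E i (w i j) ∧ Good E (w i j) j

theorem Splits.reach {E : ℕ → ℕ → Prop} {w : ℕ → ℕ → ℕ} (hw : Splits E w) {i j a b : ℕ}
    (hij : Good E i j) (h : Reach w i j a b) : Good E a b ∧ i ≤ a ∧ b ≤ j := by
  induction h with
  | refl i j => exact ⟨hij, le_rfl, le_rfl⟩
  | left h1 _ ih =>
    have h2 := hw _ _ hij h1
    have h3 := ih h2.1
    exact ⟨h3.1, h3.2.1, h3.2.2.trans h2.2.lt.le⟩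
  | right h1 _ ih =>
    have h2 := hw _ _ hij h1
    have h3 := ih h2.2
    exact ⟨h3.1, h2.1.lt.le.trans h3.2.1, h3.2.2⟩

/-- Segments on different sides of the splitting vertex cannot interleave; those on the same side
are covered by induction. -/
theorem Splits.not_cross {E : ℕ → ℕ → Prop} {w : ℕ → ℕ → ℕ} (hw : Splits E w) {i j : ℕ}
    (hij : Good E i j) {a b c d : ℕ} (h₁ : Reach w i j a b) (h₂ : Reach w i j c d)
    (hac : a < c) (hcb : c < b) (hbd : b < d) : False := by
  induction hm : j - i using Nat.strong_induction_on generalizing i j with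
  | _ m ih =>
    have r1 := hw.reach hij h₁
    have r2 := hw.reach hij h₂
    rcases reach_iff.1 h₁ with ⟨rfl, rfl⟩ | ⟨h, h₁⟩
    · omega
    rcases reach_iff.1 h₂ with ⟨rfl, rfl⟩ | ⟨-, h₂⟩
    · omega
    have hs := hw i j hij h
    have l1 := hs.1.lt
    have l2 := hs.2.lt
    rcases h₁ with h₁ | h₁ <;> rcases h₂ with h₂ | h₂
    · exact ih _ (by omega) hs.1 h₁ h₂ rfl
    · have := hw.reach hs.1 h₁
      have := hw.reach hs.2 h₂
      omega
    · have := hw.reach hs.2 h₁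
      have := hw.reach hs.1 h₂
      omega
    · exact ih _ (by omega) hs.2 h₁ h₂ rfl

/-- A segment that crosses none of the segments reached is itself one of them. -/
theorem Splits.reach_of_forall {E : ℕ → ℕ → Prop} {w : ℕ → ℕ → ℕ} (hw : Splits E w) {i j : ℕ}
    (hij : Good E i j) {c d : ℕ} (hic : i ≤ c) (hcd : c < d) (hdj : d ≤ j)
    (h : ∀ a b, Reach w i j a b → ¬ (a < c ∧ c < b ∧ b < d) ∧ ¬ (c < a ∧ a < d ∧ d < b)) :
    Reach w i j c d := by
  induction hm : j - i using Nat.strong_induction_on generalizing i j with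
  | _ m ih =>
    by_cases h1 : i + 1 < j
    · have hs := hw i j hij h1
      have l1 := hs.1.lt
      have l2 := hs.2.lt
      by_cases hd : d ≤ w i j
      · exact .left h1 (ih _ (by omega) hs.1 hic hd (fun a b hab => h a b (.left h1 hab)) rfl)
      by_cases hc : w i j ≤ c
      · exact .right h1 (ih _ (by omega) hs.2 hc hdj (fun a b hab => h a b (.right h1 hab)) rfl)
      · have h2 := h i (w i j) (.left h1 (.refl _ _))
        have h3 := h (w i j) j (.right h1 (.refl _ _))
        obtain ⟨rfl, rfl⟩ : c = i ∧ d = j := by omega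
        exact .refl _ _
    · obtain ⟨rfl, rfl⟩ : c = i ∧ d = j := by have := hij.lt; omega
      exact .refl _ _

/-- The graph on the vertices `0, …, n - 1` whose edges are the segments reached from the side
between the first and the last vertex. -/
def reachGraph (n : ℕ) (w : ℕ → ℕ → ℕ) : SimpleGraph (Fin n) :=
  SimpleGraph.fromRel fun a b => Reach w 0 (n - 1) a b

theorem Splits.reachGraph_adj {E : ℕ → ℕ → Prop} {w : ℕ → ℕ → ℕ} (hw : Splits E w)
    (h : Good E 0 (n - 1)) {a b : Fin n} :
    (reachGraph n w).Adj a b ↔ Reach w 0 (n - 1) a b ∨ Reach w 0 (n - 1) b a := by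
  rw [reachGraph, SimpleGraph.fromRel_adj]
  refine and_iff_right_of_imp ?_
  rintro (h' | h')
  · have := (hw.reach h h').1.lt
    rintro rfl
    omega
  · have := (hw.reach h h').1.lt
    rintro rfl
    omega

theorem Splits.reachGraph_adj_of_lt {E : ℕ → ℕ → Prop} {w : ℕ → ℕ → ℕ} (hw : Splits E w)
    (h : Good E 0 (n - 1)) {a b : Fin n} (hab : a < b) :
    (reachGraph n w).Adj a b ↔ Reach w 0 (n - 1) a b := by
  rw [hw.reachGraph_adj h]
  refine or_iff_left fun h' => ?_
  have := (hw.reach h h').1.lt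
  omega

/-- For maximality, an edge of a larger noncrossing graph crosses no reached segment, so it is
reached itself by `Splits.reach_of_forall`. -/
theorem Splits.isTriangulation {E : ℕ → ℕ → Prop} {w : ℕ → ℕ → ℕ} (hp : IsConvexPolygon p)
    (hw : Splits E w) (h : Good E 0 (n - 1)) : IsTriangulation p (reachGraph n w) := by
  refine ⟨?_, fun T hT hle => ?_⟩
  · rw [hp.isNoncrossing_iff]
    intro a b c d hab hcd h1 h2 h3
    rw [hw.reachGraph_adj_of_lt h (h1.trans h2)] at hab
    rw [hw.reachGraph_adj_of_lt h (h2.trans h3)] at hcd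
    exact hw.not_cross h hab hcd h1 h2 h3
  · have hnc := (hp.isNoncrossing_iff T).1 hT
    have key : ∀ c d : Fin n, c < d → T.Adj c d → (reachGraph n w).Adj c d := by
      intro c d hcd hadj
      rw [hw.reachGraph_adj_of_lt h hcd]
      refine hw.reach_of_forall h (Nat.zero_le _) hcd (by omega) fun a b hab => ?_
      have hr := hw.reach h hab
      have hlt := hr.1.lt
      have hn := hp.1
      have hab' : T.Adj ⟨a, by omega⟩ ⟨b, by omega⟩ :=
        hle ((hw.reachGraph_adj_of_lt h (by simpa [Fin.lt_def] using hlt)).2 hab)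
      exact ⟨fun hx => hnc _ _ _ _ hab' hadj (Fin.lt_def.2 hx.1) (Fin.lt_def.2 hx.2.1)
          (Fin.lt_def.2 hx.2.2),
        fun hx => hnc _ _ _ _ hadj hab' (Fin.lt_def.2 hx.1) (Fin.lt_def.2 hx.2.1)
          (Fin.lt_def.2 hx.2.2)⟩
    intro c d hadj
    rcases lt_or_gt_of_ne hadj.ne with hlt | hlt
    · exact key c d hlt hadj
    · exact (key d c hlt hadj.symm).symm

theorem Splits.reachGraph_le {G : SimpleGraph (Fin n)} {w : ℕ → ℕ → ℕ}
    (hw : Splits (edgeRel G) w) (h : Good (edgeRel G) 0 (n - 1)) : reachGraph n w ≤ G := by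
  intro a b hab
  rcases (hw.reachGraph_adj h).1 hab with hr | hr
  · obtain ⟨_, _, hadj⟩ := (hw.reach h hr).1.edge
    exact hadj
  · obtain ⟨_, _, hadj⟩ := (hw.reach h hr).1.edge
    exact hadj.symm

end Polygon

/-! ### Multiplying blocks of a table -/

/-- The entry of the table with rows of length `N` that is stored from `base` on. -/
def entry (mem : ℕ → ℕ) (base N i j : ℕ) : ℕ := mem (base + i * N + j)

theorem index_lt {N i j : ℕ} (hi : i < N) (hj : j < N) : i * N + j < N * N := by
  nlinarith

theorem index_inj {N i j i' j' : ℕ} (hj : j < N) (hj' : j' < N) :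
    i * N + j = i' * N + j' ↔ i = i' ∧ j = j' := by
  constructor
  · intro h
    have h1 : i = i' := by
      have h2 := congrArg (· / N) h
      have hN : 0 < N := by omega
      simpa [Nat.add_comm _ j, Nat.add_comm _ j', Nat.add_mul_div_right _ _ hN,
        Nat.div_eq_of_lt hj, Nat.div_eq_of_lt hj'] using h2
    subst h1
    exact ⟨rfl, by omega⟩
  · rintro ⟨rfl, rfl⟩; rfl

theorem index_div {s i j : ℕ} (hj : j < s) : (i * s + j) / s = i ∧ (i * s + j) % s = j := by
  have hs : 0 < s := by omega
  rw [add_comm]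
  simp [Nat.add_mul_div_right _ _ hs, Nat.div_eq_of_lt hj, Nat.mod_eq_of_lt hj]

theorem div_lt_of_lt_mul_self {s x : ℕ} (hx : x < s * s) : x / s < s ∧ x % s < s := by
  have hs : 0 < s := by
    rcases Nat.eq_zero_or_pos s with rfl | h
    · simp at hx
    · exact h
  exact ⟨(Nat.div_lt_iff_lt_mul hs).2 hx, Nat.mod_lt _ hs⟩

namespace Expr

/-! The registers: size of the input, side length of the tables, addresses of the tables of good
segments and of splittings, free address, size of the memory of a call, square of the side
length, row (from the end) and column of the current cell, its rank, quotient and block size of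
the rank, the first splitting vertex, the first row of the block, the square of the block size,
scratch registers, and the stack pointer and the current segment of the extraction. -/

abbrev vn : Expr := var 0
abbrev vN : Expr := var 1
abbrev vX : Expr := var 2
abbrev vA : Expr := var 3
abbrev vF : Expr := var 4
abbrev vR : Expr := var 5
abbrev vM : Expr := var 6
abbrev ve : Expr := var 7
abbrev vo : Expr := var 8
abbrev vc : Expr := var 9
abbrev vq : Expr := var 10
abbrev vs : Expr := var 11
abbrev vk : Expr := var 12
abbrev vi : Expr := var 13
abbrev vs2 : Expr := var 14
abbrev vx : Expr := var 15
abbrev va : Expr := var 16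
abbrev vb : Expr := var 17
abbrev vv : Expr := var 18
abbrev vp : Expr := var 20
abbrev vI : Expr := var 21
abbrev vJ : Expr := var 22
abbrev vK : Expr := var 23

end Expr

open Expr

/-- Copy the blocks with corners `(vi, vk)` and `(vk, vo)` of the first table. -/
def copyBlocks : Program :=
  forUp 15 14 (.seq (assign 16 (vx / vs)) (.seq (assign 17 (vx - va * vs))
    (.seq (loadC 18 (vX + (vi + va) * vN + (vk + vb))) (.seq (storeC (vF + vx) vv)
      (.seq (loadC 18 (vX + (vk + va) * vN + (vo + vb))) (storeC (vF + vs2 + vx) vv))))))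

theorem Triple.copyBlocks {W B T : ℕ} {σ : MachineState} {N X F s i₀ j₀ k₀ : ℕ}
    (h1 : σ.reg 1 = N) (h2 : σ.reg 2 = X) (h4 : σ.reg 4 = F) (h8 : σ.reg 8 = j₀)
    (h11 : σ.reg 11 = s) (h12 : σ.reg 12 = k₀) (h13 : σ.reg 13 = i₀) (h14 : σ.reg 14 = s * s)
    (hi : i₀ + s ≤ N) (hj : j₀ + s ≤ N) (hk : k₀ + s ≤ N) (hXF : X + N * N ≤ F)
    (h01 : ∀ i < N, ∀ j < N, entry σ.mem X N i j ≤ 1) (hT : (s * s + 1) * 400 + 100 ≤ T) :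
    Triple W B copyBlocks σ T (fun σ' =>
      (∀ r, r < 15 ∨ 18 < r → σ'.reg r = σ.reg r) ∧
      (∀ a, a < F ∨ F + 2 * (s * s) ≤ a → σ'.mem a = σ.mem a) ∧
      ∀ x < s * s, σ'.mem (F + x) = entry σ.mem X N (i₀ + x / s) (k₀ + x % s) ∧
        σ'.mem (F + s * s + x) = entry σ.mem X N (k₀ + x / s) (j₀ + x % s)) := by
  refine of_small fun hsm => ?_
  have hsB : s * s ≤ B := h14 ▸ hsm 14 (by norm_num)
  refine of_eight fun hB8 => ?_
  refine (Triple.forUp (T' := 300) (by norm_num) (by norm_num) (by norm_num)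
    (fun m σ' => (∀ r, r < 15 ∨ 18 < r → σ'.reg r = σ.reg r) ∧
      (∀ a, a < F ∨ F + 2 * (s * s) ≤ a → σ'.mem a = σ.mem a) ∧
      ∀ x < m, σ'.mem (F + x) = entry σ.mem X N (i₀ + x / s) (k₀ + x % s) ∧
        σ'.mem (F + s * s + x) = entry σ.mem X N (k₀ + x / s) (j₀ + x % s)) h14 hT ?_ ?_).mono
      le_rfl fun σ' h => h.1
  · refine ⟨fun r hr => ?_, by simp, by simp⟩
    rw [set_reg, if_neg (by omega)]
  · rintro x hx τ ⟨hreg, hmem, hval⟩ hτx hτ14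
    obtain ⟨hdiv, hmod⟩ := div_lt_of_lt_mul_self hx
    have hmod' : x - x / s * s = x % s := Nat.mod_eq_sub_div_mul.symm
    have hsrc : ∀ i < N, ∀ j < N, τ.mem (X + i * N + j) = entry σ.mem X N i j := by
      intro i hi j hj
      have := index_lt hi hj
      rw [entry, hmem _ (by omega)]
    have e1 := hreg 1 (by norm_num)
    have e2 := hreg 2 (by norm_num)
    have e4 := hreg 4 (by norm_num)
    have e8 := hreg 8 (by norm_num)
    have e11 := hreg 11 (by norm_num)
    have e12 := hreg 12 (by norm_num)
    have e13 := hreg 13 (by norm_num)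
    have hv1 := hsrc (i₀ + x / s) (by omega) (k₀ + x % s) (by omega)
    have hv2 := hsrc (k₀ + x / s) (by omega) (j₀ + x % s) (by omega)
    have hb1 := h01 (i₀ + x / s) (by omega) (k₀ + x % s) (by omega)
    have hb2 := h01 (k₀ + x / s) (by omega) (j₀ + x % s) (by omega)
    have hlt := index_lt (i := k₀ + x / s) (j := j₀ + x % s) (N := N) (by omega) (by omega)
    -- The first copied entry goes to free memory, so the second source entry is still intact when
    -- it is read.
    have hne : X + (k₀ + x / s) * N + (j₀ + x % s) ≠ F + x := by omega
    refine seq_assign rfl ?_ (by norm_num) (seq_assign rfl ?_ (by norm_num)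
      (seq_load rfl ?_ (by norm_num) (seq_store rfl rfl (by norm_num)
      (seq_load rfl ?_ (by norm_num) (store rfl rfl (by norm_num) ?_)))))
    · have := Nat.div_le_self x s
      simp [hτx, e11, h11]; omega
    · simp [hτx, e11, h11]; omega
    · simp [hτx, e11, h11, e2, h2, e13, h13, e1, h1, e12, h12, hmod', hv1]; omega
    · simp [hτx, e11, h11, e2, h2, e13, h13, e1, h1, e12, h12, e4, h4, e8, h8, hmod', hne, hv2]
      omega
    · simp [hτx, e11, h11, e2, h2, e13, h13, e1, h1, e12, h12, e4, h4, e8, h8, hmod', hne, hv2,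
        hv1, hτ14]
      refine ⟨fun r hr => ?_, fun a ha => ?_, fun y hy => ⟨?_, ?_⟩⟩
      · rw [if_neg (by omega), if_neg (by omega), if_neg (by omega), if_neg (by omega),
          if_neg (by omega), hreg r hr]
      · rw [if_neg (by omega), if_neg (by omega), hmem a ha]
      · by_cases hyx : y = x
        · subst hyx
          rw [if_neg (by omega), if_pos rfl]
        · rw [if_neg (by omega), if_neg (by omega)]
          exact (hval y (by omega)).1
      · by_cases hyx : y = x
        · subst hyx
          rw [if_pos rfl]
        · rw [if_neg (by omega), if_neg (by omega)]
          exact (hval y (by omega)).2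

/-- Record the nonzero entries of the product in the block with corner `(vi, vo)` of the second
table. -/
def collectProduct : Program :=
  forUp 15 14 (.seq (assign 16 (vx / vs)) (.seq (assign 17 (vx - va * vs))
    (.seq (loadC 18 (vF + lit 2 * vs2 + vx))
      (ifC vv (storeC (vA + (vi + va) * vN + (vo + vb)) (lit 1)) .skip))))

theorem Triple.collectProduct {W B T : ℕ} {σ : MachineState} {N A F s i₀ j₀ : ℕ}
    (h1 : σ.reg 1 = N) (h3 : σ.reg 3 = A) (h4 : σ.reg 4 = F) (h8 : σ.reg 8 = j₀)
    (h11 : σ.reg 11 = s) (h13 : σ.reg 13 = i₀) (h14 : σ.reg 14 = s * s)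
    (hi : i₀ + s ≤ N) (hj : j₀ + s ≤ N) (hAF : A + N * N ≤ F)
    (h01 : ∀ i < N, ∀ j < N, entry σ.mem A N i j ≤ 1)
    (hB : ∀ x < s * s, σ.mem (F + 2 * (s * s) + x) ≤ B) (hT : (s * s + 1) * 400 + 100 ≤ T) :
    Triple W B collectProduct σ T (fun σ' =>
      (∀ r, r < 15 ∨ 18 < r → σ'.reg r = σ.reg r) ∧
      (∀ a, a < A ∨ A + N * N ≤ a → σ'.mem a = σ.mem a) ∧
      ∀ i < N, ∀ j < N, entry σ'.mem A N i j ≤ 1 ∧ (entry σ'.mem A N i j = 1 ↔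
        entry σ.mem A N i j = 1 ∨ ∃ x < s * s, i = i₀ + x / s ∧ j = j₀ + x % s ∧
          σ.mem (F + 2 * (s * s) + x) ≠ 0)) := by
  refine of_small fun hsm => ?_
  have hsB : s * s ≤ B := h14 ▸ hsm 14 (by norm_num)
  refine of_eight fun hB8 => ?_
  refine (Triple.forUp (T' := 300) (by norm_num) (by norm_num) (by norm_num)
    (fun m σ' => (∀ r, r < 15 ∨ 18 < r → σ'.reg r = σ.reg r) ∧
      (∀ a, a < A ∨ A + N * N ≤ a → σ'.mem a = σ.mem a) ∧
      ∀ i < N, ∀ j < N, entry σ'.mem A N i j ≤ 1 ∧ (entry σ'.mem A N i j = 1 ↔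
        entry σ.mem A N i j = 1 ∨ ∃ x < m, i = i₀ + x / s ∧ j = j₀ + x % s ∧
          σ.mem (F + 2 * (s * s) + x) ≠ 0)) h14 hT ?_ ?_).mono
      le_rfl fun σ' h => h.1
  · refine ⟨fun r hr => ?_, by simp, fun i hi j hj => ⟨h01 i hi j hj, by simp⟩⟩
    rw [set_reg, if_neg (by omega)]
  · rintro x hx τ ⟨hreg, hmem, hval⟩ hτx hτ14
    obtain ⟨hdiv, hmod⟩ := div_lt_of_lt_mul_self hx
    have hmod' : x - x / s * s = x % s := Nat.mod_eq_sub_div_mul.symm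
    have e1 := (hreg 1 (by norm_num)).trans h1
    have e3 := (hreg 3 (by norm_num)).trans h3
    have e4 := (hreg 4 (by norm_num)).trans h4
    have e8 := (hreg 8 (by norm_num)).trans h8
    have e11 := (hreg 11 (by norm_num)).trans h11
    have e13 := (hreg 13 (by norm_num)).trans h13
    have hv : τ.mem (F + 2 * (s * s) + x) = σ.mem (F + 2 * (s * s) + x) := hmem _ (by omega)
    have hlt := index_lt (i := i₀ + x / s) (j := j₀ + x % s) (N := N) (by omega) (by omega)
    refine seq_assign rfl ?_ (by norm_num) (seq_assign rfl ?_ (by norm_num)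
      (seq_load rfl ?_ (by norm_num) (ifC (T₁ := 50) rfl (by norm_num) (fun h0 =>
        store rfl rfl (by norm_num) ?_) (fun h0 => skip (by norm_num) ?_))))
    · have := Nat.div_le_self x s
      simp [hτx, e11]; omega
    · simp [hτx, e11]; omega
    · simp [hτx, e4, hτ14, hv, hB x hx]
    · simp [hτx, e4, hτ14, hv] at h0
      simp [hτx, e11, e3, e13, e1, e4, e8, hmod', hτ14]
      refine ⟨fun r hr => ?_, fun a ha => ?_, fun i hi' j hj' => ?_⟩
      · rw [if_neg (by omega), if_neg (by omega), if_neg (by omega), if_neg (by omega),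
          hreg r hr]
      · rw [if_neg (by omega), hmem a ha]
      · have hinj := index_inj (i := i) (i' := i₀ + x / s) hj' (show j₀ + x % s < N by omega)
        have hv' := hval i hi' j hj'
        simp only [entry, put_mem, set_mem] at hv' ⊢
        by_cases hij : i = i₀ + x / s ∧ j = j₀ + x % s
        · rw [if_pos (by have := hinj.2 hij; omega)]
          exact ⟨le_rfl, iff_of_true rfl (.inr ⟨x, by omega, hij.1, hij.2, h0⟩)⟩
        · rw [if_neg (by intro h; exact hij (hinj.1 (by omega)))]
          refine ⟨hv'.1, hv'.2.trans (or_congr_right ⟨?_, ?_⟩)⟩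
          · rintro ⟨y, hy, h⟩
            exact ⟨y, by omega, h⟩
          · rintro ⟨y, hy, h, h', h''⟩
            refine ⟨y, ?_, h, h', h''⟩
            rcases Nat.lt_or_eq_of_le hy with hy | rfl
            · exact hy
            · exact absurd ⟨h, h'⟩ hij
    · simp [hτx, e4, hτ14, hv] at h0
      simp [hτx, e11, e4, hmod', hτ14]
      refine ⟨fun r hr => ?_, fun a ha => hmem a ha, fun i hi' j hj' => ?_⟩
      · rw [if_neg (by omega), if_neg (by omega), if_neg (by omega), if_neg (by omega),
          hreg r hr]
      · have hv' := hval i hi' j hj'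
        refine ⟨hv'.1, hv'.2.trans (or_congr_right ⟨?_, ?_⟩)⟩
        · rintro ⟨y, hy, h⟩
          exact ⟨y, by omega, h⟩
        · rintro ⟨y, hy, h, h', h''⟩
          refine ⟨y, ?_, h, h', h''⟩
          rcases Nat.lt_or_eq_of_le hy with hy | rfl
          · exact hy
          · exact absurd h0 h''

/-- Multiply the blocks with corners `(vi, vk)` and `(vk, vo)` of the first table and record the
nonzero entries of the product in the second table. -/
def updateBlock (N : ℕ) (P : Program) : Program :=
  .seq copyBlocks (.seq (.call 4 11 N P) (.seq collectProduct (assign 4 (vF + vR))))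

/-- The area written by the call is abandoned: the free address advances by R ≥ (s + 2) ^ k, and
everything behind it is still zero for the next call. -/
theorem Triple.updateBlock {W B T : ℕ} {σ : MachineState} {N X A F R s i₀ j₀ k₀ k Nr : ℕ}
    {P : Program} {μ : ℕ → ℕ} (hk3 : 3 ≤ k) (hP : Multiplies P k μ) (hNr : P.RegsBelow Nr)
    (h1 : σ.reg 1 = N) (h2 : σ.reg 2 = X) (h3 : σ.reg 3 = A) (h4 : σ.reg 4 = F)
    (h5 : σ.reg 5 = R) (h8 : σ.reg 8 = j₀)
    (h11 : σ.reg 11 = s) (h12 : σ.reg 12 = k₀) (h13 : σ.reg 13 = i₀) (h14 : σ.reg 14 = s * s)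
    (hs : 1 ≤ s) (hi : i₀ + s ≤ N) (hj : j₀ + s ≤ N) (hk : k₀ + s ≤ N)
    (hXA : X + N * N ≤ A) (hAF : A + N * N ≤ F) (hR : (N + 2) ^ k = R) (hFB : F + R ≤ B)
    (h01 : ∀ i < N, ∀ j < N, entry σ.mem X N i j ≤ 1)
    (h01' : ∀ i < N, ∀ j < N, entry σ.mem A N i j ≤ 1)
    (hz : ∀ a, F ≤ a → σ.mem a = 0) (hT : 2 * μ s + Nr + (s * s) * 2000 ≤ T) :
    Triple W B (updateBlock Nr P) σ T (fun σ' =>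
      (∀ r, r ≠ 4 → r < 15 ∨ 18 < r → σ'.reg r = σ.reg r) ∧ σ'.reg 4 = F + R ∧
      (∀ a, a < A → σ'.mem a = σ.mem a) ∧ (∀ a, F + R ≤ a → σ'.mem a = 0) ∧
      BlockUpdate N i₀ j₀ k₀ s (entry σ.mem X N) (entry σ.mem A N) (entry σ'.mem A N)) := by
  have hss : 1 ≤ s * s := Nat.mul_pos hs hs
  have hRs : (s + 2) ^ k ≤ R := by
    rw [← hR]; exact Nat.pow_le_pow_left (by omega) k
  have hR3 : 3 * (s * s) + s ≤ (s + 2) ^ k := by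
    calc 3 * (s * s) + s ≤ (s + 2) ^ 3 := by nlinarith
      _ ≤ _ := Nat.pow_le_pow_right (by omega) hk3
  refine seq (T₁ := (s * s + 1) * 400 + 100)
    (T₂ := (2 * μ s + Nr + 10) + (((s * s + 1) * 400 + 100) + 50))
    ((copyBlocks h1 h2 h4 h8 h11 h12 h13 h14 hi hj hk (by omega) h01 le_rfl).mono le_rfl ?_)
    (by omega)
  rintro σ₁ ⟨hr₁, hm₁, hv₁⟩
  have hfin : ∀ t : Fin s, (t : ℕ) < s := fun t => t.isLt
  let U : Matrix (Fin s) (Fin s) ℕ := fun a t => entry σ.mem X N (i₀ + a) (k₀ + t)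
  let V : Matrix (Fin s) (Fin s) ℕ := fun t b => entry σ.mem X N (k₀ + t) (j₀ + b)
  have hU : ∀ a t, U a t ≤ 1 := fun a t =>
    h01 _ (by have := a.isLt; omega) _ (by have := t.isLt; omega)
  have hV : ∀ a t, V a t ≤ 1 := fun a t =>
    h01 _ (by have := a.isLt; omega) _ (by have := t.isLt; omega)
  refine seq (T₁ := 2 * μ s + Nr + 10) (T₂ := ((s * s + 1) * 400 + 100) + 50)
    ((call (base := F) hk3 hP hNr (by norm_num) (by norm_num) hs ((hr₁ 4 (by norm_num)).trans h4)
      ((hr₁ 11 (by norm_num)).trans h11) (by omega) U V hU hV ?_ ?_ ?_ le_rfl).mono le_rfl ?_)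
    (by omega)
  · intro a t
    have h := (hv₁ (a * s + t) (index_lt a.isLt t.isLt)).1
    rw [(index_div t.isLt).1, (index_div t.isLt).2] at h
    rw [add_assoc, h]
  · intro a t
    have h := (hv₁ (a * s + t) (index_lt a.isLt t.isLt)).2
    rw [(index_div t.isLt).1, (index_div t.isLt).2] at h
    rw [add_assoc (F + s * s), h]
  · intro a ha
    rw [hm₁ a (by omega), hz a (by omega)]
  rintro σ₂ ⟨hr₂, hm₂, hv₂⟩
  have hlow : ∀ a < F, σ₂.mem a = σ.mem a := fun a ha => by
    rw [hm₂ a (.inl ha), hm₁ a (.inl ha)]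
  -- An entry of the product counts the splitting vertices in the block of k. It is at most s, so it
  -- fits into a register, and only its being nonzero matters.
  have hprod : ∀ x < s * s, σ₂.mem (F + 2 * (s * s) + x) ≤ s ∧
      (σ₂.mem (F + 2 * (s * s) + x) ≠ 0 ↔ ∃ k, k₀ ≤ k ∧ k < k₀ + s ∧
        entry σ.mem X N (i₀ + x / s) k = 1 ∧ entry σ.mem X N k (j₀ + x % s) = 1) := by
    intro x hx
    obtain ⟨hdiv, hmod⟩ := div_lt_of_lt_mul_self hx
    have h := hv₂ ⟨x / s, hdiv⟩ ⟨x % s, hmod⟩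
    simp only at h
    rw [add_assoc, show x / s * s + x % s = x by rw [mul_comm]; exact Nat.div_add_mod x s] at h
    rw [h, Matrix.mul_apply]
    constructor
    · calc ∑ t, U ⟨x / s, hdiv⟩ t * V t ⟨x % s, hmod⟩ ≤ ∑ _t : Fin s, 1 :=
          Finset.sum_le_sum fun t _ => by
            have := Nat.mul_le_mul (hU ⟨x / s, hdiv⟩ t) (hV t ⟨x % s, hmod⟩)
            simpa using this
        _ = s := by simp
    · rw [ne_eq, Finset.sum_eq_zero_iff]
      push Not
      constructor
      · rintro ⟨t, -, ht⟩
        have h1 := hU ⟨x / s, hdiv⟩ t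
        have h2 := hV t ⟨x % s, hmod⟩
        have h3 := left_ne_zero_of_mul ht
        have h4 := right_ne_zero_of_mul ht
        refine ⟨k₀ + t, by omega, by have := t.isLt; omega, ?_, ?_⟩
        · change U ⟨x / s, hdiv⟩ t = 1
          omega
        · change V t ⟨x % s, hmod⟩ = 1
          omega
      · rintro ⟨k, hk1, hk2, hk3, hk4⟩
        refine ⟨⟨k - k₀, by omega⟩, Finset.mem_univ _, ?_⟩
        simp only [U, V, show k₀ + (k - k₀) = k by omega, hk3, hk4]
        norm_num
  have hreg : ∀ r, r < 15 ∨ 18 < r → σ₂.reg r = σ.reg r := fun r hr => by rw [hr₂, hr₁ r hr]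
  have hent : ∀ i < N, ∀ j < N, entry σ₂.mem A N i j = entry σ.mem A N i j := by
    intro i hi j hj
    have := index_lt hi hj
    exact hlow _ (by omega)
  refine seq (T₁ := (s * s + 1) * 400 + 100) (T₂ := 50)
    ((collectProduct (A := A) (F := F) ((hreg 1 (by norm_num)).trans h1)
      ((hreg 3 (by norm_num)).trans h3)
      ((hreg 4 (by norm_num)).trans h4) ((hreg 8 (by norm_num)).trans h8)
      ((hreg 11 (by norm_num)).trans h11) ((hreg 13 (by norm_num)).trans h13)
      ((hreg 14 (by norm_num)).trans h14) hi hj hAF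
      (fun i hi j hj => by rw [hent i hi j hj]; exact h01' i hi j hj)
      (fun x hx => (hprod x hx).1.trans (by omega)) le_rfl).mono le_rfl ?_)
    (by omega)
  rintro σ₃ ⟨hr₃, hm₃, hv₃⟩
  have e4 : σ₃.reg 4 = F := by rw [hr₃ 4 (by norm_num), hreg 4 (by norm_num), h4]
  have e5 : σ₃.reg 5 = R := by rw [hr₃ 5 (by norm_num), hreg 5 (by norm_num), h5]
  refine assign rfl (by simpa [e4, e5] using hFB) le_rfl ⟨fun r hr4 hr => ?_, ?_, fun a ha => ?_,
    fun a ha => ?_, fun i hi' j hj' => ⟨(hv₃ i hi' j hj').1, ?_⟩⟩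
  · rw [set_reg, if_neg hr4, hr₃ r hr, hreg r hr]
  · simp [e4, e5]
  · rw [set_mem, hm₃ a (.inl ha), hlow a (by omega)]
  · rw [set_mem, hm₃ a (.inr (by omega)), hm₂ a (.inr (by omega)), hm₁ a (.inr (by omega)),
      hz a (by omega)]
  · rw [set_mem, (hv₃ i hi' j hj').2, hent i hi' j hj']
    refine or_congr_right ⟨?_, ?_⟩
    · rintro ⟨x, hx, rfl, rfl, hne⟩
      obtain ⟨hdiv, hmod⟩ := div_lt_of_lt_mul_self hx
      exact ⟨Nat.le_add_right _ _, by omega, Nat.le_add_right _ _, by omega,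
        (hprod x hx).2.1 hne⟩
    · rintro ⟨g1, g2, g3, g4, hex⟩
      have hlt := index_lt (show i - i₀ < s by omega) (show j - j₀ < s by omega)
      have hd := index_div (i := i - i₀) (show j - j₀ < s by omega)
      refine ⟨(i - i₀) * s + (j - j₀), hlt, by rw [hd.1]; omega, by rw [hd.2]; omega,
        (hprod _ hlt).2.2 ?_⟩
      rw [hd.1, hd.2, show i₀ + (i - i₀) = i by omega, show j₀ + (j - j₀) = j by omega]
      exact hex

/-! ### Filling the table of good segments -/

/-- The contents of the registers and of the memory while the tables are filled. -/
structure Tables (n N k B : ℕ) (E : ℕ → ℕ → Prop) (mem₀ : ℕ → ℕ) (cX cA b : ℕ)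
    (σ : MachineState) : Prop where
  r0 : σ.reg 0 = n
  r1 : σ.reg 1 = N
  r2 : σ.reg 2 = 2 * (n * n)
  r3 : σ.reg 3 = 2 * (n * n) + N * N
  r5 : σ.reg 5 = (N + 2) ^ k
  r6 : σ.reg 6 = N * N
  free : 2 * (n * n) + N * N + N * N ≤ σ.reg 4
  -- There is room for b more calls.
  budget : σ.reg 4 + b * (N + 2) ^ k ≤ B
  low : ∀ a < 2 * (n * n), σ.mem a = mem₀ a
  good : GoodTable E N cX (entry σ.mem (2 * (n * n)) N)
  split : SplitTable E N cA (entry σ.mem (2 * (n * n) + N * N) N)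
  zero : ∀ a, σ.reg 4 ≤ a → σ.mem a = 0

/-- The relation `E` is given by the adjacency matrix at the beginning of the memory. -/
def Represents (n : ℕ) (E : ℕ → ℕ → Prop) (mem₀ : ℕ → ℕ) : Prop :=
  ∀ i j, (E i j → i < n ∧ j < n) ∧
    (i < n → j < n → mem₀ (i * n + j) ≤ 1 ∧ (E i j ↔ mem₀ (i * n + j) = 1))

theorem Tables.regs {n N k B cX cA b : ℕ} {E : ℕ → ℕ → Prop} {mem₀ : ℕ → ℕ}
    {σ σ' : MachineState} (h : Tables n N k B E mem₀ cX cA b σ)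
    (hr : ∀ r < 7, σ'.reg r = σ.reg r) (hm : σ'.mem = σ.mem) :
    Tables n N k B E mem₀ cX cA b σ' := by
  have h4 := hr 4 (by norm_num)
  refine ⟨(hr 0 (by norm_num)).trans h.r0, (hr 1 (by norm_num)).trans h.r1,
    (hr 2 (by norm_num)).trans h.r2, (hr 3 (by norm_num)).trans h.r3,
    (hr 5 (by norm_num)).trans h.r5, (hr 6 (by norm_num)).trans h.r6,
    h4 ▸ h.free, h4 ▸ h.budget, ?_, ?_, ?_, ?_⟩
  · rw [hm]; exact h.low
  · rw [hm]; exact h.good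
  · rw [hm]; exact h.split
  · rw [hm, h4]; exact h.zero

/-- Decide the current cell. -/
def decideCell : Program :=
  -- Subtraction truncates, so the first guard is nonzero iff i < j < n, and in the second i + 2 - j
  -- is nonzero iff j ≤ i + 1: products act as conjunctions and sums as disjunctions.
  .seq (assign 21 (vN - lit 1 - ve)) (ifC ((vo - vI) * (vn - vo))
    (.seq (loadC 18 (vI * vn + vo)) (.seq (loadC 17 (vA + vI * vN + vo))
      (ifC (vv * (vb + (vI + lit 2 - vo))) (storeC (vX + vI * vN + vo) (lit 1)) .skip))) .skip)

theorem Triple.decideCell {W B T n N L k c b : ℕ} {E : ℕ → ℕ → Prop} {mem₀ : ℕ → ℕ}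
    {σ : MachineState} (hN : N = 2 ^ L) (hE : Represents n E mem₀)
    (h : Tables n N k B E mem₀ c (c + 1) b σ) (hc : c < N * N)
    (h7 : σ.reg 7 = evenBits c) (h8 : σ.reg 8 = oddBits c) (hT : 400 ≤ T) :
    Triple W B decideCell σ T (fun σ' => Tables n N k B E mem₀ (c + 1) (c + 1) b σ' ∧
      ∀ r, r ≠ 17 → r ≠ 18 → r ≠ 21 → σ'.reg r = σ.reg r) := by
  refine of_eight fun hB8 => of_small fun hsm => ?_
  have hbits := bits_lt (L := L) (c := c) (by
    rw [show (4 : ℕ) ^ L = 2 ^ L * 2 ^ L by rw [← mul_pow]; norm_num, ← hN]; exact hc)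
  rw [← hN] at hbits
  set e := evenBits c with he
  set j := oddBits c with hj
  set i := N - 1 - e with hi
  have hrank : cellRank (N - 1 - i) j = c := by
    rw [show N - 1 - i = e by omega, he, hj, cellRank_evenBits_oddBits]
  have hiN : i < N := by omega
  have hNB : N ≤ B := h.r1 ▸ hsm 1 (by norm_num)
  have hgood := h.split.good_iff hN hiN hbits.2 hrank
  have hlt := index_lt hiN hbits.2
  have hXcell := h.good i hiN j hbits.2
  have hAcell := h.split.le_one i hiN j hbits.2
  -- The table records ranks below c only, so this cell is still unmarked and a negative decision
  -- needs no write.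
  have hX0 : entry σ.mem (2 * (n * n)) N i j ≠ 1 := fun hx => by
    have := (hXcell.2.1 hx).2
    omega
  have hstay : ∀ σ' : MachineState, σ'.mem = σ.mem → (∀ r < 7, σ'.reg r = σ.reg r) →
      ¬ Good E i j → Tables n N k B E mem₀ (c + 1) (c + 1) b σ' := by
    intro σ' hm hr hg
    have ht := h.regs hr hm
    have hgd := GoodTable.step (X' := entry σ.mem (2 * (n * n)) N) hN h.good hiN hbits.2 hrank
      hXcell.1 (iff_of_false hX0 hg) (fun _ _ _ _ _ => rfl)
    exact ⟨ht.r0, ht.r1, ht.r2, ht.r3, ht.r5, ht.r6, ht.free, ht.budget, ht.low,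
      by rw [hm]; exact hgd, ht.split, ht.zero⟩
  have e0 := h.r0
  have e1 := h.r1
  have e2 := h.r2
  have e3 := h.r3
  refine seq_assign rfl ?_ (by omega) (ifC (T₁ := 200) rfl (by omega) (fun h0 => ?_)
    (fun h0 => skip (by norm_num) ?_))
  · simp [e1]; omega
  · simp [e1, h7, h8, e0, ← hi, Nat.sub_eq_zero_iff_le] at h0
    have hin : i < n := by omega
    have hGlt := index_lt hin h0.2
    have hG := (hE i j).2 hin h0.2
    have hlow := h.low (i * n + j) (by omega)
    refine seq_load rfl ?_ (by omega) (seq_load rfl ?_ (by omega) (ifC (T₁ := 50) rfl (by omega)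
      (fun h1 => store rfl rfl (by omega) ?_) (fun h1 => skip (by norm_num) ?_)))
    · simp [e1, h7, h8, e0, ← hi, hlow]; omega
    · simp [e1, h7, h8, e0, e3, ← hi]
      exact hAcell.trans (by omega)
    · simp only [e1, h7, h8, e0, e3, e2, eval_mul, eval_add, eval_sub, eval_var, eval_lit,
        set_reg, set_mem, ← hi] at h1 ⊢
      simp at h1 ⊢
      simp only [entry] at hAcell
      have hgd : Good E i j := by
        rw [hgood]
        refine ⟨hG.2.2 (by omega), ?_⟩
        simp only [entry]
        omega
      refine ⟨⟨?_, ?_, ?_, ?_, ?_, ?_, ?_, ?_, fun a ha => ?_, ?_, ?_, fun a ha => ?_⟩,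
        fun r h17 h18 h21 => ?_⟩
      · simp [e0]
      · simp [e1]
      · simp [e2]
      · simp [e3]
      · simp [h.r5]
      · simp [h.r6]
      · simpa using h.free
      · simpa using h.budget
      · simp only [put_mem, set_mem]
        rw [if_neg (by omega), h.low a ha]
      · refine h.good.step hN hiN hbits.2 hrank ?_ (iff_of_true ?_ hgd) ?_
        · simp [entry]
        · simp [entry]
        · intro i' hi' j' hj' hne
          simp only [entry, put_mem, set_mem]
          rw [if_neg]
          intro heq
          have := (index_inj hj' hbits.2).1 (by omega : i' * N + j' = i * N + j)
          exact hne (Prod.ext this.1 this.2)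
      · have hent : ∀ i' < N, ∀ j' < N, σ.mem (2 * (n * n) + N * N + i' * N + j') =
            if 2 * (n * n) + N * N + i' * N + j' = 2 * (n * n) + i * N + j then 1
            else σ.mem (2 * (n * n) + N * N + i' * N + j') := by
          intro i' hi' j' hj'
          rw [if_neg (by omega)]
        refine ⟨fun i' hi' j' hj' => ?_, fun i' hi' j' hj' => ?_, fun i' hi' j' hj' => ?_⟩
        · simp only [entry, put_mem, set_mem]
          rw [← hent i' hi' j' hj']
          exact h.split.le_one i' hi' j' hj'
        · simp only [entry, put_mem, set_mem]
          rw [← hent i' hi' j' hj']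
          exact h.split.sound i' hi' j' hj'
        · simp only [entry, put_mem, set_mem]
          rw [← hent i' hi' j' hj']
          exact h.split.complete i' hi' j' hj'
      · simp at ha
        simp only [put_mem, set_mem]
        have := h.free
        rw [if_neg (by omega), h.zero a ha]
      · simp [h17, h18, h21]
    · simp only [e1, h7, h8, e0, e3, eval_mul, eval_add, eval_sub, eval_var, eval_lit,
        set_reg, set_mem, ← hi] at h1 ⊢
      simp at h1 ⊢
      refine ⟨hstay _ rfl (fun r hr => ?_) ?_, fun r h17 h18 h21 => ?_⟩
      · simp only [set_reg]
        rw [if_neg (by omega), if_neg (by omega), if_neg (by omega)]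
      · rw [hgood, hG.2]
        simp only [entry]
        omega
      · simp [h17, h18, h21]
  · simp [e1, h7, h8, e0, ← hi, Nat.sub_eq_zero_iff_le] at h0
    refine ⟨hstay _ rfl (fun r hr => ?_) ?_, fun r h17 h18 h21 => ?_⟩
    · simp only [set_reg]
      rw [if_neg (by omega)]
    · intro hg
      have := hg.lt
      have := (hE i j).1 hg.edge
      omega
    · simp [h21]

/-- Write the rank as a power of `4` times a number not divisible by `4`. -/
def splitRank : Program :=
  .seq (assign 10 vc) (.seq (assign 11 (lit 1))
    -- The guard is nonzero iff 4 divides q.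
    (whileC (lit 1 - (vq - vq / lit 4 * lit 4))
      (.seq (assign 10 (vq / lit 4)) (assign 11 (vs + vs)))))

theorem Triple.splitRank {W B T c : ℕ} {σ : MachineState} (hc : c ≠ 0) (h9 : σ.reg 9 = c)
    (hT : 200 * level c + 200 ≤ T) :
    Triple W B splitRank σ T (fun σ' => ∃ l q, c = 4 ^ l * q ∧ q % 4 ≠ 0 ∧ l = level c ∧
      σ'.reg 10 = q ∧ σ'.reg 11 = 2 ^ l ∧ (∀ r, r ≠ 10 → r ≠ 11 → σ'.reg r = σ.reg r) ∧
      σ'.mem = σ.mem) := by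
  refine of_eight fun hB8 => of_small fun hsm => ?_
  have hcB : c ≤ B := h9 ▸ hsm 9 (by norm_num)
  refine seq_assign rfl (by simpa [h9] using hcB) (by omega) (seq_assign rfl
    (by simp; omega) (by omega) ?_)
  refine (whileC (φ := 200 * level c) rfl (fun φ σ' => ∃ l q, c = 4 ^ l * q ∧ q ≠ 0 ∧
      φ = 200 * level q ∧
      σ'.reg 10 = q ∧ σ'.reg 11 = 2 ^ l ∧ (∀ r, r ≠ 10 → r ≠ 11 → σ'.reg r = σ.reg r) ∧
      σ'.mem = σ.mem) (by omega) ?_ ?_).mono le_rfl ?_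
  · rintro _ τ ⟨l, q, hq, hq0, rfl, e10, e11, hr, hm⟩ hne
    simp [e10, Nat.sub_eq_zero_iff_le] at hne
    have hq4 : q = 4 * (q / 4) := by omega
    have hl : level q = level (q / 4) + 1 := by
      conv_lhs => rw [hq4]
      exact level_mul_four (by omega)
    have h2B : 2 ^ l + 2 ^ l ≤ B := by
      have h4 : 4 ^ l * 4 ≤ c := by rw [hq]; exact Nat.mul_le_mul_left _ (by omega)
      have : 2 ^ l ≤ 4 ^ l := Nat.pow_le_pow_left (by norm_num) l
      omega
    have hqB : q ≤ c := by rw [hq]; exact Nat.le_mul_of_pos_left _ (by positivity)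
    refine ⟨200 * level (q / 4), 100, by omega, seq_assign rfl ?_ (by norm_num)
      (assign rfl ?_ (by norm_num) ⟨l + 1, q / 4, ?_, by omega, rfl, ?_, ?_, ?_, ?_⟩)⟩
    · simp [e10]; omega
    · simp [e11]; exact h2B
    · rw [hq, pow_succ, mul_assoc, ← hq4]
    · simp [e10]
    · simp [e11, pow_succ]; omega
    · intro r h10 h11
      simp [h10, h11, hr r h10 h11]
    · simp [hm]
  · refine ⟨0, c, by simp, hc, rfl, by simp [h9], by simp, fun r h10 h11 => ?_, by simp⟩
    simp [h10, h11]
  · rintro σ' ⟨h0, φ', l, q, hq, hq0, -, e10, e11, hr, hm⟩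
    simp [e10] at h0
    have hq4 : q % 4 ≠ 0 := by omega
    refine ⟨l, q, hq, hq4, ?_, e10, e11, hr, hm⟩
    rw [hq, level_pow_mul hq0, level_of_mod hq4, zero_add]

/-- Go from the cell of rank `c - 1` to the cell of rank `c`. -/
def moveOn : Program :=
  -- From the far corner of the square q - 1 to its first cell, and from there to the first cell of
  -- the square q as in `bits_pred`.
  .seq (assign 7 (ve + lit 1 - vs)) (.seq (assign 8 (vo + lit 1 - vs))
    (.seq (ifC (vq - vq / lit 2 * lit 2) (assign 7 (ve + vs))
      (.seq (assign 7 (ve - vs)) (assign 8 (vo + vs))))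
    (.seq (assign 14 (vs * vs)) (assign 13 (vN - ve - vs)))))

theorem Triple.moveOn {W B T N c l q : ℕ} {σ : MachineState} (hcq : c = 4 ^ l * q)
    (hq : q % 4 ≠ 0) (h1 : σ.reg 1 = N) (h7 : σ.reg 7 = evenBits (c - 1))
    (h8 : σ.reg 8 = oddBits (c - 1)) (h10 : σ.reg 10 = q) (h11 : σ.reg 11 = 2 ^ l)
    (he : evenBits c + 2 ^ l ≤ N) (ho : oddBits c + 2 ^ l ≤ N) (he' : evenBits (c - 1) < N)
    (ho' : oddBits (c - 1) < N) (hNB : N * N ≤ B) (hT : 400 ≤ T) :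
    Triple W B moveOn σ T (fun σ' => σ'.reg 7 = evenBits c ∧ σ'.reg 8 = oddBits c ∧
      σ'.reg 14 = 2 ^ l * 2 ^ l ∧ σ'.reg 13 = N - evenBits c - 2 ^ l ∧
      (∀ r, r ≠ 7 → r ≠ 8 → r ≠ 13 → r ≠ 14 → σ'.reg r = σ.reg r) ∧ σ'.mem = σ.mem) := by
  refine of_eight fun hB8 => ?_
  have hq0 : 0 < q := by omega
  have hNN : N ≤ N * N := Nat.le_mul_self N
  have a1 := evenBits_pow_mul l q
  have a2 := oddBits_pow_mul l q
  have a3 := evenBits_pow_mul_pred l q hq0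
  have a4 := oddBits_pow_mul_pred l q hq0
  rw [← hcq] at a1 a2 a3 a4
  have hb := bits_pred hq
  have hpos : 1 ≤ 2 ^ l := Nat.one_le_two_pow
  have hss : 2 ^ l * 2 ^ l ≤ B := (Nat.mul_le_mul (by omega) (by omega)).trans hNB
  have b3 : evenBits (c - 1) + 1 - 2 ^ l = 2 ^ l * evenBits (q - 1) := by
    rw [a3, mul_add]; omega
  have b4 : oddBits (c - 1) + 1 - 2 ^ l = 2 ^ l * oddBits (q - 1) := by
    rw [a4, mul_add]; omega
  refine seq_assign rfl ?_ (by omega) (seq_assign rfl ?_ (by omega)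
    (seq (T₁ := 150) (T₂ := 100) (ifC (T₁ := 100) rfl le_rfl (fun hne => assign rfl ?_ (by omega)
      (seq_assign rfl ?_ (by omega) (assign rfl ?_ (by omega) ?_)))
      (fun heq => seq_assign rfl ?_ (by omega) (assign rfl ?_ (by omega)
      (seq_assign rfl ?_ (by omega) (assign rfl ?_ (by omega) ?_))))) (by omega)))
  · simp [h7, h11]; omega
  · simp [h8, h11]; omega
  · simp [h10] at hne
    obtain ⟨c1, c2⟩ := hb.2 (by omega)
    have d1 : 2 ^ l * evenBits (q - 1) + 2 ^ l = evenBits c := by rw [a1, ← c1]; ring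
    simp [h7, h8, h11, b3, d1]; omega
  · simpa [h11] using hss
  · simp [h1]; omega
  · simp [h10] at hne
    obtain ⟨c1, c2⟩ := hb.2 (by omega)
    have d1 : 2 ^ l * evenBits (q - 1) + 2 ^ l = evenBits c := by rw [a1, ← c1]; ring
    have d2 : 2 ^ l * oddBits (q - 1) = oddBits c := by rw [a2, c2]
    simp [h1, h7, h8, h11, b3, b4, d1, d2]
    intro r r7 r8 r13 r14
    simp [r7, r8, r13, r14]
  · simp [h7, h11, b3]; omega
  · simp [h10] at heq
    obtain ⟨c1, c2⟩ := hb.1 (by omega)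
    have d2 : 2 ^ l * oddBits (q - 1) + 2 ^ l = oddBits c := by rw [a2, ← c2]; ring
    simp [h7, h8, h11, b4, d2]; omega
  · simpa [h11] using hss
  · simp [h1]; omega
  · simp [h10] at heq
    obtain ⟨c1, c2⟩ := hb.1 (by omega)
    have d1 : 2 ^ l * evenBits (q - 1) - 2 ^ l = evenBits c := by
      rw [a1, c1, mul_add]; omega
    have d2 : 2 ^ l * oddBits (q - 1) + 2 ^ l = oddBits c := by rw [a2, ← c2]; ring
    simp [h1, h7, h8, h11, b3, b4, d1, d2]
    intro r r7 r8 r13 r14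
    simp [r7, r8, r13, r14]

/-- Update the block that starts with the current cell. -/
def updateBlocks (Nr : ℕ) (P : Program) : Program :=
  -- The two lowest bits of q are the parities of the row and the column of the square. If a parity
  -- is odd, there is a preceding sibling block in that coordinate, from which k is taken.
  .seq (ifC (vq - vq / lit 2 * lit 2) (.seq (assign 12 (vN - ve)) (updateBlock Nr P)) .skip)
    (ifC (vq / lit 2 - vq / lit 4 * lit 2) (.seq (assign 12 (vo - vs)) (updateBlock Nr P)) .skip)

theorem Tables.of_update {n N k B c b i₀ j₀ k₀ s : ℕ} {E : ℕ → ℕ → Prop} {mem₀ : ℕ → ℕ}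
    {σ σ' : MachineState} (h : Tables n N k B E mem₀ c c (b + 1) σ) (hk : k₀ + s ≤ N)
    (hr : ∀ r, r ≠ 4 → r < 7 → σ'.reg r = σ.reg r)
    (h4 : σ'.reg 4 = σ.reg 4 + (N + 2) ^ k)
    (hm : ∀ a < 2 * (n * n) + N * N, σ'.mem a = σ.mem a)
    (hz : ∀ a, σ.reg 4 + (N + 2) ^ k ≤ a → σ'.mem a = 0)
    (hu : BlockUpdate N i₀ j₀ k₀ s (entry σ.mem (2 * (n * n)) N)
      (entry σ.mem (2 * (n * n) + N * N) N) (entry σ'.mem (2 * (n * n) + N * N) N)) :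
    Tables n N k B E mem₀ c c b σ' := by
  have hb := h.budget
  refine ⟨(hr 0 (by norm_num) (by norm_num)).trans h.r0,
    (hr 1 (by norm_num) (by norm_num)).trans h.r1, (hr 2 (by norm_num) (by norm_num)).trans h.r2,
    (hr 3 (by norm_num) (by norm_num)).trans h.r3, (hr 5 (by norm_num) (by norm_num)).trans h.r5,
    (hr 6 (by norm_num) (by norm_num)).trans h.r6, by have := h.free; omega, ?_,
    fun a ha => ?_, fun i hi j hj => ?_, h.split.blockUpdate_sound h.good hk hu,
    fun a ha => hz a (by omega)⟩
  · rw [h4]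
    rw [add_mul, one_mul] at hb
    omega
  · rw [hm a (by omega), h.low a ha]
  · have := index_lt hi hj
    have he : entry σ'.mem (2 * (n * n)) N i j = entry σ.mem (2 * (n * n)) N i j :=
      hm _ (by omega)
    rw [he]
    exact h.good i hi j hj

theorem Triple.updateBlocks {W B T n N L k c b l q Nr : ℕ} {E : ℕ → ℕ → Prop} {mem₀ : ℕ → ℕ}
    {P : Program} {μ : ℕ → ℕ} {σ : MachineState} (hk3 : 3 ≤ k) (hP : Multiplies P k μ)
    (hNr : P.RegsBelow Nr) (hN : N = 2 ^ L) (h : Tables n N k B E mem₀ c c (b + 2) σ)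
    (hcq : c = 4 ^ l * q) (hq : q % 4 ≠ 0) (h7 : σ.reg 7 = evenBits c)
    (h8 : σ.reg 8 = oddBits c) (h10 : σ.reg 10 = q) (h11 : σ.reg 11 = 2 ^ l)
    (h13 : σ.reg 13 = N - evenBits c - 2 ^ l) (h14 : σ.reg 14 = 2 ^ l * 2 ^ l)
    (he : evenBits c + 2 ^ l ≤ N) (ho : oddBits c + 2 ^ l ≤ N)
    (hT : 2 * (2 * μ (2 ^ l) + Nr + (2 ^ l * 2 ^ l) * 2000) + 200 ≤ T) :
    Triple W B (updateBlocks Nr P) σ T (fun σ' => Tables n N k B E mem₀ c (c + 1) b σ' ∧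
      ∀ r, 6 < r → r < 12 → σ'.reg r = σ.reg r) := by
  set U := 2 * μ (2 ^ l) + Nr + (2 ^ l * 2 ^ l) * 2000 with hU
  refine of_eight fun hB8 => of_small fun hsm => ?_
  have hNB : N ≤ B := h.r1 ▸ hsm 1 (by norm_num)
  have a1 := evenBits_pow_mul l q
  have a2 := oddBits_pow_mul l q
  rw [← hcq] at a1 a2
  have hpos : 1 ≤ 2 ^ l := Nat.one_le_two_pow
  have heq1 := evenBits_eq q
  have hoq1 := oddBits_eq q
  have hodd1 : q % 2 = 1 → 2 ^ l ≤ evenBits c := fun h => by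
    rw [a1]; exact Nat.le_mul_of_pos_right _ (by omega)
  have hodd2 : q / 2 % 2 = 1 → 2 ^ l ≤ oddBits c := fun h => by
    rw [a2]; exact Nat.le_mul_of_pos_right _ (by omega)
  -- One update, when the first splitting vertex is known.
  have one : ∀ (b k₀ : ℕ) (τ : MachineState), Tables n N k B E mem₀ c c (b + 1) τ →
      (∀ r, 6 < r → r ≠ 12 → r < 15 → τ.reg r = σ.reg r) → τ.reg 12 = k₀ → k₀ + 2 ^ l ≤ N →
      Triple W B (_root_.updateBlock Nr P) τ U (fun σ' => Tables n N k B E mem₀ c c b σ' ∧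
        (∀ r, 6 < r → r ≠ 12 → r < 15 → σ'.reg r = σ.reg r) ∧
        (∀ a < 2 * (n * n) + N * N, σ'.mem a = τ.mem a) ∧
        BlockUpdate N (N - evenBits c - 2 ^ l) (oddBits c) k₀ (2 ^ l)
          (entry τ.mem (2 * (n * n)) N) (entry τ.mem (2 * (n * n) + N * N) N)
          (entry σ'.mem (2 * (n * n) + N * N) N)) := by
    intro b k₀ τ hτ hreg h12 hk₀
    have hb := hτ.budget
    rw [add_mul, one_mul] at hb
    refine (updateBlock hk3 hP hNr hτ.r1 hτ.r2 hτ.r3 rfl hτ.r5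
      ((hreg 8 (by norm_num) (by norm_num) (by norm_num)).trans h8)
      ((hreg 11 (by norm_num) (by norm_num) (by norm_num)).trans h11) h12
      ((hreg 13 (by norm_num) (by norm_num) (by norm_num)).trans h13)
      ((hreg 14 (by norm_num) (by norm_num) (by norm_num)).trans h14) hpos (by omega) ho hk₀
      le_rfl hτ.free rfl (by omega) (fun i hi j hj => (hτ.good i hi j hj).1)
      hτ.split.le_one hτ.zero le_rfl).mono le_rfl ?_
    rintro σ' ⟨hr, h4, hm, hz, hu⟩
    exact ⟨hτ.of_update hk₀ (fun r hr4 hr7 => hr r hr4 (by omega)) h4 hm hz hu,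
      fun r h6 h12 h15 => (hr r (by omega) (by omega)).trans (hreg r h6 h12 h15), hm, hu⟩
  have hA1 := h.split.le_one
  refine seq (T₁ := U + 100) (T₂ := U + 100) (Triple.mono
    (Q := fun σ' => Tables n N k B E mem₀ c c (b + 1) σ' ∧
      (∀ r, 6 < r → r ≠ 12 → r < 15 → σ'.reg r = σ.reg r) ∧
      (∀ i < N, ∀ j < N, entry σ.mem (2 * (n * n) + N * N) N i j = 1 →
        entry σ'.mem (2 * (n * n) + N * N) N i j = 1) ∧
      (∀ i < N, ∀ j < N, entry σ'.mem (2 * (n * n)) N i j = entry σ.mem (2 * (n * n)) N i j) ∧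
      (q % 2 = 1 → BlockUpdate N (N - evenBits c - 2 ^ l) (oddBits c) (N - evenBits c) (2 ^ l)
          (entry σ.mem (2 * (n * n)) N) (entry σ.mem (2 * (n * n) + N * N) N)
          (entry σ'.mem (2 * (n * n) + N * N) N))) ?_ le_rfl ?_) (by omega)
  · refine ifC (T₁ := U + 50) rfl le_rfl (fun hne => ?_) (fun heq => skip (by omega) ?_)
    · simp [h10] at hne
      have := hodd1 (by omega)
      refine seq_assign rfl ?_ (by omega) ((one (b + 1) (N - evenBits c) _ ?_ ?_ ?_ ?_).mono
        (by omega) ?_)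
      · simp [h.r1]; omega
      · refine h.regs (fun r hr => ?_) rfl
        rw [set_reg, if_neg (by omega)]
      · intro r _ hr _
        simp [hr]
      · simp [h.r1, h7]
      · omega
      · rintro σ' ⟨ht, hr, hm, hu⟩
        refine ⟨ht, hr, fun i hi j hj h1 => (hu i hi j hj).2.2 (.inl h1), fun i hi j hj => ?_,
          fun _ => hu⟩
        have := index_lt hi hj
        exact hm _ (by omega)
    · simp [h10] at heq
      refine ⟨?_, fun _ _ _ _ => rfl, fun _ _ _ _ h => h, fun _ _ _ _ => rfl, fun h => by omega⟩
      have hb := h.budget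
      exact ⟨h.r0, h.r1, h.r2, h.r3, h.r5, h.r6, h.free,
        le_trans (Nat.add_le_add_left (Nat.mul_le_mul_right _ (by omega)) _) hb,
        h.low, h.good, h.split, h.zero⟩
  rintro σ₁ ⟨ht₁, hr₁, hA₁, hX₁, hu₁⟩
  have g10 : σ₁.reg 10 = q := (hr₁ 10 (by norm_num) (by norm_num) (by norm_num)).trans h10
  have g8 : σ₁.reg 8 = oddBits c := (hr₁ 8 (by norm_num) (by norm_num) (by norm_num)).trans h8
  have g11 : σ₁.reg 11 = 2 ^ l := (hr₁ 11 (by norm_num) (by norm_num) (by norm_num)).trans h11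
  have fin : ∀ σ', Tables n N k B E mem₀ c c b σ' →
      (∀ r, 6 < r → r ≠ 12 → r < 15 → σ'.reg r = σ.reg r) →
      (∀ i < N, ∀ j < N, entry σ₁.mem (2 * (n * n) + N * N) N i j = 1 →
        entry σ'.mem (2 * (n * n) + N * N) N i j = 1) →
      (q / 2 % 2 = 1 →
        BlockUpdate N (N - evenBits c - 2 ^ l) (oddBits c) (oddBits c - 2 ^ l) (2 ^ l)
          (entry σ₁.mem (2 * (n * n)) N) (entry σ₁.mem (2 * (n * n) + N * N) N)
          (entry σ'.mem (2 * (n * n) + N * N) N)) →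
      Tables n N k B E mem₀ c (c + 1) b σ' ∧ ∀ r, 6 < r → r < 12 → σ'.reg r = σ.reg r := by
    intro σ' ht hr hA hu
    refine ⟨⟨ht.r0, ht.r1, ht.r2, ht.r3, ht.r5, ht.r6, ht.free, ht.budget, ht.low, ht.good,
      SplitTable.step hN h.good h.split ht.split hcq hq rfl
        (fun i hi j hj h1 => hA i hi j hj (hA₁ i hi j hj h1)) ?_ ?_, ht.zero⟩,
      fun r h6 h12 => hr r h6 (by omega) (by omega)⟩
    · intro hodd i hi1 hi2 j hj1 hj2 hi hj k hk1 hk2 hx1 hx2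
      exact hA i hi j hj ((hu₁ hodd i hi j hj).2.2
        (.inr ⟨hi1, by omega, hj1, hj2, k, hk1, hk2, hx1, hx2⟩))
    · intro hodd i hi1 hi2 j hj1 hj2 hi hj k hk1 hk2 hx1 hx2
      have := hodd2 hodd
      refine (hu hodd i hi j hj).2.2
        (.inr ⟨hi1, by omega, hj1, hj2, k, hk1, by omega, ?_, ?_⟩)
      · rw [hX₁ i hi k (by omega)]; exact hx1
      · rw [hX₁ k (by omega) j hj]; exact hx2
  refine ifC (T₁ := U + 50) rfl (by omega) (fun hne => ?_) (fun heq => skip (by omega) ?_)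
  · simp [g10] at hne
    have := hodd2 (by omega)
    refine seq_assign rfl ?_ (by omega) ((one b (oddBits c - 2 ^ l) _ ?_ ?_ ?_ ?_).mono
      (by omega) ?_)
    · simp [g8, g11]; omega
    · refine ht₁.regs (fun r hr => ?_) rfl
      rw [set_reg, if_neg (by omega)]
    · intro r h6 hr h15
      simp [hr, hr₁ r h6 hr h15]
    · simp [g8, g11]
    · omega
    · rintro σ' ⟨ht, hr, hm, hu⟩
      exact fin σ' ht hr (fun i hi j hj h1 => (hu i hi j hj).2.2 (.inl h1)) fun _ => hu
  · simp [g10] at heq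
    have hb := ht₁.budget
    refine fin σ₁ ⟨ht₁.r0, ht₁.r1, ht₁.r2, ht₁.r3, ht₁.r5, ht₁.r6, ht₁.free,
        le_trans (Nat.add_le_add_left (Nat.mul_le_mul_right _ (by omega)) _) hb,
        ht₁.low, ht₁.good, ht₁.split, ht₁.zero⟩ hr₁ (fun _ _ _ _ h => h) (fun h => by omega)

/-- Fill the tables. -/
def fillTables (Nr : ℕ) (P : Program) : Program :=
  .seq decideCell (.seq (assign 9 (lit 1)) (whileC (vM - vc)
    (.seq splitRank (.seq moveOn (.seq (updateBlocks Nr P)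
      (.seq decideCell (assign 9 (vc + lit 1))))))))

/-- The cost of a step with blocks of size `2 ^ l`. -/
def stepCost (μ : ℕ → ℕ) (Nr l : ℕ) : ℕ :=
  4 * μ (2 ^ l) + 2 * Nr + 4000 * (2 ^ l * 2 ^ l) + 200 * l + 1500

theorem Tables.weaken {n N k B cX cA b b' : ℕ} {E : ℕ → ℕ → Prop} {mem₀ : ℕ → ℕ}
    {σ : MachineState} (h : Tables n N k B E mem₀ cX cA b σ) (hb : b' ≤ b) :
    Tables n N k B E mem₀ cX cA b' σ :=
  ⟨h.r0, h.r1, h.r2, h.r3, h.r5, h.r6, h.free,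
    (Nat.add_le_add_left (Nat.mul_le_mul_right _ hb) _).trans h.budget,
    h.low, h.good, h.split, h.zero⟩

/-- Since l < L, the coordinates are multiples of 2 ^ l below a multiple of 2 ^ l, so a whole block
fits. -/
theorem bits_add_pow_le {L N c l q : ℕ} (hN : N = 2 ^ L) (hc : c < N * N) (hcq : c = 4 ^ l * q)
    (hq : q ≠ 0) : evenBits c + 2 ^ l ≤ N ∧ oddBits c + 2 ^ l ≤ N := by
  have h4 : (4 : ℕ) ^ L = N * N := by rw [hN, ← mul_pow]; norm_num
  rw [← h4] at hc
  have hb := bits_lt hc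
  have hl : l < L := by
    by_contra hcon
    have h1 : (4 : ℕ) ^ L ≤ 4 ^ l := Nat.pow_le_pow_right (by norm_num) (by omega)
    have h2 : 4 ^ l ≤ 4 ^ l * q := Nat.le_mul_of_pos_right _ (by omega)
    omega
  obtain ⟨d, rfl⟩ := Nat.exists_eq_add_of_lt hl
  have key : ∀ x, 2 ^ l * x < 2 ^ (l + d + 1) → 2 ^ l * x + 2 ^ l ≤ N := by
    intro x hx
    rw [hN]
    rw [show 2 ^ (l + d + 1) = 2 ^ l * 2 ^ (d + 1) by rw [add_assoc, pow_add]] at hx ⊢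
    have h3 : x + 1 ≤ 2 ^ (d + 1) := Nat.lt_of_mul_lt_mul_left hx
    calc 2 ^ l * x + 2 ^ l = 2 ^ l * (x + 1) := by ring
      _ ≤ _ := Nat.mul_le_mul_left _ h3
  have a1 := evenBits_pow_mul l q
  have a2 := oddBits_pow_mul l q
  rw [← hcq] at a1 a2
  rw [a1, a2] at hb ⊢
  exact ⟨key _ hb.1, key _ hb.2⟩

theorem Triple.fillTables {W B T n N L k b Nr : ℕ} {E : ℕ → ℕ → Prop} {mem₀ : ℕ → ℕ}
    {P : Program} {μ : ℕ → ℕ} {σ : MachineState} (hk3 : 3 ≤ k) (hP : Multiplies P k μ)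
    (hNr : P.RegsBelow Nr) (hN : N = 2 ^ L) (hE : Represents n E mem₀)
    (h : Tables n N k B E mem₀ 0 0 (2 * (N * N) + b) σ)
    (h7 : σ.reg 7 = 0) (h8 : σ.reg 8 = 0)
    (hT : ∑ c ∈ Finset.Ico 1 (4 ^ L), stepCost μ Nr (level c) + 600 ≤ T) :
    Triple W B (fillTables Nr P) σ T (fun σ' => Tables n N k B E mem₀ (N * N) (N * N) b σ') := by
  refine of_eight fun hB8 => ?_
  have h4 : (4 : ℕ) ^ L = N * N := by rw [hN, ← mul_pow]; norm_num
  have hN1 : 1 ≤ N * N := by rw [← h4]; exact Nat.one_le_pow _ _ (by norm_num)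
  have hNB : N * N ≤ B := by
    have := h.free
    have := h.budget
    omega
  have hz : evenBits 0 = 0 ∧ oddBits 0 = 0 := by simp [evenBits, oddBits]
  rw [h4] at hT
  have h' : Tables n N k B E mem₀ 0 (0 + 1) (2 * (N * N) + b) σ :=
    ⟨h.r0, h.r1, h.r2, h.r3, h.r5, h.r6, h.free, h.budget, h.low, h.good,
      SplitTable.step_zero hN h.split, h.zero⟩
  refine seq (T₁ := 400) (T₂ := ∑ c ∈ Finset.Ico 1 (N * N), stepCost μ Nr (level c) + 100)
    ((decideCell hN hE h' (by omega) (h7.trans hz.1.symm) (h8.trans hz.2.symm) le_rfl).mono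
      le_rfl ?_) (by omega)
  rintro σ₁ ⟨ht₁, hr₁⟩
  refine seq_assign rfl (by simp; omega) (by omega) ?_
  refine (whileC (φ := ∑ c ∈ Finset.Ico 1 (N * N), stepCost μ Nr (level c)) rfl
    -- The potential is the cost of the remaining steps, and memory is reserved for two calls in
    -- each of them.
    (fun φ τ => ∃ c, 1 ≤ c ∧ c ≤ N * N ∧ Tables n N k B E mem₀ c c (2 * (N * N - c) + b) τ ∧
      τ.reg 9 = c ∧ τ.reg 7 = evenBits (c - 1) ∧ τ.reg 8 = oddBits (c - 1) ∧
      φ = ∑ c ∈ Finset.Ico c (N * N), stepCost μ Nr (level c)) (by omega) ?_ ?_).mono le_rfl ?_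
  · rintro _ τ ⟨c, hc1, hcN, ht, h9, h7, h8, rfl⟩ hne
    simp [ht.r6, h9, Nat.sub_eq_zero_iff_le] at hne
    refine ⟨∑ c ∈ Finset.Ico (c + 1) (N * N), stepCost μ Nr (level c),
      stepCost μ Nr (level c) - 50, ?_, ?_⟩
    · rw [Finset.sum_eq_sum_Ico_succ_bot hne]
      simp only [stepCost]
      omega
    refine seq (T₁ := 200 * level c + 200)
      (T₂ := 4 * μ (2 ^ level c) + 2 * Nr + 4000 * (2 ^ level c * 2 ^ level c) + 1250)
      ((splitRank (by omega) h9 le_rfl).mono le_rfl ?_) (by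
        simp only [stepCost]
        generalize 2 ^ level c * 2 ^ level c = Z
        generalize μ _ = Y
        clear * -
        omega)
    rintro σ₂ ⟨l, q, hcq, hq, hl, h10, h11, hr₂, hm₂⟩
    rw [← hl]
    have hb := bits_add_pow_le hN hne hcq (by rintro rfl; simp at hq)
    have hb' := bits_lt (L := L) (c := c - 1) (by omega)
    rw [← hN] at hb'
    have ht₂ : Tables n N k B E mem₀ c c (2 * (N * N - c) + b) σ₂ :=
      ht.regs (fun r hr => hr₂ r (by omega) (by omega)) hm₂
    refine seq (T₁ := 400) (T₂ := 4 * μ (2 ^ l) + 2 * Nr + 4000 * (2 ^ l * 2 ^ l) + 850)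
      ((moveOn hcq hq ht₂.r1 ((hr₂ 7 (by norm_num) (by norm_num)).trans h7)
        ((hr₂ 8 (by norm_num) (by norm_num)).trans h8) h10 h11 hb.1 hb.2 hb'.1 hb'.2 hNB
        le_rfl).mono le_rfl ?_) (by
          generalize 2 ^ l * 2 ^ l = Z
          generalize μ _ = Y
          clear * -
          omega)
    rintro σ₃ ⟨e7, e8, e14, e13, hr₃, hm₃⟩
    have ht₃ : Tables n N k B E mem₀ c c (2 * (N * N - (c + 1)) + b + 2) σ₃ :=
      (ht₂.regs (fun r hr => hr₃ r (by omega) (by omega) (by omega) (by omega)) hm₃).weaken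
        (by omega)
    refine seq (T₁ := 4 * μ (2 ^ l) + 2 * Nr + 4000 * (2 ^ l * 2 ^ l) + 200) (T₂ := 450)
      ((updateBlocks hk3 hP hNr hN ht₃ hcq hq e7 e8
        ((hr₃ 10 (by norm_num) (by norm_num) (by norm_num) (by norm_num)).trans h10)
        ((hr₃ 11 (by norm_num) (by norm_num) (by norm_num) (by norm_num)).trans h11) e13 e14
        hb.1 hb.2 (by omega)).mono le_rfl ?_) (by omega)
    rintro σ₄ ⟨ht₄, hr₄⟩
    refine seq (T₁ := 400) (T₂ := 50)
      ((decideCell hN hE ht₄ hne ((hr₄ 7 (by norm_num) (by norm_num)).trans e7)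
        ((hr₄ 8 (by norm_num) (by norm_num)).trans e8) le_rfl).mono le_rfl ?_) (by omega)
    rintro σ₅ ⟨ht₅, hr₅⟩
    have e9 : σ₅.reg 9 = c := by
      rw [hr₅ 9 (by norm_num) (by norm_num) (by norm_num), hr₄ 9 (by norm_num) (by norm_num),
        hr₃ 9 (by norm_num) (by norm_num) (by norm_num) (by norm_num),
        hr₂ 9 (by norm_num) (by norm_num), h9]
    refine assign rfl (by simp [e9]; omega) le_rfl ⟨c + 1, by omega, hne,
      ht₅.regs (fun r hr => ?_) rfl, by simp [e9], ?_, ?_, rfl⟩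
    · rw [set_reg, if_neg (by omega)]
    · simp [hr₅ 7 (by norm_num) (by norm_num) (by norm_num), hr₄ 7 (by norm_num) (by norm_num),
        e7]
    · simp [hr₅ 8 (by norm_num) (by norm_num) (by norm_num), hr₄ 8 (by norm_num) (by norm_num),
        e8]
  · refine ⟨1, le_rfl, hN1, Tables.weaken (b := 2 * (N * N) + b)
      (ht₁.regs (fun r hr => ?_) rfl) (by omega), by simp, ?_, ?_,
      rfl⟩
    · rw [set_reg, if_neg (by omega)]
    · simp [hr₁ 7 (by norm_num) (by norm_num) (by norm_num), h7, hz]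
    · simp [hr₁ 8 (by norm_num) (by norm_num) (by norm_num), h8, hz]
  · rintro σ' ⟨h0, φ', c, hc1, hcN, ht, h9, -, -, -⟩
    simp [ht.r6, h9, Nat.sub_eq_zero_iff_le] at h0
    obtain rfl : c = N * N := by omega
    exact ht.weaken (by omega)

/-- The least power of two that is at least `n`. -/
def roundUp : Program := .seq (assign 1 (lit 1)) (whileC (vn - vN) (assign 1 (vN + vN)))

theorem Triple.roundUp {W B T n : ℕ} {σ : MachineState} (h0 : σ.reg 0 = n) (hn : 1 ≤ n)
    (hB : 2 * n ≤ B) (hT : 100 * n + 100 ≤ T) :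
    Triple W B roundUp σ T (fun σ' => ∃ L, σ'.reg 1 = 2 ^ L ∧ n ≤ 2 ^ L ∧ 2 ^ L ≤ 2 * n ∧
      (∀ r, r ≠ 1 → σ'.reg r = σ.reg r) ∧ σ'.mem = σ.mem) := by
  refine of_eight fun hB8 => seq_assign rfl (by simp; omega) (by omega) ?_
  refine (whileC (φ := 100 * n) rfl (fun φ τ => ∃ L, τ.reg 1 = 2 ^ L ∧ 2 ^ L ≤ 2 * n ∧
    (∀ r, r ≠ 1 → τ.reg r = σ.reg r) ∧ τ.mem = σ.mem ∧ 100 * (n - 2 ^ L) ≤ φ) (by omega)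
    ?_ ?_).mono le_rfl ?_
  · rintro φ τ ⟨L, h1, hL, hr, hm, hφ⟩ hne
    have e0 := (hr 0 (by norm_num)).trans h0
    simp [e0, h1, Nat.sub_eq_zero_iff_le] at hne
    have hpos : 1 ≤ 2 ^ L := Nat.one_le_two_pow
    -- Every doubling lowers n - 2 ^ L by at least 1; this crude linear bound is good enough.
    refine ⟨100 * (n - 2 ^ (L + 1)), 50, by rw [pow_succ]; omega, assign rfl ?_ le_rfl
      ⟨L + 1, ?_, by rw [pow_succ]; omega, fun r hr1 => ?_, hm, le_rfl⟩⟩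
    · simp [h1]; omega
    · simp [h1, pow_succ]; omega
    · simp [hr1, hr r hr1]
  · exact ⟨0, by simp, by simp; omega, fun r hr => by simp [hr], rfl, by simp⟩
  · rintro σ' ⟨hz, φ, L, h1, hL, hr, hm, -⟩
    have e0 := (hr 0 (by norm_num)).trans h0
    simp [e0, h1, Nat.sub_eq_zero_iff_le] at hz
    exact ⟨L, h1, hz, hL, hr, hm⟩

/-- Compute the size of the memory of a call. -/
def powerProgram : ℕ → Program
  | 0 => assign 5 (lit 1)
  | k + 1 => .seq (powerProgram k) (assign 5 (vR * (vN + lit 2)))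

theorem Triple.powerProgram {W B T N k : ℕ} {σ : MachineState} (h1 : σ.reg 1 = N)
    (hB : (N + 2) ^ k ≤ B) (hT : 50 * (k + 1) ≤ T) :
    Triple W B (powerProgram k) σ T (fun σ' => σ' = σ.set 5 ((N + 2) ^ k)) := by
  refine of_eight fun hB8 => ?_
  induction k generalizing T with
  | zero => exact assign rfl (by simp; omega) (by omega) (by simp)
  | succ k ih =>
    have hle : (N + 2) ^ k ≤ (N + 2) ^ (k + 1) := Nat.pow_le_pow_right (by omega) (by omega)
    refine seq (T₂ := 50) ((ih (hle.trans hB) le_rfl).mono le_rfl ?_) (by omega)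
    rintro σ' rfl
    refine assign rfl (by simpa [h1, pow_succ] using hB) le_rfl ?_
    simp only [eval_mul, eval_add, eval_var, eval_lit, set_reg]
    simp [MachineState.set, h1, pow_succ]

/-- Set up the registers. -/
def setUp (k : ℕ) : Program :=
  .seq roundUp (.seq (assign 2 (lit 2 * (vn * vn))) (.seq (assign 6 (vN * vN))
    (.seq (assign 3 (vX + vM)) (.seq (assign 4 (vA + vM)) (powerProgram k)))))

/-- As N ≤ 2 * n, the tables end by address 2 * n² + 2 * N² ≤ 10 * n², and the 2 * N² calls number
at most 8 * n². -/
theorem Triple.setUp {W B T n k b : ℕ} {E : ℕ → ℕ → Prop} {σ : MachineState}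
    (hσ : σ.IsInitial n (n * n)) (hn : 1 ≤ n)
    (hB : 10 * (n * n) + (8 * (n * n) + b) * (2 * n + 2) ^ k ≤ B)
    (hT : 100 * n + 400 + 50 * (k + 1) ≤ T) :
    Triple W B (setUp k) σ T (fun σ' => ∃ L N, N = 2 ^ L ∧ n ≤ N ∧ N ≤ 2 * n ∧
      Tables n N k B E σ.mem 0 0 (2 * (N * N) + b) σ' ∧ σ'.reg 7 = 0 ∧ σ'.reg 8 = 0) := by
  refine of_eight fun hB8 => ?_
  obtain ⟨h0, hr0, hm0⟩ := hσ
  have hnn : n ≤ n * n := Nat.le_mul_self n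
  refine seq (T₁ := 100 * n + 100) (T₂ := 300 + 50 * (k + 1))
    ((roundUp h0 hn (by omega) le_rfl).mono le_rfl ?_) (by omega)
  rintro σ₁ ⟨L, h1, hnN, hN2, hr, hm⟩
  obtain ⟨N, hN⟩ : ∃ N, N = 2 ^ L := ⟨_, rfl⟩
  rw [← hN] at h1 hnN hN2
  have e0 := (hr 0 (by norm_num)).trans h0
  have hNN : N * N ≤ 4 * (n * n) := by nlinarith
  have hRR : (N + 2) ^ k ≤ (2 * n + 2) ^ k := Nat.pow_le_pow_left (by omega) k
  have hbud : (2 * (N * N) + b) * (N + 2) ^ k ≤ (8 * (n * n) + b) * (2 * n + 2) ^ k :=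
    Nat.mul_le_mul (by omega) hRR
  have hpow1 : (N + 2) ^ k ≤ (2 * (N * N) + b) * (N + 2) ^ k := by
    have : 1 ≤ N * N := Nat.mul_pos (by omega) (by omega)
    exact Nat.le_mul_of_pos_left _ (by omega)
  refine seq_assign rfl ?_ (by omega) (seq_assign rfl ?_ (by omega) (seq_assign rfl ?_ (by omega)
    (seq_assign rfl ?_ (by omega) ((powerProgram (N := N) ?_ (by omega) (by omega)).mono
      (le_refl (300 + 50 * (k + 1) - 50 - 50 - 50 - 50)) ?_))))
  · simp [e0]; omega
  · simp [h1]; omega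
  · simp [h1, e0]; omega
  · simp [h1, e0]; omega
  · simp [h1]
  · rintro σ' rfl
    refine ⟨L, N, hN, hnN, hN2, ⟨?_, ?_, ?_, ?_, ?_, ?_, ?_, ?_, ?_, ?_, ?_, ?_⟩, ?_, ?_⟩
    · simp [e0]
    · simp [h1]
    · simp [e0]
    · simp [e0, h1]
    · simp
    · simp [h1]
    · simp [e0, h1]
    · simp [e0, h1]; omega
    · intro a _
      simp [hm]
    · intro i hi j hj
      have : entry σ.mem (2 * (n * n)) N i j = 0 := hm0 _ (by omega)
      simp [hm, this]
    · have hz : ∀ i < N, ∀ j < N, entry σ.mem (2 * (n * n) + N * N) N i j = 0 :=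
        fun i _ j _ => hm0 _ (by omega)
      simp only [set_mem, hm]
      refine ⟨fun i hi j hj => ?_, fun i hi j hj h => ?_, fun _ _ _ _ _ _ _ _ _ h => ?_⟩
      · rw [hz i hi j hj]; omega
      · rw [hz i hi j hj] at h; omega
      · omega
    · intro a ha
      simp [e0, h1] at ha
      simp only [set_mem, hm]
      exact hm0 a (by omega)
    · simp [hr 7 (by norm_num), hr0]
    · simp [hr 8 (by norm_num), hr0]

/-! ### Extracting a triangulation -/

open Classical in
/-- The least index at which the segment `i j` can be split. -/
noncomputable def splitter (X : ℕ → ℕ → ℕ) (i j : ℕ) : ℕ :=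
  if h : ∃ k, i < k ∧ X i k * X k j ≠ 0 then Nat.find h else 0

theorem splitter_spec {E : ℕ → ℕ → Prop} {X : ℕ → ℕ → ℕ} {N i j : ℕ}
    (hX : ∀ i < N, ∀ j < N, X i j ≤ 1 ∧ (X i j = 1 ↔ Good E i j)) (h : Good E i j)
    (hj : j < N) (hij : i + 1 < j) :
    Good E i (splitter X i j) ∧ Good E (splitter X i j) j ∧
      ∀ k, i < k → k < splitter X i j → X i k * X k j = 0 := by
  classical
  obtain ⟨k, h₁, h₂⟩ := h.eq_or_split.resolve_left (by omega)
  have l1 := h₁.lt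
  have l2 := h₂.lt
  have hk : i < k ∧ X i k * X k j ≠ 0 := by
    refine ⟨l1, ?_⟩
    rw [(hX i (by omega) k (by omega)).2.2 h₁, (hX k (by omega) j hj).2.2 h₂]
    norm_num
  have hex : ∃ k, i < k ∧ X i k * X k j ≠ 0 := ⟨k, hk⟩
  have hs : splitter X i j = Nat.find hex := by rw [splitter, dif_pos hex]
  have hle := Nat.find_min' hex hk
  have hsp := Nat.find_spec hex
  have hmin := fun m => Nat.find_min hex (m := m)
  rw [← hs] at hle hsp hmin
  generalize splitter X i j = w at *
  have hne := hsp.2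
  have b1 := hX i (by omega) w (by omega)
  have b2 := hX w (by omega) j hj
  refine ⟨b1.2.1 ?_, b2.2.1 ?_, fun m hm hmw => ?_⟩
  · have := left_ne_zero_of_mul hne
    omega
  · have := right_ne_zero_of_mul hne
    omega
  · have := hmin m hmw
    push Not at this
    exact this hm

/-- Find the least index at which the segment can be split. -/
def findSplit : Program :=
  .seq (assign 23 (vI + lit 1)) (.seq (loadC 16 (vX + vI * vN + vK))
    (.seq (loadC 17 (vX + vK * vN + vJ)) (whileC (lit 1 - va * vb)
      (.seq (assign 23 (vK + lit 1)) (.seq (loadC 16 (vX + vI * vN + vK))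
        (loadC 17 (vX + vK * vN + vJ)))))))

theorem Triple.findSplit {W B T N X i j : ℕ} {E : ℕ → ℕ → Prop} {σ : MachineState}
    (h1 : σ.reg 1 = N) (h2 : σ.reg 2 = X) (h21 : σ.reg 21 = i) (h22 : σ.reg 22 = j)
    (hX : ∀ i < N, ∀ j < N, entry σ.mem X N i j ≤ 1 ∧ (entry σ.mem X N i j = 1 ↔ Good E i j))
    (h : Good E i j) (hj : j < N) (hij : i + 1 < j) (hT : 200 * (j - i) + 200 ≤ T) :
    Triple W B findSplit σ T (fun σ' => σ'.reg 23 = splitter (entry σ.mem X N) i j ∧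
      (∀ r, r ≠ 16 → r ≠ 17 → r ≠ 23 → σ'.reg r = σ.reg r) ∧ σ'.mem = σ.mem) := by
  refine of_eight fun hB8 => of_small fun hsm => ?_
  have hNB : N ≤ B := h1 ▸ hsm 1 (by norm_num)
  obtain ⟨s1, s2, s3⟩ := splitter_spec hX h hj hij
  set w := splitter (entry σ.mem X N) i j with hw
  have l1 := s1.lt
  have l2 := s2.lt
  have b1 : ∀ k, k ≤ w → σ.mem (X + i * N + k) ≤ B := fun k hk => by
    have := (hX i (by omega) k (by omega)).1
    simp only [entry] at this
    omega
  have b2 : ∀ k, k ≤ w → σ.mem (X + k * N + j) ≤ B := fun k hk => by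
    have := (hX k (by omega) j hj).1
    simp only [entry] at this
    omega
  refine seq_assign rfl ?_ (by omega) (seq_load rfl ?_ (by omega) (seq_load rfl ?_ (by omega)
    ((whileC (φ := 200 * (w - (i + 1))) rfl (fun φ τ => ∃ k, i < k ∧ k ≤ w ∧ τ.reg 23 = k ∧
      τ.reg 16 = entry σ.mem X N i k ∧ τ.reg 17 = entry σ.mem X N k j ∧
      (∀ r, r ≠ 16 → r ≠ 17 → r ≠ 23 → τ.reg r = σ.reg r) ∧ τ.mem = σ.mem ∧
      φ = 200 * (w - k)) (by omega) ?_ ?_).mono (le_refl (T - 50 - 50 - 50)) ?_)))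
  · simp [h21]; omega
  · simp [h21, h1, h2]
    exact b1 _ (by omega)
  · simp [h21, h1, h2, h22]
    exact b2 _ (by omega)
  · rintro _ τ ⟨k, hik, hkw, e23, e16, e17, hr, hm, rfl⟩ hne
    have hkw' : k ≠ w := by
      rintro rfl
      simp [e16, e17, (hX i (by omega) w (by omega)).2.2 s1, (hX w (by omega) j hj).2.2 s2] at hne
    have e1 := (hr 1 (by norm_num) (by norm_num) (by norm_num)).trans h1
    have e2 := (hr 2 (by norm_num) (by norm_num) (by norm_num)).trans h2
    have e21 := (hr 21 (by norm_num) (by norm_num) (by norm_num)).trans h21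
    have e22 := (hr 22 (by norm_num) (by norm_num) (by norm_num)).trans h22
    refine ⟨200 * (w - (k + 1)), 150, by omega, seq_assign rfl ?_ (by norm_num)
      (seq_load rfl ?_ (by norm_num) (load rfl ?_ (by norm_num)
        ⟨k + 1, by omega, by omega, ?_, ?_, ?_, fun r h16 h17 h23 => ?_, ?_, rfl⟩))⟩
    · simp [e23]; omega
    · simp [e23, e1, e2, e21, hm]
      exact b1 _ (by omega)
    · simp [e23, e1, e2, e22, hm]
      exact b2 _ (by omega)
    · simp [e23]
    · simp [e23, e1, e2, e21, hm, entry]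
    · simp [e23, e1, e2, e22, hm, entry]
    · simp [h16, h17, h23, hr r h16 h17 h23]
    · simp [hm]
  · refine ⟨i + 1, by omega, by omega, by simp [h21], ?_, ?_, fun r h16 h17 h23 => ?_, by simp,
      rfl⟩
    · simp [h21, h1, h2, entry]
    · simp [h21, h22, h1, h2, entry]
    · simp [h16, h17, h23]
  · rintro σ' ⟨h0, φ, k, hik, hkw, e23, e16, e17, hr, hm, -⟩
    refine ⟨?_, hr, hm⟩
    rw [e23]
    by_contra hkw'
    have := s3 k hik (by omega)
    simp [e16, e17, this] at h0

/-- The list of pairs is stored as a stack, with the pair `(i, j)` encoded as `i * n + j`. -/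
def StackAt (mem : ℕ → ℕ) (base n : ℕ) : List (ℕ × ℕ) → Prop
  | [] => True
  | p :: l => mem (base + l.length) = p.1 * n + p.2 ∧ StackAt mem base n l

theorem StackAt.congr {mem mem' : ℕ → ℕ} {base n : ℕ} {l : List (ℕ × ℕ)}
    (h : StackAt mem base n l) (hm : ∀ a, base ≤ a → a < base + l.length → mem' a = mem a) :
    StackAt mem' base n l := by
  induction l with
  | nil => trivial
  | cons p l ih =>
    simp only [List.length_cons] at hm
    exact ⟨(hm _ (by omega) (by omega)).trans h.1, ih h.2 fun a h1 h2 => hm a h1 (by omega)⟩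

/-- What it may cost to process the segments of the list. -/
def segmentCost (l : List (ℕ × ℕ)) : ℕ :=
  (l.map fun p => 3000 * ((p.2 - p.1) * (p.2 - p.1))).sum

/-- This bounds the height of the stack by the remaining potential and so keeps its addresses in
range. -/
theorem length_le_segmentCost {E : ℕ → ℕ → Prop} {l : List (ℕ × ℕ)}
    (h : ∀ p ∈ l, Good E p.1 p.2) : 3000 * l.length ≤ segmentCost l := by
  induction l with
  | nil => simp
  | cons p l ih =>
    have h1 := ih fun q hq => h q (List.mem_cons_of_mem _ hq)
    have h2 := (h p List.mem_cons_self).lt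
    have h3 : 1 ≤ (p.2 - p.1) * (p.2 - p.1) := Nat.mul_pos (by omega) (by omega)
    simp only [segmentCost, List.length_cons, List.map_cons, List.sum_cons] at h1 ⊢
    omega

/-- The state during the extraction, when the segments in `l` are still to be processed. -/
structure Extracting (n N F : ℕ) (E : ℕ → ℕ → Prop) (X : ℕ → ℕ → ℕ) (w : ℕ → ℕ → ℕ)
    (l : List (ℕ × ℕ)) (σ : MachineState) : Prop where
  r0 : σ.reg 0 = n
  r1 : σ.reg 1 = N
  r2 : σ.reg 2 = 2 * (n * n)
  r4 : σ.reg 4 = F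
  r20 : σ.reg 20 = F + l.length
  table : ∀ i < N, ∀ j < N, entry σ.mem (2 * (n * n)) N i j = X i j
  stack : StackAt σ.mem F n l
  good : ∀ p ∈ l, Good E p.1 p.2
  marked : ∀ a < n, ∀ b < n, entry σ.mem (n * n) n a b ≤ 1 ∧
    (Reach w 0 (n - 1) a b ∨ Reach w 0 (n - 1) b a ↔ entry σ.mem (n * n) n a b = 1 ∨
      ∃ p ∈ l, Reach w p.1 p.2 a b ∨ Reach w p.1 p.2 b a)

/-- Process the topmost segment of the stack. -/
def processSegment : Program :=
  .seq (assign 20 (vp - lit 1)) (.seq (loadC 18 vp) (.seq (assign 21 (vv / vn))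
    (.seq (assign 22 (vv - vI * vn)) (.seq (storeC (vn * vn + vI * vn + vJ) (lit 1))
      (.seq (storeC (vn * vn + vJ * vn + vI) (lit 1)) (ifC (vJ - (vI + lit 1))
        (.seq findSplit (.seq (storeC vp (vI * vn + vK)) (.seq (storeC (vp + lit 1) (vK * vn + vJ))
          (assign 20 (vp + lit 2))))) .skip))))))

theorem Triple.processSegment_of {W B n F m i j T T' : ℕ} {σ τ : MachineState}
    {Q : MachineState → Prop} (h0 : σ.reg 0 = n) (h20 : σ.reg 20 = F + m + 1)
    (hcode : σ.mem (F + m) = i * n + j) (hjn : j < n) (hB : i * n + j ≤ B) (hiB : i ≤ B)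
    (hmB : F + m ≤ B)
    (hτ : τ = (((((σ.set 20 (F + m)).set 18 (i * n + j)).set 21 i).set 22
      j).put (n * n + i * n + j) 1).put (n * n + j * n + i) 1) (hT' : 1 ≤ T')
    (hT : T' + 400 ≤ T)
    (h₁ : i + 1 < j → Triple W B (.seq _root_.findSplit (.seq (storeC vp (vI * vn + vK))
      (.seq (storeC (vp + lit 1) (vK * vn + vJ)) (_root_.assign 20 (vp + lit 2))))) τ T' Q)
    (h₂ : j ≤ i + 1 → Q τ) : Triple W B processSegment σ T Q := by
  have hdiv := (index_div (i := i) hjn).1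
  have hsub : i * n + j - i * n = j := by omega
  refine seq_assign rfl ?_ (by omega) (seq_load rfl ?_ (by omega) (seq_assign rfl ?_ (by omega)
    (seq_assign rfl ?_ (by omega) (seq_store rfl rfl (by omega) (seq_store rfl rfl (by omega)
      (ifC (T₁ := T') rfl (by omega) ?_ ?_))))))
  · simp [h20]; omega
  · simp [h20, hcode]; omega
  · simp [h20, hcode, h0, hdiv]; omega
  · simp [h20, hcode, h0, hdiv, hsub]; omega
  · intro hne
    simp [h20, hcode, h0, hdiv, hsub, Nat.sub_eq_zero_iff_le] at hne ⊢
    rw [← hτ]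
    exact h₁ hne
  · intro heq
    simp [h20, hcode, h0, hdiv, hsub, Nat.sub_eq_zero_iff_le] at heq ⊢
    rw [← hτ]
    exact skip hT' (h₂ heq)

theorem reach_or_reach_iff {w : ℕ → ℕ → ℕ} {i j a b : ℕ} :
    Reach w i j a b ∨ Reach w i j b a ↔ ((a = i ∧ b = j) ∨ (b = i ∧ a = j)) ∨
      (i + 1 < j ∧ ((Reach w i (w i j) a b ∨ Reach w i (w i j) b a) ∨
        (Reach w (w i j) j a b ∨ Reach w (w i j) j b a))) := by
  rw [reach_iff (a := a), reach_iff (a := b)]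
  tauto

/-- `splitter` searches without an upper limit, and the tables agree only below N. The least
splitting vertex of a good segment is less than j, so the rest does not matter. -/
theorem splitter_congr {X Y : ℕ → ℕ → ℕ} {E : ℕ → ℕ → Prop} {N i j : ℕ}
    (hX : ∀ i < N, ∀ j < N, X i j ≤ 1 ∧ (X i j = 1 ↔ Good E i j))
    (hY : ∀ i < N, ∀ j < N, Y i j = X i j) (h : Good E i j) (hj : j < N) (hij : i + 1 < j) :
    splitter Y i j = splitter X i j := by
  have q1 := splitter_spec (X := Y) (E := E)
    (fun a ha b hb => by rw [hY a ha b hb]; exact hX a ha b hb) h hj hij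
  have q2 := splitter_spec hX h hj hij
  set w' := splitter Y i j
  set w := splitter X i j
  have k1 := q1.1.lt
  have k2 := q1.2.1.lt
  have l1 := q2.1.lt
  have l2 := q2.2.1.lt
  rcases lt_trichotomy w' w with hlt | heq | hlt
  · have := q2.2.2 w' k1 hlt
    rw [(hX i (by omega) w' (by omega)).2.2 q1.1, (hX w' (by omega) j hj).2.2 q1.2.1] at this
    omega
  · exact heq
  · have := q1.2.2 w l1 hlt
    rw [hY i (by omega) w (by omega), hY w (by omega) j hj,
      (hX i (by omega) w (by omega)).2.2 q2.1, (hX w (by omega) j hj).2.2 q2.2.1] at this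
    omega

/-- The potential of a segment is quadratic in its length. Splitting d = x + y releases 6000 * x * y
≥ 6000 * (d - 1) ≥ 3000 * d, which pays for the linear search for the splitting vertex. -/
theorem Triple.processSegment {W B n N F : ℕ} {E : ℕ → ℕ → Prop} {X : ℕ → ℕ → ℕ} {p : ℕ × ℕ}
    {l : List (ℕ × ℕ)} {σ : MachineState} (hnN : n ≤ N) (hEn : ∀ i j, E i j → j < n)
    (hX : ∀ i < N, ∀ j < N, X i j ≤ 1 ∧ (X i j = 1 ↔ Good E i j))
    (hF : 2 * (n * n) + N * N ≤ F) (hB : F + n * n + 2 ≤ B)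
    (h : Extracting n N F E X (splitter X) (p :: l) σ)
    (hφ : segmentCost (p :: l) ≤ 3000 * (n * n)) :
    ∃ l', 850 + 200 * (p.2 - p.1) + segmentCost l' ≤ segmentCost (p :: l) ∧
      Triple W B processSegment σ (800 + 200 * (p.2 - p.1)) (Extracting n N F E X (splitter X) l')
      := by
  obtain ⟨i, j⟩ := p
  have hij := h.good (i, j) List.mem_cons_self
  simp only at hij ⊢
  have hlt := hij.lt
  have hjn := hEn i j hij.edge
  have hlen := length_le_segmentCost h.good
  simp only [List.length_cons] at hlen
  have hcode := h.stack.1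
  have hst := h.stack.2
  simp only at hcode
  have e0 := h.r0
  have e1 := h.r1
  have e2 := h.r2
  have e4 := h.r4
  have e20 := h.r20
  simp only [List.length_cons] at e20
  have hc := index_lt (show i < n by omega) hjn
  have hc' := index_lt hjn (show i < n by omega)
  have hdiv := index_div (i := i) hjn
  have hnn : n ≤ n * n := Nat.le_mul_self n
  have hsub : i * n + j - i * n = j := by omega
  -- The state after the segment has been marked.
  obtain ⟨τ, hτ⟩ : ∃ τ, τ = (((((σ.set 20 (F + l.length)).set 18 (i * n + j)).set 21 i).set 22
      j).put (n * n + i * n + j) 1).put (n * n + j * n + i) 1 := ⟨_, rfl⟩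
  have hτm : ∀ a, 2 * (n * n) ≤ a → τ.mem a = σ.mem a := by
    intro a ha
    simp only [hτ, put_mem, set_mem]
    rw [if_neg (by omega), if_neg (by omega)]
  have htab : ∀ i < N, ∀ j < N, entry τ.mem (2 * (n * n)) N i j = X i j := by
    intro i hi j hj
    rw [← h.table i hi j hj]
    exact hτm _ (by omega)
  have hmark : ∀ a < n, ∀ b < n, entry τ.mem (n * n) n a b ≤ 1 ∧
      (entry τ.mem (n * n) n a b = 1 ↔ entry σ.mem (n * n) n a b = 1 ∨
        (a = i ∧ b = j) ∨ (b = i ∧ a = j)) := by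
    intro a ha b hb
    have i1 := index_inj (i := a) (i' := i) hb hjn
    have i2 := index_inj (i := a) (i' := j) hb (show i < n by omega)
    have hle := (h.marked a ha b hb).1
    simp only [entry, hτ, put_mem, set_mem] at hle ⊢
    by_cases h1 : a = j ∧ b = i
    · rw [if_pos (by have := i2.2 h1; omega)]
      exact ⟨le_rfl, iff_of_true rfl (.inr (.inr ⟨h1.2, h1.1⟩))⟩
    rw [if_neg (fun hh => h1 (i2.1 (by omega)))]
    by_cases h2 : a = i ∧ b = j
    · rw [if_pos (by have := i1.2 h2; omega)]
      exact ⟨le_rfl, iff_of_true rfl (.inr (.inl h2))⟩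
    rw [if_neg (fun hh => h2 (i1.1 (by omega)))]
    exact ⟨hle, by simp [h2, and_comm.not.1 h1]⟩
  have hsplit : ∀ a < n, ∀ b < n, (Reach (splitter X) 0 (n - 1) a b ∨
      Reach (splitter X) 0 (n - 1) b a ↔ entry τ.mem (n * n) n a b = 1 ∨
      (i + 1 < j ∧ ((Reach (splitter X) i (splitter X i j) a b ∨
        Reach (splitter X) i (splitter X i j) b a) ∨ (Reach (splitter X) (splitter X i j) j a b ∨
        Reach (splitter X) (splitter X i j) j b a))) ∨
      ∃ p ∈ l, Reach (splitter X) p.1 p.2 a b ∨ Reach (splitter X) p.1 p.2 b a) := by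
    intro a ha b hb
    rw [(h.marked a ha b hb).2, (hmark a ha b hb).2, List.exists_mem_cons_iff,
      reach_or_reach_iff]
    simp only [or_assoc]
  have t20 : τ.reg 20 = F + l.length := by simp [hτ]
  have t21 : τ.reg 21 = i := by simp [hτ]
  have t22 : τ.reg 22 = j := by simp [hτ]
  have t0 : τ.reg 0 = n := by simp [hτ, e0]
  have t1 : τ.reg 1 = N := by simp [hτ, e1]
  have t2 : τ.reg 2 = 2 * (n * n) := by simp [hτ, e2]
  have t4 : τ.reg 4 = F := by simp [hτ, e4]
  by_cases hside : i + 1 < j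
  · obtain ⟨s1, s2, -⟩ := splitter_spec hX hij (by omega) hside
    set w := splitter X i j with hw
    have l1 := s1.lt
    have l2 := s2.lt
    refine ⟨(w, j) :: (i, w) :: l, ?_, processSegment_of e0 (by omega) hcode hjn (by omega) (by omega)
      (by omega) hτ
      (T' := 200 * (j - i) + 400) (by omega) (by omega)
      (fun _ => ?_) (fun hle => by omega)⟩
    · simp only [segmentCost, List.map_cons, List.sum_cons]
      obtain ⟨a, ha⟩ : ∃ a, w = i + a + 1 := ⟨w - i - 1, by omega⟩
      obtain ⟨b, hb⟩ : ∃ b, j = w + b + 1 := ⟨j - w - 1, by omega⟩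
      rw [show j - i = a + b + 2 by omega, show j - w = b + 1 by omega,
        show w - i = a + 1 by omega]
      have e : 3000 * ((a + b + 2) * (a + b + 2)) = 3000 * ((b + 1) * (b + 1)) +
          3000 * ((a + 1) * (a + 1)) + (6000 * (a * b) + 6000 * a + 6000 * b + 6000) := by ring
      rw [e]
      generalize a * b = c
      generalize (a + 1) * (a + 1) = c'
      generalize (b + 1) * (b + 1) = c''
      clear * -
      omega
    · refine seq (T₁ := 200 * (j - i) + 200) (T₂ := 150) ((findSplit (E := E) t1 t2 t21 t22
        (fun a ha b hb => by rw [htab a ha b hb]; exact hX a ha b hb) hij (by omega) hside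
        le_rfl).mono le_rfl ?_) (by omega)
      rintro σ₁ ⟨h23, hr, hm⟩
      rw [splitter_congr hX htab hij (by omega) hside, ← hw] at h23
      have g0 := (hr 0 (by norm_num) (by norm_num) (by norm_num)).trans t0
      have g1 := (hr 1 (by norm_num) (by norm_num) (by norm_num)).trans t1
      have g2 := (hr 2 (by norm_num) (by norm_num) (by norm_num)).trans t2
      have g4 := (hr 4 (by norm_num) (by norm_num) (by norm_num)).trans t4
      have g20 := (hr 20 (by norm_num) (by norm_num) (by norm_num)).trans t20
      have g21 := (hr 21 (by norm_num) (by norm_num) (by norm_num)).trans t21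
      have g22 := (hr 22 (by norm_num) (by norm_num) (by norm_num)).trans t22
      have hlow : ∀ ρ : MachineState, (∀ a < F, ρ.mem a = τ.mem a) →
          (∀ i < N, ∀ j < N, entry ρ.mem (2 * (n * n)) N i j = X i j) ∧
          ∀ a < n, ∀ b < n, entry ρ.mem (n * n) n a b = entry τ.mem (n * n) n a b := by
        intro ρ hρ
        refine ⟨fun a ha b hb => ?_, fun a ha b hb => ?_⟩
        · have := index_lt ha hb
          rw [← htab a ha b hb]
          exact hρ _ (by omega)
        · have := index_lt ha hb
          exact hρ _ (by omega)
      refine seq_store rfl rfl (by norm_num) (seq_store rfl rfl (by norm_num)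
        (assign rfl ?_ (by norm_num) ?_))
      · simp [g20]; omega
      simp only [eval_mul, eval_add, eval_var, eval_lit, put_reg, g0, g20, g21, g22, h23]
      have hl := hlow (((σ₁.put (F + l.length) (i * n + w)).put (F + l.length + 1)
        (w * n + j)).set 20 (F + l.length + 2)) (fun a ha => by
          simp only [set_mem, put_mem]
          rw [if_neg (by omega), if_neg (by omega), hm])
      refine ⟨?_, ?_, ?_, ?_, ?_, hl.1, ⟨?_, ?_, ?_⟩, ?_, fun a ha b hb => ?_⟩
      · simp [g0]
      · simp [g1]
      · simp [g2]
      · simp [g4]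
      · simp; omega
      · simp only [set_mem, put_mem, List.length_cons]
        rw [if_pos (by omega)]
      · simp
      · refine hst.congr fun a h1 h2 => ?_
        simp only [set_mem, put_mem]
        rw [if_neg (by omega), if_neg (by omega), hm, hτm a (by omega)]
      · intro q hq
        simp only [List.mem_cons] at hq
        rcases hq with rfl | rfl | hq
        · exact s2
        · exact s1
        · exact h.good q (List.mem_cons_of_mem _ hq)
      · rw [hl.2 a ha b hb]
        refine ⟨(hmark a ha b hb).1, (hsplit a ha b hb).trans ?_⟩
        rw [List.exists_mem_cons_iff, List.exists_mem_cons_iff, and_iff_right hside, or_assoc]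
        exact or_congr_right or_left_comm
  · refine ⟨l, ?_, processSegment_of e0 (by omega) hcode hjn (by omega) (by omega)
      (by omega) hτ
      (T' := 200 * (j - i) + 400) (by omega) (by omega)
      (fun hh => absurd hh hside) (fun _ => ?_)⟩
    · simp only [segmentCost, List.map_cons, List.sum_cons]
      rw [show j - i = 1 by omega]
      omega
    · refine ⟨t0, t1, t2, t4, t20, htab, hst.congr fun a h1 h2 => hτm a (by omega),
        fun q hq => h.good q (List.mem_cons_of_mem _ hq), fun a ha b hb => ?_⟩
      refine ⟨(hmark a ha b hb).1, (hsplit a ha b hb).trans ?_⟩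
      simp [hside]

/-- Read off the answer from the table of good segments. -/
def extract : Program :=
  .seq (loadC 18 (vX + (vn - lit 1))) (ifC vv
    -- The pair (0, n - 1) is encoded by 0 * n + (n - 1).
    (.seq (storeC vF (vn - lit 1)) (.seq (assign 20 (vF + lit 1))
      (.seq (whileC (vp - vF) processSegment) (assign 0 (lit 1)))))
    (assign 0 (lit 0)))

theorem Triple.extract {W B T n N F : ℕ} {E : ℕ → ℕ → Prop} {σ : MachineState}
    (hn : 2 ≤ n) (hnN : n ≤ N) (hEn : ∀ i j, E i j → j < n)
    (h0 : σ.reg 0 = n) (h1 : σ.reg 1 = N) (h2 : σ.reg 2 = 2 * (n * n)) (h4 : σ.reg 4 = F)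
    (hX : ∀ i < N, ∀ j < N, entry σ.mem (2 * (n * n)) N i j ≤ 1 ∧
      (entry σ.mem (2 * (n * n)) N i j = 1 ↔ Good E i j))
    (hz : ∀ a, n * n ≤ a → a < 2 * (n * n) → σ.mem a = 0)
    (hF : 2 * (n * n) + N * N ≤ F) (hB : F + n * n + 2 ≤ B) (hT : 3000 * (n * n) + 400 ≤ T) :
    Triple W B extract σ T (fun σ' =>
      (σ'.reg 0 = 1 ∧ Good E 0 (n - 1) ∧ ∃ w, Splits E w ∧ ∀ a < n, ∀ b < n,
        σ'.mem (n * n + a * n + b) ≤ 1 ∧ (σ'.mem (n * n + a * n + b) = 1 ↔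
          Reach w 0 (n - 1) a b ∨ Reach w 0 (n - 1) b a)) ∨
      (σ'.reg 0 = 0 ∧ ¬ Good E 0 (n - 1))) := by
  refine of_eight fun hB8 => ?_
  set X := entry σ.mem (2 * (n * n)) N with hXdef
  have hx := hX 0 (by omega) (n - 1) (by omega)
  have hx0 : σ.mem (2 * (n * n) + (n - 1)) = X 0 (n - 1) := by simp [hXdef, entry]
  have hnn : n ≤ n * n := Nat.le_mul_self n
  have hw : Splits E (splitter X) := fun i j hij hlt =>
    have hs := splitter_spec hX hij ((hEn i j hij.edge).trans_le hnN) hlt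
    ⟨hs.1, hs.2.1⟩
  refine seq_load rfl ?_ (by omega) (ifC (T₁ := 3000 * (n * n) + 300) rfl (by omega)
    (fun hne => ?_) (fun heq => ?_))
  · simp [h2, h0, hx0]; omega
  · simp [h2, h0, hx0] at hne
    have hg : Good E 0 (n - 1) := hx.2.1 (by omega)
    refine seq_store rfl rfl (by omega) (seq_assign rfl ?_ (by omega)
      (seq (T₁ := 3000 * (n * n) + 100) (T₂ := 50) ((whileC (φ := 3000 * (n * n)) rfl
        (fun φ τ => ∃ l, Extracting n N F E X (splitter X) l τ ∧ segmentCost l ≤ φ ∧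
          φ ≤ 3000 * (n * n)) (by omega) ?_ ?_).mono le_rfl ?_) (by omega)))
    · simp [h4]; omega
    · rintro φ τ ⟨l, hl, hφ, hφ'⟩ hne
      cases l with
      | nil =>
        have := hl.r20
        simp [hl.r4, this] at hne
      | cons p l =>
        obtain ⟨l', hle, htr⟩ := processSegment (W := W) hnN hEn hX hF hB hl (hφ.trans hφ')
        exact ⟨segmentCost l', 800 + 200 * (p.2 - p.1), by omega,
          htr.mono le_rfl fun σ' hσ' => ⟨l', hσ', le_rfl, by omega⟩⟩
    · refine ⟨[(0, n - 1)], ⟨?_, ?_, ?_, ?_, ?_, fun i hi j hj => ?_, ⟨?_, trivial⟩, ?_,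
        fun a ha b hb => ?_⟩, ?_, le_rfl⟩
      · simp [h0]
      · simp [h1]
      · simp [h2]
      · simp [h4]
      · simp [h4]
      · have := index_lt hi hj
        have hne : 2 * (n * n) + i * N + j ≠ F := by omega
        simp [hXdef, entry, h4, hne]
      · simp [h4, h0]
      · simpa using hg
      · have := index_lt ha hb
        have hzero : entry σ.mem (n * n) n a b = 0 := hz _ (by omega) (by omega)
        have hne : n * n + a * n + b ≠ F := by omega
        simp only [entry] at hzero ⊢
        simp [h4, hne, hzero]
      · simp only [segmentCost, List.map_cons, List.map_nil, List.sum_cons, List.sum_nil]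
        have : (n - 1 - 0) * (n - 1 - 0) ≤ n * n := Nat.mul_le_mul (by omega) (by omega)
        omega
    · rintro τ ⟨hz0, φ, l, hl, -, -⟩
      have hl0 : l = [] := by
        have := hl.r20
        simp [hl.r4, this] at hz0
        exact hz0
      subst hl0
      refine assign rfl (by simp; omega) le_rfl (.inl ⟨by simp, hg, splitter X, hw,
        fun a ha b hb => ⟨(hl.marked a ha b hb).1, ?_⟩⟩)
      rw [(hl.marked a ha b hb).2]
      simp [entry]
  · simp [h2, h0, hx0] at heq
    refine assign rfl (by simp) (by omega) (.inr ⟨by simp, fun hg => ?_⟩)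
    have := hx.2.2 hg
    omega

/-! ### The running time -/

theorem sum_level_rpow_le {ω : ℝ} (hω : 2 < ω) (L : ℕ) :
    ∑ c ∈ Finset.Ico 1 (4 ^ L), (2 ^ level c : ℝ) ^ ω ≤ 3 / (2 ^ ω - 4) * (2 ^ L : ℝ) ^ ω := by
  have h4 : (4 : ℝ) < 2 ^ ω := by
    have h : (2 : ℝ) ^ (2 : ℝ) < 2 ^ ω := Real.rpow_lt_rpow_of_exponent_lt (by norm_num) hω
    have h' : (2 : ℝ) ^ (2 : ℝ) = 4 := by
      rw [show (2 : ℝ) = ((2 : ℕ) : ℝ) by norm_num, Real.rpow_natCast]; norm_num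
    linarith
  set D : ℝ := 3 / (2 ^ ω - 4) with hD
  have hDpos : 0 < D := by
    have : (0 : ℝ) < 2 ^ ω - 4 := by linarith
    positivity
  have hD3 : D * (2 ^ ω - 4) = 3 := by
    have : (2 : ℝ) ^ ω - 4 ≠ 0 := by linarith
    rw [hD]; field_simp
  have hsucc : ∀ l : ℕ, ((2 : ℝ) ^ (l + 1)) ^ ω = 2 ^ ω * (2 ^ l : ℝ) ^ ω := fun l => by
    rw [pow_succ, mul_comm, Real.mul_rpow (by norm_num) (by positivity)]
  -- The additional term D * 4 ^ L makes the induction close: the sum S satisfies S (L + 1) = 2 ^ ω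
  -- * S L + 3 * 4 ^ L, and D * 2 ^ ω = 3 + 4 * D.
  have key : ∑ c ∈ Finset.Ico 1 (4 ^ L), (2 ^ level c : ℝ) ^ ω + D * 4 ^ L ≤
      D * (2 ^ L : ℝ) ^ ω := by
    induction L with
    | zero => simp
    | succ L ih =>
      rw [sum_level_succ (fun l => (2 ^ l : ℝ) ^ ω) L]
      simp only [hsucc, ← Finset.mul_sum, pow_zero, Real.one_rpow, nsmul_eq_mul, mul_one]
      push_cast
      have h5 := mul_le_mul_of_nonneg_left ih (by positivity : (0 : ℝ) ≤ 2 ^ ω)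
      have h6 : D * (2 : ℝ) ^ ω * 4 ^ L = 3 * 4 ^ L + D * 4 * 4 ^ L := by
        rw [← hD3]; ring
      rw [pow_succ]
      nlinarith
  have : 0 ≤ D * 4 ^ L := by positivity
  linarith

/-- With 5700 = 4000 + 200 + 1500: the numbers 1, l and 4 ^ l are all at most (2 ^ l) ^ ω, as ω > 2.
-/
theorem sum_stepCost_le {ω K : ℝ} (hω : 2 < ω) (hK : 0 ≤ K) (Nr L : ℕ) :
    ((∑ c ∈ Finset.Ico 1 (4 ^ L), stepCost (fun m => ⌊K * (m : ℝ) ^ ω⌋₊) Nr (level c) : ℕ) : ℝ) ≤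
      (4 * K + 2 * Nr + 5700) * (3 / (2 ^ ω - 4)) * (2 ^ L : ℝ) ^ ω := by
  have hstep : ∀ l : ℕ, (stepCost (fun m => ⌊K * (m : ℝ) ^ ω⌋₊) Nr l : ℝ) ≤
      (4 * K + 2 * Nr + 5700) * (2 ^ l : ℝ) ^ ω := by
    intro l
    have h1 : (1 : ℝ) ≤ 2 ^ l := one_le_pow₀ (by norm_num)
    have h2 : (2 ^ l : ℝ) * 2 ^ l ≤ (2 ^ l : ℝ) ^ ω := by
      have := Real.rpow_le_rpow_of_exponent_le h1 hω.le
      rwa [Real.rpow_two, sq] at this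
    have h3 : (l : ℝ) ≤ (2 ^ l : ℝ) * 2 ^ l := by
      have : (l : ℝ) ≤ 2 ^ l := by exact_mod_cast Nat.lt_two_pow_self.le
      nlinarith
    have h4 : (⌊K * ((2 ^ l : ℕ) : ℝ) ^ ω⌋₊ : ℝ) ≤ K * (2 ^ l : ℝ) ^ ω := by
      have := Nat.floor_le (show 0 ≤ K * ((2 ^ l : ℕ) : ℝ) ^ ω by positivity)
      simpa using this
    have h5 : (1 : ℝ) ≤ (2 ^ l : ℝ) ^ ω := Real.one_le_rpow h1 (by linarith)
    have h6 : (Nr : ℝ) ≤ Nr * (2 ^ l : ℝ) ^ ω := le_mul_of_one_le_right (by positivity) h5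
    simp only [stepCost]
    push_cast at h4 ⊢
    linarith
  push_cast
  calc ∑ c ∈ Finset.Ico 1 (4 ^ L), (stepCost (fun m => ⌊K * (m : ℝ) ^ ω⌋₊) Nr (level c) : ℝ)
      ≤ ∑ c ∈ Finset.Ico 1 (4 ^ L), (4 * K + 2 * Nr + 5700) * (2 ^ level c : ℝ) ^ ω :=
        Finset.sum_le_sum fun c _ => hstep _
    _ = (4 * K + 2 * Nr + 5700) * ∑ c ∈ Finset.Ico 1 (4 ^ L), (2 ^ level c : ℝ) ^ ω := by
        rw [Finset.mul_sum]
    _ ≤ (4 * K + 2 * Nr + 5700) * (3 / (2 ^ ω - 4) * (2 ^ L : ℝ) ^ ω) :=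
        mul_le_mul_of_nonneg_left (sum_level_rpow_le hω L) (by positivity)
    _ = _ := by ring

/-- From 2 * n + 2 ≤ (n + 2) ^ 2 and 19 * n² + 2 ≤ (n + 2) ^ 4. The eighth power is the room that
expressions need, and the final + 1 makes the inequality strict. -/
theorem size_bound {n k : ℕ} (hn : 3 ≤ n) :
    (10 * (n * n) + (8 * (n * n) + (n * n + 2)) * (2 * n + 2) ^ k) ^ 8 <
      (n + 2) ^ (8 * (2 * k + 4) + 1) := by
  have h1 : (2 * n + 2) ^ k ≤ (n + 2) ^ (2 * k) := by
    rw [pow_mul]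
    exact Nat.pow_le_pow_left (by nlinarith) k
  have h2 : 1 ≤ (n + 2) ^ (2 * k) := Nat.one_le_pow _ _ (by omega)
  have h3 : 10 * (n * n) + (8 * (n * n) + (n * n + 2)) * (2 * n + 2) ^ k ≤
      (n + 2) ^ (2 * k + 4) := by
    calc 10 * (n * n) + (8 * (n * n) + (n * n + 2)) * (2 * n + 2) ^ k
        ≤ 10 * (n * n) * (n + 2) ^ (2 * k) +
          (8 * (n * n) + (n * n + 2)) * (n + 2) ^ (2 * k) :=
          Nat.add_le_add (Nat.le_mul_of_pos_right _ h2) (Nat.mul_le_mul_left _ h1)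
      _ = (n + 2) ^ (2 * k) * (19 * (n * n) + 2) := by ring
      _ ≤ (n + 2) ^ (2 * k) * (n + 2) ^ 4 := by
          refine Nat.mul_le_mul_left _ ?_
          have h5 : 25 ≤ (n + 2) * (n + 2) := 
            Nat.mul_le_mul (show 5 ≤ n + 2 by omega) (show 5 ≤ n + 2 by omega)
          have h6 : n * n + 2 ≤ (n + 2) * (n + 2) := by nlinarith
          calc 19 * (n * n) + 2 ≤ 25 * (n * n + 2) := by omega
            _ ≤ (n + 2) * (n + 2) * ((n + 2) * (n + 2)) := Nat.mul_le_mul h5 h6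
            _ = (n + 2) ^ 4 := by ring
      _ = (n + 2) ^ (2 * k + 4) := by rw [pow_add]
  calc _ ≤ ((n + 2) ^ (2 * k + 4)) ^ 8 := Nat.pow_le_pow_left h3 8
    _ = (n + 2) ^ (8 * (2 * k + 4)) := by rw [← pow_mul, mul_comm]
    _ < _ := Nat.pow_lt_pow_right (by omega) (by omega)

/-! ### Assembling the algorithm -/

theorem represents_edgeRel {n : ℕ} {G : SimpleGraph (Fin n)} {mem : ℕ → ℕ}
    (h : StoredAt mem 0 (adjacencyMatrix G)) : Represents n (edgeRel G) mem := by
  classical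
  refine fun i j => ⟨fun ⟨hi, hj, _⟩ => ⟨hi, hj⟩, fun hi hj => ?_⟩
  have h1 := h ⟨i, hi⟩ ⟨j, hj⟩
  simp only [adjacencyMatrix, SimpleGraph.adjMatrix_apply, zero_add] at h1
  rw [h1]
  by_cases hadj : G.Adj ⟨i, hi⟩ ⟨j, hj⟩
  · simp [hadj, edgeRel, hi, hj]
  · simp [hadj, edgeRel, hi, hj]

/-- The whole algorithm. -/
def findTriangulation (k Nr : ℕ) (P : Program) : Program :=
  .seq (setUp k) (.seq (fillTables Nr P) extract)

theorem Triple.findTriangulation {W B n k Nr S : ℕ} {P : Program} {μ : ℕ → ℕ}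
    (hk3 : 3 ≤ k) (hP : Multiplies P k μ) (hNr : P.RegsBelow Nr)
    {p : Fin n → EuclideanSpace ℝ (Fin 2)} (hp : IsConvexPolygon p) {G : SimpleGraph (Fin n)}
    {s : MachineState} (hs : s.IsInitial n (n * n)) (hG : StoredAt s.mem 0 (adjacencyMatrix G))
    (hB : 10 * (n * n) + (8 * (n * n) + (n * n + 2)) * (2 * n + 2) ^ k ≤ B)
    (hS : ∀ L, 2 ^ L ≤ 2 * n → ∑ c ∈ Finset.Ico 1 (4 ^ L), stepCost μ Nr (level c) ≤ S) :
    Triple W B (findTriangulation k Nr P) s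
      (S + (100 * n + 50 * (k + 1) + 3000 * (n * n) + 1400)) (IsCorrectAnswer p G) := by
  have hn := hp.1
  have hE := represents_edgeRel hG
  refine seq (T₁ := 100 * n + 400 + 50 * (k + 1)) (T₂ := S + (3000 * (n * n) + 1000))
    ((setUp (E := edgeRel G) hs (by omega) hB le_rfl).mono le_rfl ?_) (by omega)
  rintro σ₁ ⟨L, N, hN, hnN, hN2, ht₁, h7, h8⟩
  refine seq (T₁ := S + 600) (T₂ := 3000 * (n * n) + 400)
    ((fillTables hk3 hP hNr hN hE ht₁ h7 h8
      (Nat.add_le_add_right (hS L (hN ▸ hN2)) 600)).mono le_rfl ?_) (by omega)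
  intro σ₂ ht₂
  have h4 : (4 : ℕ) ^ L = N * N := by rw [hN, ← mul_pow]; norm_num
  have hpos : 1 ≤ (N + 2) ^ k := Nat.one_le_pow _ _ (by omega)
  have hbud := ht₂.budget
  have hmul : n * n + 2 ≤ (n * n + 2) * (N + 2) ^ k := Nat.le_mul_of_pos_right _ hpos
  refine (extract (N := N) (E := edgeRel G) (by omega) hnN (fun i j h => h.2.1) ht₂.r0 ht₂.r1
    ht₂.r2 rfl (fun i hi j hj => ⟨(ht₂.good i hi j hj).1, (ht₂.good i hi j hj).2.trans
      (and_iff_left ?_)⟩) (fun a ha ha' => ?_) (by have := ht₂.free; omega) (by omega)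
    le_rfl).mono le_rfl ?_
  -- All ranks are below 4 ^ L = N * N, so the finished table decides every cell.
  · rw [← h4]
    exact cellRank_lt (by omega) (by omega)
  · rw [ht₂.low a ha', hs.2.2 a ha]
  · rintro σ₃ (⟨h0, hg, w, hw, hmem⟩ | ⟨h0, hg⟩)
    · refine .inl ⟨h0, reachGraph n w, hw.isTriangulation hp hg, hw.reachGraph_le hg,
        fun i j => ?_⟩
      have hij := hmem i i.isLt j j.isLt
      have hadj := hw.reachGraph_adj hg (a := i) (b := j)
      simp only [adjacencyMatrix, SimpleGraph.adjMatrix_apply]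
      split_ifs with h
      · exact hij.2.2 (hadj.1 h)
      · have := mt hij.2.1 (mt hadj.2 h)
        omega
    · refine .inr ⟨h0, ?_⟩
      rintro ⟨T, hT, hTG⟩
      exact hg (hT.good hp hTG)

theorem IsCorrectAnswer.congr {n : ℕ} {p : Fin n → EuclideanSpace ℝ (Fin 2)}
    {G : SimpleGraph (Fin n)} {s σ : MachineState} (h : IsCorrectAnswer p G σ)
    (hag : s.Agree σ) : IsCorrectAnswer p G s := by
  rw [IsCorrectAnswer, hag.1, hag.2 0 (by norm_num)]
  exact h

theorem theorem3 (ω : ℝ) (hω : 2 < ω) (hmul : MatrixMultiplicationInTime ω) :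
    ∃ (P : Program) (k : ℕ) (K : ℝ), ∀ (n : ℕ) (p : Fin n → EuclideanSpace ℝ (Fin 2)),
      IsConvexPolygon p → ∀ (G : SimpleGraph (Fin n)) (s : MachineState),
        s.IsInitial n (n * n) → StoredAt s.mem 0 (adjacencyMatrix G) →
        ∃ (t : ℕ) (s' : MachineState), Exec ((n + 2) ^ k) P s t s' ∧
          (t : ℝ) ≤ K * (n : ℝ) ^ ω ∧ IsCorrectAnswer p G s' := by
  obtain ⟨P, k, K, hk, hK, hP⟩ := hmul.multiplies
  obtain ⟨Nr, hNr⟩ := P.exists_regsBelow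
  have h4 : (0 : ℝ) < 2 ^ ω - 4 := by
    have h : (2 : ℝ) ^ (2 : ℝ) < 2 ^ ω := Real.rpow_lt_rpow_of_exponent_lt (by norm_num) hω
    rw [Real.rpow_two] at h
    linarith
  set C : ℝ := (4 * K + 2 * Nr + 5700) * (3 / (2 ^ ω - 4)) with hC
  have hC0 : 0 ≤ C := by positivity
  refine ⟨findTriangulation k Nr P, 8 * (2 * k + 4) + 1,
    -- The factor 2 ^ ω comes from N ≤ 2 * n, and 4550 = 100 + 50 + 3000 + 1400 collects the terms
    -- outside the main sum.
    C * 2 ^ ω + (4550 + 50 * k), fun n p hp G s hs hG => ?_⟩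
  have hn := hp.1
  set S := ⌊C * ((2 * n : ℕ) : ℝ) ^ ω⌋₊ with hS
  have hsum : ∀ L, 2 ^ L ≤ 2 * n → ∑ c ∈ Finset.Ico 1 (4 ^ L),
      stepCost (fun m => ⌊K * (m : ℝ) ^ ω⌋₊) Nr (level c) ≤ S := by
    intro L hL
    refine Nat.le_floor ((sum_stepCost_le hω hK Nr L).trans ?_)
    refine mul_le_mul_of_nonneg_left (Real.rpow_le_rpow (by positivity) ?_ (by linarith)) hC0
    exact_mod_cast hL
  set B := 10 * (n * n) + (8 * (n * n) + (n * n + 2)) * (2 * n + 2) ^ k with hB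
  have hnn : 3 * 3 ≤ n * n := Nat.mul_le_mul hn hn
  have hnn' : n ≤ n * n := Nat.le_mul_self n
  obtain ⟨t, s', σ', hE, ht, hag, -, hans⟩ :=
    Triple.findTriangulation (W := (n + 2) ^ (8 * (2 * k + 4) + 1)) hk hP hNr hp hs hG hB.ge hsum
      (by omega) (size_bound hn) (fun r _ => by
        by_cases h : r = 0
        · rw [h, hs.1]; omega
        · rw [hs.2.1 r h]; omega) s ⟨rfl, fun _ _ => rfl⟩
  refine ⟨t, s', hE, ?_, hans.congr hag⟩
  have hn1 : (1 : ℝ) ≤ n := by exact_mod_cast (by omega : 1 ≤ n)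
  have hsq : (n : ℝ) * n ≤ (n : ℝ) ^ ω := by
    have := Real.rpow_le_rpow_of_exponent_le hn1 hω.le
    rwa [Real.rpow_two, sq] at this
  have hS' : (S : ℝ) ≤ C * (2 ^ ω * (n : ℝ) ^ ω) := by
    have h : (S : ℝ) ≤ C * ((2 * n : ℕ) : ℝ) ^ ω := Nat.floor_le (by positivity)
    rwa [Nat.cast_mul, Real.mul_rpow (by norm_num) (by positivity), Nat.cast_ofNat] at h
  have ht' : (t : ℝ) ≤ S + (100 * n + 50 * (k + 1) + 3000 * (n * n) + 1400) := by
    exact_mod_cast ht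
  have h1 : (1 : ℝ) ≤ (n : ℝ) ^ ω := Real.one_le_rpow hn1 (by linarith)
  have h2 : (n : ℝ) ≤ (n : ℝ) ^ ω := le_trans (by nlinarith) hsq
  have h3 : (k : ℝ) ≤ k * (n : ℝ) ^ ω := le_mul_of_one_le_right (by positivity) h1
  calc (t : ℝ) ≤ C * (2 ^ ω * (n : ℝ) ^ ω) + (100 * (n : ℝ) ^ ω +
        50 * (k * (n : ℝ) ^ ω + (n : ℝ) ^ ω) + 3000 * (n : ℝ) ^ ω + 1400 * (n : ℝ) ^ ω) := by
        linarith
    _ = (C * 2 ^ ω + (4550 + 50 * k)) * (n : ℝ) ^ ω := by ring
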